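/- Let $l\ge 1$, $r\ge 0$ and $n=rl$. Let $\mathfrak g=Q(n)$ be the complex queer Lie superalgebra of block matrices $\begin{pmatrix}A&B\\B&A\end{pmatrix}$ with $A,B\in\mathrm{Mat}_n(\mathbb C)$ ($A$ even, $B$ odd), with $e_{i,j}$ and $f_{i,j}$ its elements with $(A,B)=(E_{ij},0)$ and $(A,B)=(0,E_{ij})$, and with the odd invariant form $(x|y)=\mathrm{otr}(xy)$, where $\mathrm{otr}\begin{pmatrix}A&B\\B&A\end{pmatrix}=\mathrm{tr}\,B$. Put $$E=\sum_{p=1}^{r}\sum_{i=1}^{l-1}f_{l(p-1)+i,\,l(p-1)+i+1},\qquad h=\sum_{p=1}^{r}\sum_{i=1}^{l}(l-2i+1)\,e_{l(p-1)+i,\,l(p-1)+i},$$ so that the odd part of $E$ is a nilpotent matrix all of whose Jordan blocks have size $l$. Let $\chi\in\mathfrak g^*$ be the even functional $\chi(x)=(x|E)$, let $\mathfrak g^\chi=\{x\in\mathfrak g:\chi([x,\mathfrak g])=0\}$ be its annihilator, let $\mathfrak g_j=\{x\in\mathfrak g:[h,x]=jx\}$ for $j\in\mathbb Z$, and let $\mathfrak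 m=\bigoplus_{j\le -2}\mathfrak g_j$. Let $I_\chi$ be the left ideal of $U(\mathfrak g)$ generated by all $a-\chi(a)$ with $a\in\mathfrak m$, let $Q_\chi=U(\mathfrak g)/I_\chi$, and let $W_\chi=\mathrm{End}_{U(\mathfrak g)}(Q_\chi)^{\mathrm{op}}$ be the finite $W$-algebra. The map $\varphi\mapsto\varphi(1+I_\chi)$ identifies $W_\chi$ with a subspace of $Q_\chi$, with product $(y_1+I_\chi)(y_2+I_\chi)=y_1y_2+I_\chi$. The Kazhdan filtration of $U(\mathfrak g)$ is the one induced by the grading of the tensor algebra of $\mathfrak g$ in which the elements of $\mathfrak g_j$ have degree $j+2$; it induces filtrations of $Q_\chi$ and of $W_\chi$. Let $Gr_KW_\chi$ be the associated graded algebra of $W_\chi$. Then $\mathfrak g=\bigoplus_j\mathfrak g_j$ is a $\mathbb Z$-grading of the Lie superalgebra $\mathfrak g$ that is good for $\chi$ (that is, $\chi(\mathfrak g_j)=0$ for $j\ne-2$, and $\mathfrak g^\chi\subseteq\bigoplus_{j\ge0}\mathfrak g_j$), one has $\mathfrak g_{-1}=0$, and there is an isomorphism of associative superalgebras $$Gr_KW_\chi\;\cong\;S(\mathfrak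 g^\chi)$$ with the symmetric superalgebra of $\mathfrak g^\chi$. It can be chosen to be also an isomorphism of $\mathbb Z$-graded algebras, where $\mathfrak g^\chi\cap\mathfrak g_j$ has degree $j+2$ in $S(\mathfrak g^\chi)$. -/

import Mathlib

open scoped DirectSum

noncomputable section

namespace QueerW

/-! ### The queer Lie superalgebra -/

/-- The queer Lie superalgebra with matrices indexed by `ι`. The element with
even part `A` and odd part `B` stands for the block matrix with rows `A B` and `B A` (see
`Queer.toBlock`). -/
@[ext] structure Queer (ι : Type) where
  even : Matrix ι ι ℂ
  odd : Matrix ι ι ℂ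

namespace Queer

variable {ι : Type}

/-- The pair of the even part and the odd part. -/
def equivProd : Queer ι ≃ Matrix ι ι ℂ × Matrix ι ι ℂ where
  toFun x := (x.even, x.odd)
  invFun p := ⟨p.1, p.2⟩
  left_inv _ := rfl
  right_inv _ := rfl

instance : AddCommGroup (Queer ι) := equivProd.addCommGroup

instance : Module ℂ (Queer ι) := equivProd.module ℂ

@[simp] theorem add_even (x y : Queer ι) : (x + y).even = x.even + y.even := rfl
@[simp] theorem add_odd (x y : Queer ι) : (x + y).odd = x.odd + y.odd := rfl
@[simp] theorem zero_even : (0 : Queer ι).even = 0 := rfl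
@[simp] theorem zero_odd : (0 : Queer ι).odd = 0 := rfl
@[simp] theorem smul_even (c : ℂ) (x : Queer ι) : (c • x).even = c • x.even := rfl
@[simp] theorem smul_odd (c : ℂ) (x : Queer ι) : (c • x).odd = c • x.odd := rfl

/-- The even part (`a = 0`) and the odd part (`a = 1`). -/
def parity (a : ZMod 2) : Submodule ℂ (Queer ι) where
  carrier := {x | if a = 0 then x.odd = 0 else x.even = 0}
  add_mem' := by
    intro x y hx hy
    by_cases h : a = 0 <;> simp_all
  zero_mem' := by simp
  smul_mem' := by
    intro c x hx
    by_cases h : a = 0 <;> simp_all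

theorem mem_parity_zero {x : Queer ι} : x ∈ parity 0 ↔ x.odd = 0 := Iff.rfl

theorem mem_parity_one {x : Queer ι} : x ∈ parity 1 ↔ x.even = 0 := Iff.rfl

variable [Fintype ι]

/-- The product of block matrices. -/
def mul (x y : Queer ι) : Queer ι :=
  ⟨x.even * y.even + x.odd * y.odd, x.even * y.odd + x.odd * y.even⟩

/-- The superbracket: the bilinear extension of `x y - (-1) ^ (p(x) p(y)) y x` (see
`Queer.toBlock_bracket`). -/
instance : Bracket (Queer ι) (Queer ι) where
  bracket x y := ⟨x.even * y.even - y.even * x.even + (x.odd * y.odd + y.odd * x.odd),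
    x.even * y.odd - y.odd * x.even + (x.odd * y.even - y.even * x.odd)⟩

@[simp] theorem bracket_even (x y : Queer ι) :
    ⁅x, y⁆.even = x.even * y.even - y.even * x.even + (x.odd * y.odd + y.odd * x.odd) := rfl
@[simp] theorem bracket_odd (x y : Queer ι) :
    ⁅x, y⁆.odd = x.even * y.odd - y.odd * x.even + (x.odd * y.even - y.even * x.odd) := rfl

theorem bracket_add (x y z : Queer ι) : ⁅x, y + z⁆ = ⁅x, y⁆ + ⁅x, z⁆ := by
  ext1 <;> simp [mul_add, add_mul] <;> abel

theorem add_bracket (x y z : Queer ι) : ⁅x + y, z⁆ = ⁅x, z⁆ + ⁅y, z⁆ := by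
  ext1 <;> simp [mul_add, add_mul] <;> abel

theorem bracket_smul (c : ℂ) (x y : Queer ι) : ⁅x, c • y⁆ = c • ⁅x, y⁆ := by
  ext1 <;> simp [smul_sub, smul_add]

theorem smul_bracket (c : ℂ) (x y : Queer ι) : ⁅c • x, y⁆ = c • ⁅x, y⁆ := by
  ext1 <;> simp [smul_sub, smul_add]

/-- The invariant odd bilinear form `(x | y) = otr (x y)`, where `otr x` is the trace of the odd
part of `x`. -/
def form (x y : Queer ι) : ℂ := Matrix.trace (mul x y).odd

end Queer

/-- The sign `(-1) ^ (a b)` of parities `a` and `b`. -/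
def superSign (a b : ZMod 2) : ℂ := if a = 1 ∧ b = 1 then -1 else 1

namespace Queer

variable {ι : Type}

/-- The block matrix of an element of the queer Lie superalgebra. -/
def toBlock (x : Queer ι) : Matrix (ι ⊕ ι) (ι ⊕ ι) ℂ := Matrix.fromBlocks x.even x.odd x.odd x.even

theorem toBlock_mul [Fintype ι] (x y : Queer ι) : toBlock (mul x y) = toBlock x * toBlock y := by
  simp [toBlock, mul, Matrix.fromBlocks_multiply, add_comm]

theorem toBlock_bracket [Fintype ι] (a b : ZMod 2) (x y : Queer ι) (hx : x ∈ parity a)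
    (hy : y ∈ parity b) :
    toBlock ⁅x, y⁆ = toBlock x * toBlock y - superSign a b • (toBlock y * toBlock x) := by
  obtain rfl | rfl : a = 0 ∨ a = 1 := by clear hx hy; revert a; decide
  all_goals obtain rfl | rfl : b = 0 ∨ b = 1 := by clear hx hy; revert b; decide
  all_goals
    simp only [mem_parity_zero, mem_parity_one] at hx hy
    simp [toBlock, superSign, Matrix.fromBlocks_multiply, hx, hy, sub_eq_add_neg,
      Matrix.fromBlocks_neg, Matrix.fromBlocks_add]

end Queer

/-! ### Enveloping superalgebras and symmetric superalgebras -/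

/-- The defining relations `x y - (-1) ^ (p(x) p(y)) y x = [x, y]`, for homogeneous `x` and `y`, of
the universal enveloping superalgebra. -/
inductive EnvRel (ι : Type) [Fintype ι] :
    TensorAlgebra ℂ (Queer ι) → TensorAlgebra ℂ (Queer ι) → Prop
  | bracket (a b : ZMod 2) (x y : Queer ι) (hx : x ∈ Queer.parity a) (hy : y ∈ Queer.parity b) :
      EnvRel ι
        (TensorAlgebra.ι ℂ x * TensorAlgebra.ι ℂ y
          - superSign a b • (TensorAlgebra.ι ℂ y * TensorAlgebra.ι ℂ x))
        (TensorAlgebra.ι ℂ ⁅x, y⁆)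

/-- The universal enveloping superalgebra of the queer Lie superalgebra. -/
def Env (ι : Type) [Fintype ι] : Type := RingQuot (EnvRel ι)

instance (ι : Type) [Fintype ι] : Ring (Env ι) := inferInstanceAs (Ring (RingQuot (EnvRel ι)))

instance (ι : Type) [Fintype ι] : Algebra ℂ (Env ι) :=
  inferInstanceAs (Algebra ℂ (RingQuot (EnvRel ι)))

/-- The canonical map from the Lie superalgebra to its enveloping superalgebra. -/
def Env.of (ι : Type) [Fintype ι] : Queer ι →ₗ[ℂ] Env ι :=
  (RingQuot.mkAlgHom ℂ (EnvRel ι)).toLinearMap ∘ₗ TensorAlgebra.ι ℂ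

/-- The defining relations `x y = (-1) ^ (p(x) p(y)) y x`, for homogeneous `x` and `y`, of the
symmetric superalgebra of the superspace `V` with homogeneous parts `P 0` and `P 1`. -/
inductive SymRel {V : Type} [AddCommGroup V] [Module ℂ V] (P : ZMod 2 → Submodule ℂ V) :
    TensorAlgebra ℂ V → TensorAlgebra ℂ V → Prop
  | comm (a b : ZMod 2) (x y : V) (hx : x ∈ P a) (hy : y ∈ P b) :
      SymRel P (TensorAlgebra.ι ℂ x * TensorAlgebra.ι ℂ y)
        (superSign a b • (TensorAlgebra.ι ℂ y * TensorAlgebra.ι ℂ x))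

/-- The symmetric superalgebra of a superspace. -/
def SuperSym {V : Type} [AddCommGroup V] [Module ℂ V] (P : ZMod 2 → Submodule ℂ V) : Type :=
  RingQuot (SymRel P)

section SuperSym

variable {V : Type} [AddCommGroup V] [Module ℂ V] (P : ZMod 2 → Submodule ℂ V)

instance : Ring (SuperSym P) := inferInstanceAs (Ring (RingQuot (SymRel P)))

instance : Algebra ℂ (SuperSym P) := inferInstanceAs (Algebra ℂ (RingQuot (SymRel P)))

/-- The canonical map from a superspace to its symmetric superalgebra. -/
def SuperSym.of : V →ₗ[ℂ] SuperSym P :=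
  (RingQuot.mkAlgHom ℂ (SymRel P)).toLinearMap ∘ₗ TensorAlgebra.ι ℂ

end SuperSym

/-- For a family `D` of subspaces of `V` (the vectors of degree `d` being those of `D d`) and a
linear map `f` to an algebra, the span of all products `f v₁ ⋯ f vₛ` of homogeneous vectors of total
degree `k`; this is the image of the degree `k` part of the tensor algebra of `V`. -/
def degreePart {V A κ : Type} [AddCommGroup V] [Module ℂ V] [Ring A] [Algebra ℂ A] [AddMonoid κ]
    (f : V →ₗ[ℂ] A) (D : κ → Submodule ℂ V) (k : κ) : Submodule ℂ A :=
  Submodule.span ℂ {x | ∃ L : List (κ × V), (∀ p ∈ L, p.2 ∈ D p.1) ∧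
    (L.map Prod.fst).sum = k ∧ x = (L.map fun p => f p.2).prod}

section degreePart

variable {V A κ : Type} [AddCommGroup V] [Module ℂ V] [Ring A] [Algebra ℂ A] [AddMonoid κ]
    (f : V →ₗ[ℂ] A) (D : κ → Submodule ℂ V)

theorem one_mem_degreePart : (1 : A) ∈ degreePart f D 0 :=
  Submodule.subset_span ⟨[], by simp, by simp, by simp⟩

theorem degreePart_mul_le (a b : κ) :
    degreePart f D a * degreePart f D b ≤ degreePart f D (a + b) := by
  unfold degreePart
  rw [Submodule.span_mul_span, Submodule.span_le]
  rintro _ ⟨_, ⟨L, hL, rfl, rfl⟩, _, ⟨M, hM, rfl, rfl⟩, rfl⟩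
  refine Submodule.subset_span ⟨L ++ M, ?_, by simp, by simp⟩
  intro p hp
  rcases List.mem_append.1 hp with h | h
  · exact hL p h
  · exact hM p h

end degreePart

/-! ### Filtered algebras and associated graded algebras -/

/-- An increasing filtration of an algebra, indexed by the integers. -/
structure AlgFiltration (A : Type) [Ring A] [Algebra ℂ A] where
  F : ℤ → Submodule ℂ A
  mono : Monotone F
  one_mem : (1 : A) ∈ F 0
  mul_mem : ∀ {i j : ℤ} {x y : A}, x ∈ F i → y ∈ F j → x * y ∈ F (i + j)

namespace AlgFiltration

variable {A : Type} [Ring A] [Algebra ℂ A] (Φ : AlgFiltration A)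

/-- `F (k - 1)` as a subspace of `F k`. -/
abbrev lower (k : ℤ) : Submodule ℂ (Φ.F k) := (Φ.F (k - 1)).comap (Φ.F k).subtype

/-- The component `F k / F (k - 1)` of the associated graded algebra. -/
def Piece (k : ℤ) : Type := Φ.F k ⧸ Φ.lower k

instance (k : ℤ) : AddCommGroup (Φ.Piece k) := inferInstanceAs (AddCommGroup (Φ.F k ⧸ Φ.lower k))

instance (k : ℤ) : Module ℂ (Φ.Piece k) := inferInstanceAs (Module ℂ (Φ.F k ⧸ Φ.lower k))

/-- The symbol in degree `k` of an element of `F k`. -/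
def symb (k : ℤ) : Φ.F k →ₗ[ℂ] Φ.Piece k := (Φ.lower k).mkQ

theorem symb_surjective (k : ℤ) : Function.Surjective (Φ.symb k) :=
  Submodule.mkQ_surjective _

theorem symb_eq {k : ℤ} {x y : Φ.F k} (h : (x : A) = y) : Φ.symb k x = Φ.symb k y := by
  rw [Subtype.ext h]

theorem gmk_eq {i j : ℤ} (h : i = j) (x : Φ.F i) (y : Φ.F j) (hxy : (x : A) = y) :
    GradedMonoid.mk (A := Φ.Piece) i (Φ.symb i x) = GradedMonoid.mk j (Φ.symb j y) := by
  subst h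
  rw [Φ.symb_eq hxy]

/-- Multiplication `F i × F j → F (i + j)`. -/
def mulF (i j : ℤ) : Φ.F i →ₗ[ℂ] Φ.F j →ₗ[ℂ] Φ.F (i + j) :=
  LinearMap.mk₂ ℂ (fun x y => ⟨x * y, Φ.mul_mem x.2 y.2⟩)
    (fun _ _ _ => Subtype.ext (add_mul _ _ _)) (fun _ _ _ => Subtype.ext (smul_mul_assoc _ _ _))
    (fun _ _ _ => Subtype.ext (mul_add _ _ _)) (fun _ _ _ => Subtype.ext (mul_smul_comm _ _ _))

@[simp] theorem coe_mulF (i j : ℤ) (x : Φ.F i) (y : Φ.F j) :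
    (Φ.mulF i j x y : A) = x * y := rfl

theorem symb_mulF_eq_zero_right {i j : ℤ} (x : Φ.F i) (y : Φ.F j) (hy : (y : A) ∈ Φ.F (j - 1)) :
    Φ.symb (i + j) (Φ.mulF i j x y) = 0 := by
  have h : (x : A) * y ∈ Φ.F (i + j - 1) := by
    rw [show i + j - 1 = i + (j - 1) by ring]
    exact Φ.mul_mem x.2 hy
  exact (Submodule.Quotient.mk_eq_zero (Φ.lower (i + j))).2 h

theorem symb_mulF_eq_zero_left {i j : ℤ} (x : Φ.F i) (y : Φ.F j) (hx : (x : A) ∈ Φ.F (i - 1)) :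
    Φ.symb (i + j) (Φ.mulF i j x y) = 0 := by
  have h : (x : A) * y ∈ Φ.F (i + j - 1) := by
    rw [show i + j - 1 = i - 1 + j by ring]
    exact Φ.mul_mem hx y.2
  exact (Submodule.Quotient.mk_eq_zero (Φ.lower (i + j))).2 h

/-- Left multiplication of symbols by an element of `F i`. -/
def mulPieceAux (i j : ℤ) : Φ.F i →ₗ[ℂ] Φ.Piece j →ₗ[ℂ] Φ.Piece (i + j) where
  toFun x := (Φ.lower j).liftQ (Φ.symb (i + j) ∘ₗ Φ.mulF i j x)
    fun y hy => Φ.symb_mulF_eq_zero_right x y hy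
  map_add' x x' := by
    refine LinearMap.ext fun y => ?_
    obtain ⟨y, rfl⟩ := Φ.symb_surjective j y
    change Φ.symb (i + j) (Φ.mulF i j (x + x') y) =
      Φ.symb (i + j) (Φ.mulF i j x y) + Φ.symb (i + j) (Φ.mulF i j x' y)
    rw [map_add, LinearMap.add_apply, map_add]
  map_smul' c x := by
    refine LinearMap.ext fun y => ?_
    obtain ⟨y, rfl⟩ := Φ.symb_surjective j y
    change Φ.symb (i + j) (Φ.mulF i j (c • x) y) = c • Φ.symb (i + j) (Φ.mulF i j x y)
    rw [map_smul, LinearMap.smul_apply, map_smul]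

/-- Multiplication of symbols: the product of the symbols of `x` in degree `i` and of `y` in degree
`j` is the symbol of `x y` in degree `i + j`. -/
def mulPiece (i j : ℤ) : Φ.Piece i →ₗ[ℂ] Φ.Piece j →ₗ[ℂ] Φ.Piece (i + j) :=
  (Φ.lower i).liftQ (Φ.mulPieceAux i j) fun x hx => by
    refine LinearMap.mem_ker.2 (LinearMap.ext fun y => ?_)
    obtain ⟨y, rfl⟩ := Φ.symb_surjective j y
    exact Φ.symb_mulF_eq_zero_left x y hx

@[simp] theorem mulPiece_symb (i j : ℤ) (x : Φ.F i) (y : Φ.F j) :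
    Φ.mulPiece i j (Φ.symb i x) (Φ.symb j y) = Φ.symb (i + j) (Φ.mulF i j x y) := rfl

instance : GradedMonoid.GMul Φ.Piece where
  mul {i j} x y := Φ.mulPiece i j x y

instance : GradedMonoid.GOne Φ.Piece where
  one := Φ.symb 0 ⟨1, Φ.one_mem⟩

theorem gmul_symb {i j : ℤ} (x : Φ.F i) (y : Φ.F j) :
    GradedMonoid.mk (A := Φ.Piece) i (Φ.symb i x) * GradedMonoid.mk j (Φ.symb j y)
      = GradedMonoid.mk (i + j) (Φ.symb (i + j) (Φ.mulF i j x y)) := rfl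

theorem gone_symb : (1 : GradedMonoid Φ.Piece) = GradedMonoid.mk 0 (Φ.symb 0 ⟨1, Φ.one_mem⟩) := rfl

instance : DirectSum.GRing Φ.Piece where
  one_mul := by
    rintro ⟨i, x⟩
    obtain ⟨x, rfl⟩ := Φ.symb_surjective i x
    exact Φ.gmk_eq (zero_add i) (Φ.mulF 0 i ⟨1, Φ.one_mem⟩ x) x (by simp)
  mul_one := by
    rintro ⟨i, x⟩
    obtain ⟨x, rfl⟩ := Φ.symb_surjective i x
    exact Φ.gmk_eq (add_zero i) (Φ.mulF i 0 x ⟨1, Φ.one_mem⟩) x (by simp)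
  mul_assoc := by
    rintro ⟨i, x⟩ ⟨j, y⟩ ⟨k, z⟩
    obtain ⟨x, rfl⟩ := Φ.symb_surjective i x
    obtain ⟨y, rfl⟩ := Φ.symb_surjective j y
    obtain ⟨z, rfl⟩ := Φ.symb_surjective k z
    exact Φ.gmk_eq (add_assoc i j k) (Φ.mulF (i + j) k (Φ.mulF i j x y) z)
      (Φ.mulF i (j + k) x (Φ.mulF j k y z)) (by simp [mul_assoc])
  mul_zero := fun {i j} a => map_zero (Φ.mulPiece i j a)
  zero_mul := fun {i j} b => by
    change Φ.mulPiece i j 0 b = 0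
    rw [map_zero, LinearMap.zero_apply]
  mul_add := fun {i j} a b c => map_add (Φ.mulPiece i j a) b c
  add_mul := fun {i j} a b c => by
    change Φ.mulPiece i j (a + b) c = Φ.mulPiece i j a c + Φ.mulPiece i j b c
    rw [map_add, LinearMap.add_apply]
  natCast := fun n => n • Φ.symb 0 ⟨1, Φ.one_mem⟩
  natCast_zero := zero_smul _ _
  natCast_succ := fun n => succ_nsmul _ _
  intCast := fun n => n • Φ.symb 0 ⟨1, Φ.one_mem⟩
  intCast_ofNat := fun n => by simp
  intCast_negSucc_ofNat := fun n => negSucc_zsmul _ _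

instance : DirectSum.GAlgebra ℂ Φ.Piece where
  toFun := (LinearMap.toSpanSingleton ℂ (Φ.Piece 0) (Φ.symb 0 ⟨1, Φ.one_mem⟩)).toAddMonoidHom
  map_one := by
    change (1 : ℂ) • Φ.symb 0 ⟨1, Φ.one_mem⟩ = _
    rw [one_smul]; rfl
  map_mul := by
    intro r s
    exact Φ.gmk_eq (add_zero 0).symm ((r * s) • ⟨1, Φ.one_mem⟩)
      (Φ.mulF 0 0 (r • ⟨1, Φ.one_mem⟩) (s • ⟨1, Φ.one_mem⟩)) (by
        rw [coe_mulF]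
        simp [mul_smul, smul_comm r s])
  commutes := by
    rintro r ⟨i, x⟩
    obtain ⟨x, rfl⟩ := Φ.symb_surjective i x
    exact Φ.gmk_eq (add_comm 0 i) (Φ.mulF 0 i (r • ⟨1, Φ.one_mem⟩) x)
      (Φ.mulF i 0 x (r • ⟨1, Φ.one_mem⟩)) (by simp)
  smul_def := by
    rintro r ⟨i, x⟩
    obtain ⟨x, rfl⟩ := Φ.symb_surjective i x
    exact Φ.gmk_eq (zero_add i).symm (r • x) (Φ.mulF 0 i (r • ⟨1, Φ.one_mem⟩) x) (by simp)

/-- The associated graded algebra `⨁ F k / F (k - 1)`. -/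
abbrev Gr : Type := ⨁ k : ℤ, Φ.Piece k

/-- The homogeneous component of degree `k` of the associated graded algebra. -/
def grDegree (k : ℤ) : Submodule ℂ Φ.Gr := LinearMap.range (DirectSum.lof ℂ ℤ Φ.Piece k)

/-- The subspace of the associated graded algebra spanned by the symbols of the elements of `P`. -/
def grSub (P : Submodule ℂ A) : Submodule ℂ Φ.Gr :=
  ⨆ k : ℤ, (P.comap (Φ.F k).subtype).map (DirectSum.lof ℂ ℤ Φ.Piece k ∘ₗ Φ.symb k)

end AlgFiltration

/-! ### The nilpotent element, the Dynkin grading and the annihilator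

The queer Lie superalgebra `Q(n)` with `n = r l` is realized with the index set `Fin r × Fin l`: the
pair `(p, i)` (counted from `0`) is the index `l p + i` of the usual numbering. -/

/-- The matrix with `r` nilpotent Jordan blocks, each of size `l`. -/
def jordan (r l : ℕ) : Matrix (Fin r × Fin l) (Fin r × Fin l) ℂ :=
  Matrix.of fun a b => if a.1 = b.1 ∧ (b.2 : ℕ) = a.2 + 1 then 1 else 0

/-- The odd element `E` with odd part `jordan r l`. -/
def oddE (r l : ℕ) : Queer (Fin r × Fin l) := ⟨0, jordan r l⟩

/-- The even semisimple element `h`, with diagonal entries `l - 1, l - 3, …, 1 - l` in each block. -/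
def cartanH (r l : ℕ) : Queer (Fin r × Fin l) :=
  ⟨Matrix.diagonal fun a => (l : ℂ) - 1 - 2 * (a.2 : ℕ), 0⟩

/-- The even linear functional `χ(x) = (x | E)`. -/
def chi (r l : ℕ) : Queer (Fin r × Fin l) →ₗ[ℂ] ℂ where
  toFun x := Queer.form x (oddE r l)
  map_add' x y := by simp [Queer.form, Queer.mul, add_mul, oddE]
  map_smul' c x := by simp [Queer.form, Queer.mul, oddE]

/-- The Dynkin grading, by the eigenspaces of `ad h`. -/
def dynkin (r l : ℕ) (j : ℤ) : Submodule ℂ (Queer (Fin r × Fin l)) where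
  carrier := {x | ⁅cartanH r l, x⁆ = (j : ℂ) • x}
  add_mem' := by
    intro x y hx hy
    simp only [Set.mem_ofPred_eq] at hx hy ⊢
    rw [Queer.bracket_add, hx, hy, smul_add]
  zero_mem' := by
    simp only [Set.mem_ofPred_eq]
    ext1 <;> simp
  smul_mem' := by
    intro c x hx
    simp only [Set.mem_ofPred_eq] at hx ⊢
    rw [Queer.bracket_smul, hx, smul_comm]

/-- The annihilator of a linear functional `χ`: all `x` with `χ([x, y]) = 0` for all `y`. -/
def annihilator {ι : Type} [Fintype ι] (χ : Queer ι →ₗ[ℂ] ℂ) : Submodule ℂ (Queer ι) where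
  carrier := {x | ∀ y, χ ⁅x, y⁆ = 0}
  add_mem' := by
    intro x x' hx hx' y
    rw [Queer.add_bracket, map_add, hx y, hx' y, add_zero]
  zero_mem' := by
    intro y
    rw [← zero_smul ℂ (0 : Queer ι), Queer.smul_bracket, zero_smul, map_zero]
  smul_mem' := by
    intro c x hx y
    rw [Queer.smul_bracket, map_smul, hx y, smul_zero]

/-- `G` is a `ℤ`-grading of the Lie superalgebra that is good for `χ`. -/
structure IsGoodGrading {ι : Type} [Fintype ι] (G : ℤ → Submodule ℂ (Queer ι))
    (χ : Queer ι →ₗ[ℂ] ℂ) : Prop where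
  internal : DirectSum.IsInternal G
  bracket_mem : ∀ i j x y, x ∈ G i → y ∈ G j → ⁅x, y⁆ ∈ G (i + j)
  parity : ∀ j, G j = ⨆ a, G j ⊓ Queer.parity a
  chi_eq_zero : ∀ j, j ≠ -2 → ∀ x ∈ G j, χ x = 0
  annihilator_le : annihilator χ ≤ ⨆ j : ℤ, ⨆ _ : 0 ≤ j, G j

/-! ### The finite `W`-algebra and its Kazhdan filtration -/

variable (r l : ℕ)

/-- The enveloping superalgebra `U(Q(n))`, `n = r l`. -/
abbrev UQ : Type := Env (Fin r × Fin l)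

/-- The subalgebra `m`, the sum of the components of degree at most `-2`. (The component of degree
`-1` is zero.) -/
def nilM : Submodule ℂ (Queer (Fin r × Fin l)) := ⨆ j : ℤ, ⨆ _ : j ≤ -2, dynkin r l j

/-- The left ideal of `U(Q(n))` generated by `a - χ(a)` for all `a` in `m`. -/
def whittakerIdeal : Ideal (UQ r l) :=
  Ideal.span {u | ∃ a ∈ nilM r l, u = Env.of _ a - algebraMap ℂ (UQ r l) (chi r l a)}

/-- The generalized Whittaker module. -/
abbrev WhittakerModule : Type := UQ r l ⧸ whittakerIdeal r l

/-- The projection from `U(Q(n))` to the generalized Whittaker module. -/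
def proj : UQ r l →ₗ[ℂ] WhittakerModule r l := (whittakerIdeal r l).mkQ.restrictScalars ℂ

/-- The finite `W`-algebra: the opposite of the algebra of all `U(Q(n))`-linear endomorphisms of the
generalized Whittaker module. An endomorphism `φ` is determined by `φ (proj 1) = proj y`, and in the
opposite algebra the elements of `proj y₁` and `proj y₂` have the product of `proj (y₁ y₂)`. -/
abbrev WAlg : Type := (Module.End (UQ r l) (WhittakerModule r l))ᵐᵒᵖ

/-- The embedding of the finite `W`-algebra in the generalized Whittaker module. -/
def evalOne : WAlg r l →ₗ[ℂ] WhittakerModule r l where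
  toFun w := w.unop (proj r l 1)
  map_add' _ _ := rfl
  map_smul' _ _ := rfl

/-- The Kazhdan filtration of `U(Q(n))`: spanned by the products of homogeneous elements of total
degree at most `k`, where the vectors of Dynkin degree `j` have degree `j + 2`. -/
def kazhdanU (k : ℤ) : Submodule ℂ (UQ r l) :=
  ⨆ d : ℤ, ⨆ _ : d ≤ k, degreePart (Env.of _) (fun d => dynkin r l (d - 2)) d

theorem kazhdanU_mono : Monotone (kazhdanU r l) := by
  intro i j hij
  exact iSup_le fun d => iSup_le fun hd => le_iSup₂_of_le d (hd.trans hij) le_rfl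

theorem one_mem_kazhdanU : (1 : UQ r l) ∈ kazhdanU r l 0 :=
  (le_iSup₂_of_le (f := fun (d : ℤ) (_ : d ≤ 0) =>
    degreePart (Env.of _) (fun d => dynkin r l (d - 2)) d) 0 le_rfl le_rfl)
    (one_mem_degreePart _ _)

theorem mul_mem_kazhdanU {i j : ℤ} {x y : UQ r l} (hx : x ∈ kazhdanU r l i)
    (hy : y ∈ kazhdanU r l j) : x * y ∈ kazhdanU r l (i + j) := by
  have h : kazhdanU r l i * kazhdanU r l j ≤ kazhdanU r l (i + j) := by
    conv_lhs => unfold kazhdanU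
    simp only [Submodule.iSup_mul, Submodule.mul_iSup]
    refine iSup_le fun a => iSup_le fun ha => iSup_le fun b => iSup_le fun hb => ?_
    exact (degreePart_mul_le _ _ _ _).trans
      (le_iSup₂_of_le (f := fun (d : ℤ) (_ : d ≤ i + j) =>
        degreePart (Env.of _) (fun d => dynkin r l (d - 2)) d) _ (add_le_add ‹_› ‹_›) le_rfl)
  exact h (Submodule.mul_mem_mul hx hy)

/-- The Kazhdan filtration of the finite `W`-algebra, induced from the generalized Whittaker module,
where it is the image of the Kazhdan filtration of `U(Q(n))`. -/
def kazhdanW : AlgFiltration (WAlg r l) where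
  F k := ((kazhdanU r l k).map (proj r l)).comap (evalOne r l)
  mono := fun i j hij => Submodule.comap_mono (Submodule.map_mono (kazhdanU_mono r l hij))
  one_mem := ⟨1, one_mem_kazhdanU r l, rfl⟩
  mul_mem := by
    rintro i j v w ⟨x, hx, hxv⟩ ⟨y, hy, hyw⟩
    refine ⟨x * y, mul_mem_kazhdanU r l hx hy, ?_⟩
    have hv : v.unop (proj r l 1) = proj r l x := hxv.symm
    have hw : w.unop (proj r l 1) = proj r l y := hyw.symm
    have hp : ∀ a b : UQ r l, proj r l (a * b) = a • proj r l b := fun a b => rfl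
    change _ = w.unop (v.unop (proj r l 1))
    rw [hv, hp, ← hw, ← map_smul, ← hp, mul_one]

/-- The even part (`a = 0`) and the odd part (`a = 1`) of `U(Q(n))`. -/
def parityU (a : ZMod 2) : Submodule ℂ (UQ r l) := degreePart (Env.of _) Queer.parity a

/-- The even part and the odd part of the finite `W`-algebra. -/
def parityW (a : ZMod 2) : Submodule ℂ (WAlg r l) :=
  ((parityU r l a).map (proj r l)).comap (evalOne r l)

/-! ### The symmetric superalgebra of the annihilator -/

/-- The annihilator of `χ` in `Q(n)`. -/
abbrev gChi : Submodule ℂ (Queer (Fin r × Fin l)) := annihilator (chi r l)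

/-- The even part and the odd part of the annihilator of `χ`. -/
def gChiParity (a : ZMod 2) : Submodule ℂ (gChi r l) := (Queer.parity a).comap (gChi r l).subtype

/-- The vectors of Kazhdan degree `d`, that is, of Dynkin degree `d - 2`, in the annihilator. -/
def gChiDegree (d : ℤ) : Submodule ℂ (gChi r l) := (dynkin r l (d - 2)).comap (gChi r l).subtype

/-- The symmetric superalgebra of the annihilator of `χ`. -/
abbrev SGChi : Type := SuperSym (gChiParity r l)

/-- The component of Kazhdan degree `d` of the symmetric superalgebra of the annihilator. -/
def symDegree (d : ℤ) : Submodule ℂ (SGChi r l) := degreePart (SuperSym.of _) (gChiDegree r l) d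

/-- The even part and the odd part of the symmetric superalgebra of the annihilator. -/
def symParity (a : ZMod 2) : Submodule ℂ (SGChi r l) := degreePart (SuperSym.of _) (gChiParity r l) a

end QueerW

end

/-!
The finite `W`-algebra is studied inside the generalized Whittaker module, through its embedding
`evalOne`, whose image consists of vectors annihilated by all `a - χ(a)` with `a` in `m` (Whittaker
vectors). All arguments are computations with words in the letters `gen x = x - χ(x)`, where `x`
runs over the standard basis of `Q(n)`. Two letters supercommute up to words of at most one letter,
and the Kazhdan degree drops by two (`gen_superComm`). Hence, in a fixed Kazhdan degree and modulo
lower degrees, words may be reordered up to sign, and the number of letters serves as a second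
filtration.

*The Whittaker module.* The Poincaré–Birkhoff–Witt theorem for `U(Q(n))`
(`linearIndependent_normal`) is proved by letting the matrix coefficients of the defining
representation act on `U(Q(n))` through the comultiplication. On words they act, up to shorter
words, as twisted derivations that remove one prescribed letter, so that their composites detect the
leading words. It follows that the monomials in letters of positive Kazhdan degree form a basis of
the Whittaker module (`qbasis`).

*Upper bound.* A letter `z` of nonpositive degree acts on words as the contraction with the form
`χ([z, y])`, up to longer words (`gen_smul_mon_sub_der_mem`). The letters `y` that it contracts are
a letter outside the first rows of the Jordan blocks and the letter one step up along the same
diagonal. So the leading term of a Whittaker vector is determined by its coefficients at the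
monomials in the letters of the first rows (`mem_kazhdanQ_pred_of_whittaker`).

*Lower bound.* Sergeev's elements `serg m c a b`, which are entries of signed powers of the matrix
of generators of `U(Q(n))`, supercommute with the generators like matrix units (`even_mul_serg`,
`odd_mul_serg`). Those in the last row and the first column of the blocks are therefore Whittaker
vectors (`gen_smul_proj_wgenU`). The one for the power `l + n` has as its leading term, up to longer
words and words with letters outside the first rows, the letter in the first row and in column `n`
(`proj_wgenU_lead`). By triangularity with respect to the number of letters, the monomials in these
elements are linearly independent modulo lower degrees (`linearIndependent_lead`), and by the upper
bound they span (`exists_sub_mem_pred`). Their supercommutators have lower degree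
(`wgen_superCommutator_mem`), so the associated graded algebra is a free supercommutative algebra in
their symbols.

*The annihilator.* An element annihilates `χ` if and only if it supercommutes with `E`
(`mem_gChi_iff`). It is then determined by its entries in the first rows of the blocks, and there is
one basis vector for each of the generators above, of the same parity and degree
(`eq_sum_annVector`). Sending the basis vectors to the symbols of the generators gives the inverse
`symToGr` of the isomorphism sought.
-/

open scoped DirectSum

noncomputable section

namespace QueerW

/-! ### Supercommutation of monomials -/

section Sign

theorem superSign_zero_left (b : ZMod 2) : superSign 0 b = 1 := by simp [superSign]

theorem superSign_zero_right (a : ZMod 2) : superSign a 0 = 1 := by simp [superSign]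

theorem superSign_add_right (a b c : ZMod 2) :
    superSign a (b + c) = superSign a b * superSign a c := by
  have h : ∀ x : ZMod 2, x = 0 ∨ x = 1 := by decide
  rcases h a with rfl | rfl <;> rcases h b with rfl | rfl <;> rcases h c with rfl | rfl <;>
    simp [superSign, show (1 + 1 : ZMod 2) = 0 from rfl]

theorem superSign_comm (a b : ZMod 2) : superSign a b = superSign b a := by
  simp [superSign, and_comm]

theorem superSign_add_left (a b c : ZMod 2) :
    superSign (a + b) c = superSign a c * superSign b c := by
  rw [superSign_comm, superSign_add_right, superSign_comm c a, superSign_comm c b]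

theorem superSign_eq (a b : ZMod 2) : superSign a b = 1 ∨ superSign a b = -1 := by
  unfold superSign; split_ifs <;> simp

theorem superSign_mul_self (a b : ZMod 2) : superSign a b * superSign a b = 1 := by
  rcases superSign_eq a b with h | h <;> simp [h]

theorem zmod_two_cases (a : ZMod 2) : a = 0 ∨ a = 1 := by revert a; decide

end Sign

section Monomials

variable {A X : Type} [Ring A]

/-- The noncommutative monomial of a word `L` in letters, where the letter `x` stands for `u x`. -/
def mon (u : X → A) (L : List X) : A := (L.map u).prod

@[simp] theorem mon_nil (u : X → A) : mon u [] = 1 := rfl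

@[simp] theorem mon_cons (u : X → A) (x : X) (L : List X) : mon u (x :: L) = u x * mon u L := by
  simp [mon]

@[simp] theorem mon_append (u : X → A) (L M : List X) : mon u (L ++ M) = mon u L * mon u M := by
  simp [mon]

variable [Algebra ℂ A]

/-- Checking on generators that a linear map sends the span of a set to a given subspace. -/
theorem map_mem_of_span {V V' : Type} [AddCommGroup V] [Module ℂ V] [AddCommGroup V'] [Module ℂ V']
    {S : Set V} {N : Submodule ℂ V'} {v : V} (f : V →ₗ[ℂ] V') (h : ∀ s ∈ S, f s ∈ N)
    (hv : v ∈ Submodule.span ℂ S) : f v ∈ N :=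
  (Submodule.span_le.2 h : Submodule.span ℂ S ≤ N.comap f) hv

theorem mul_mem_of_span {S : Set A} {N : Submodule ℂ A} {a v : A} (h : ∀ s ∈ S, a * s ∈ N)
    (hv : v ∈ Submodule.span ℂ S) : a * v ∈ N :=
  map_mem_of_span (LinearMap.mulLeft ℂ a) h hv

/-- The span of the monomials of fewer than `n` letters whose multiset of letters satisfies `J`. -/
def below (u : X → A) (J : Multiset X → Prop) (n : ℕ) : Submodule ℂ A :=
  Submodule.span ℂ {a | ∃ M : List X, M.length < n ∧ J ↑M ∧ a = mon u M}

theorem mon_mem_below {u : X → A} {J : Multiset X → Prop} {n : ℕ} {M : List X} (h : M.length < n)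
    (hJ : J ↑M) : mon u M ∈ below u J n :=
  Submodule.subset_span ⟨M, h, hJ, rfl⟩

theorem below_mono {u : X → A} {J J' : Multiset X → Prop} {n n' : ℕ} (h : n ≤ n')
    (hJ : ∀ s, J s → J' s) : below u J n ≤ below u J' n' := by
  refine Submodule.span_mono ?_
  rintro _ ⟨M, hM, hJM, rfl⟩
  exact ⟨M, hM.trans_le h, hJ _ hJM, rfl⟩

theorem mul_below_le {u : X → A} {J J' : Multiset X → Prop} {n n' : ℕ} (x : X)
    (h : n + 1 ≤ n') (hJ : ∀ s, J s → J' (x ::ₘ s)) {v : A} (hv : v ∈ below u J n) :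
    u x * v ∈ below u J' n' := by
  have : below u J n ≤ (below u J' n').comap (LinearMap.mulLeft ℂ (u x)) := by
    refine Submodule.span_le.2 ?_
    rintro _ ⟨M, hM, hJM, rfl⟩
    exact Submodule.subset_span ⟨x :: M, by simp; omega, hJ _ hJM, by simp⟩
  exact this hv

/-- The letters `x`, of parity `par x`, supercommute up to the monomials of words of length at most
one listed in `C`. In the lemmas below, `J` and `J'` are properties of the multiset of letters (such
as bounds for the degree) such that `J'` holds for what arises by replacing two letters of a word
with `J` by a word of `C`. -/
structure SuperComm (u : X → A) (par : X → ZMod 2) (C : X → X → Set (List X)) : Prop where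
  length_le : ∀ x y M, M ∈ C x y → M.length ≤ 1
  comm_mem : ∀ x y, u x * u y - superSign (par x) (par y) • (u y * u x) ∈
    Submodule.span ℂ (mon u '' C x y)

namespace SuperComm

variable {u : X → A} {par : X → ZMod 2} {C : X → X → Set (List X)} (h : SuperComm u par C)
  {J J' : Multiset X → Prop}
  (hJ : ∀ x y s M, M ∈ C x y → J (x ::ₘ y ::ₘ s) → J' (↑M + s))

include h hJ

theorem swap_mem (S T : List X) (x y : X) (hS : J ↑(S ++ x :: y :: T)) :
    mon u (S ++ x :: y :: T) - superSign (par x) (par y) • mon u (S ++ y :: x :: T) ∈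
      below u J' (S.length + T.length + 2) := by
  have key : Submodule.span ℂ (mon u '' C x y) ≤ (below u J' (S.length + T.length + 2)).comap
      (LinearMap.mulLeft ℂ (mon u S) ∘ₗ LinearMap.mulRight ℂ (mon u T)) := by
    refine Submodule.span_le.2 ?_
    rintro _ ⟨M, hM, rfl⟩
    have hl := h.length_le x y M hM
    refine Submodule.subset_span ⟨S ++ (M ++ T), by simp; omega, ?_, by simp⟩
    have h1 : (↑(S ++ (M ++ T)) : Multiset X) = ↑M + ↑(S ++ T) := by
      simp only [← Multiset.coe_add]; abel
    have h2 : (↑(S ++ x :: y :: T) : Multiset X) = x ::ₘ y ::ₘ ↑(S ++ T) := by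
      simp only [← Multiset.coe_add, ← Multiset.cons_coe, Multiset.add_cons]
    rw [h1]
    rw [h2] at hS
    exact hJ x y _ M hM hS
  have := key (h.comm_mem x y)
  simpa [mul_sub, sub_mul, mul_assoc] using this

/-- Reordering the letters of a word changes its monomial by a sign, up to lower terms. -/
theorem perm_mem {L L' : List X} (hp : L.Perm L') : ∀ S : List X, J ↑(S ++ L) →
    ∃ c : ℂ, (c = 1 ∨ c = -1) ∧
      mon u (S ++ L) - c • mon u (S ++ L') ∈ below u J' (S.length + L.length) := by
  induction hp with
  | nil => exact fun S _ => ⟨1, Or.inl rfl, by simp⟩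
  | cons x hp ih =>
    intro S hS
    obtain ⟨c, hc, hm⟩ := ih (S ++ [x]) (by simpa using hS)
    refine ⟨c, hc, ?_⟩
    simp only [List.append_assoc, List.cons_append, List.nil_append, List.length_append,
      List.length_cons, List.length_nil] at hm ⊢
    exact below_mono (by omega) (fun _ => id) hm
  | swap x y L =>
    intro S hS
    refine ⟨_, superSign_eq (par y) (par x), ?_⟩
    exact below_mono (by simp; omega) (fun _ => id) (h.swap_mem hJ S L y x hS)
  | @trans L₁ L₂ L₃ h₁ h₂ ih₁ ih₂ =>
    intro S hS
    obtain ⟨c, hc, hm⟩ := ih₁ S hS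
    have e : (↑(S ++ L₁) : Multiset X) = ↑(S ++ L₂) :=
      Multiset.coe_eq_coe.2 (h₁.append_left S)
    obtain ⟨d, hd, hm'⟩ := ih₂ S (e ▸ hS)
    refine ⟨c * d, by rcases hc with rfl | rfl <;> rcases hd with rfl | rfl <;> simp, ?_⟩
    rw [← h₁.length_eq] at hm'
    have := add_mem hm (Submodule.smul_mem _ c hm')
    simpa [smul_sub, mul_smul] using this

/-- The monomial of a word with a repeated odd letter is a combination of lower terms. -/
theorem mem_of_odd_repeat {L : List X} (hL : J ↑L) {x : X} (hx : par x = 1)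
    {s : Multiset X} (hs : (L : Multiset X) = x ::ₘ x ::ₘ s) : mon u L ∈ below u J' L.length := by
  have e : (L : Multiset X) = ↑(x :: x :: s.toList) := by
    rw [hs]; simp [← Multiset.cons_coe]
  have hp := Multiset.coe_eq_coe.1 e
  obtain ⟨c, -, hm⟩ := h.perm_mem hJ hp [] (by simpa using hL)
  have h2 := h.swap_mem hJ [] s.toList x x (by simpa using e ▸ hL)
  have hl := hp.length_eq
  simp only [List.length_cons] at hl
  simp only [List.nil_append, List.length_nil, zero_add, superSign, hx, and_self, if_true,
    neg_smul, one_smul, sub_neg_eq_add, ← two_smul ℂ] at h2 hm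
  have h3 := Submodule.smul_mem _ (2⁻¹ : ℂ) h2
  rw [smul_smul, inv_mul_cancel₀ two_ne_zero, one_smul] at h3
  rw [hl] at hm ⊢
  have := add_mem hm (Submodule.smul_mem _ c h3)
  simpa using this

theorem move_mem (x : X) (L : List X) : ∀ S T : List X, J ↑(S ++ x :: (L ++ T)) →
    mon u (S ++ x :: (L ++ T)) - superSign (par x) (L.map par).sum • mon u (S ++ (L ++ x :: T)) ∈
      below u J' (S.length + L.length + T.length + 1) := by
  induction L with
  | nil => intro S T _; simp [superSign_zero_right]
  | cons y L ih =>
    intro S T hS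
    have h1 := h.swap_mem hJ S (L ++ T) x y (by simpa using hS)
    have e : (↑(S ++ x :: (y :: L ++ T)) : Multiset X) = ↑((S ++ [y]) ++ x :: (L ++ T)) := by
      refine Multiset.coe_eq_coe.2 ?_
      simp only [List.append_assoc, List.cons_append, List.nil_append]
      exact (List.Perm.swap _ _ _).append_left S
    have h2 := ih (S ++ [y]) T (e ▸ hS)
    have h1' := below_mono (J' := J') (n' := S.length + (y :: L).length + T.length + 1)
      (by simp; omega) (fun _ => id) h1
    have h2' := below_mono (J' := J') (n' := S.length + (y :: L).length + T.length + 1)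
      (by simp; omega) (fun _ => id) h2
    have := add_mem h1' (Submodule.smul_mem _ (superSign (par x) (par y)) h2')
    simpa [smul_sub, superSign_add_right, mul_smul] using this

/-- Interchanging two blocks of a word. -/
theorem block_swap_mem (L' L : List X) : ∀ T : List X, J ↑(L' ++ (L ++ T)) →
    mon u (L' ++ (L ++ T)) - superSign (L'.map par).sum (L.map par).sum • mon u (L ++ (L' ++ T)) ∈
      below u J' (L'.length + L.length + T.length) := by
  induction L' using List.reverseRecOn with
  | nil => intro T _; simp [superSign_zero_left]
  | append_singleton L' x ih =>
    intro T hS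
    have h1 := h.move_mem hJ x L L' T (by simpa using hS)
    have e : (↑(L' ++ [x] ++ (L ++ T)) : Multiset X) = ↑(L' ++ (L ++ x :: T)) := by
      refine Multiset.coe_eq_coe.2 ?_
      simp only [List.append_assoc, List.cons_append, List.nil_append]
      exact (List.perm_middle.symm).append_left L'
    have h2 := ih (x :: T) (e ▸ hS)
    have h1' := below_mono (J' := J') (n' := (L' ++ [x]).length + L.length + T.length)
      (by simp) (fun _ => id) h1
    have h2' := below_mono (J' := J') (n' := (L' ++ [x]).length + L.length + T.length)
      (by simp; omega) (fun _ => id) h2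
    have := add_mem h1' (Submodule.smul_mem _ (superSign (par x) (L.map par).sum) h2')
    rw [smul_sub, smul_smul, sub_add_sub_cancel, mul_comm, ← superSign_add_left] at this
    simpa using this

end SuperComm

/-- A multiset of letters without repeated odd letters: the exponent of a normal monomial. -/
def Good (par : X → ZMod 2) (s : Multiset X) : Prop := ∀ x, par x = 1 → ∀ t, s ≠ x ::ₘ x ::ₘ t

/-- Every monomial is a combination of monomials of normal words `nf s`, where `nf` is an
arbitrary way of ordering the letters. -/
theorem SuperComm.mem_span_normal {u : X → A} {par : X → ZMod 2} {C : X → X → Set (List X)}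
    (h : SuperComm u par C) {J : Multiset X → Prop}
    (hJ : ∀ x y s M, M ∈ C x y → J (x ::ₘ y ::ₘ s) → J (↑M + s))
    (nf : Multiset X → List X) (hnf : ∀ s, (nf s : Multiset X) = s) (L : List X) (hL : J ↑L) :
    mon u L ∈ Submodule.span ℂ {a | ∃ s, Good par s ∧ J s ∧ a = mon u (nf s)} := by
  have main : ∀ n, below u J n ≤
      Submodule.span ℂ {a | ∃ s, Good par s ∧ J s ∧ a = mon u (nf s)} := by
    intro n
    induction n with
    | zero =>
      refine Submodule.span_le.2 ?_
      rintro _ ⟨M, hM, -⟩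
      exact absurd hM (by simp)
    | succ n ih =>
      refine Submodule.span_le.2 ?_
      rintro _ ⟨M, hM, hJM, rfl⟩
      have hle : below u J M.length ≤ _ :=
        (below_mono (Nat.lt_succ_iff.1 hM) (fun _ => id)).trans ih
      by_cases hg : Good par (M : Multiset X)
      · obtain ⟨c, -, hm⟩ := h.perm_mem hJ (Multiset.coe_eq_coe.1 (hnf ↑M).symm) []
          (by simpa using hJM)
        simp only [List.nil_append, List.length_nil, zero_add] at hm
        have := add_mem (hle hm) (Submodule.smul_mem _ c (Submodule.subset_span
          (⟨↑M, hg, hJM, rfl⟩ : mon u (nf ↑M) ∈ {a | ∃ s, Good par s ∧ J s ∧ a = mon u (nf s)})))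
        simpa using this
      · simp only [Good, not_forall, not_not] at hg
        obtain ⟨x, hx, t, ht⟩ := hg
        exact hle (h.mem_of_odd_repeat hJ hJM hx ht)
  exact main (L.length + 1) (mon_mem_below (Nat.lt_succ_self _) hL)

/-! ### Superderivations of degree minus one on words -/

/-- The value on the word `L` of the twisted derivation that sends the letter `x` to the scalar
`θ x` and that acquires the factor `ε x` on passing `x`. -/
def der (u : X → A) (ε θ : X → ℂ) : List X → A
  | [] => 0
  | y :: L => ε y • (u y * der u ε θ L) + θ y • mon u L

/-- The terms of the twisted derivation are words with one letter removed. -/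
theorem der_mem (u : X → A) (ε θ : X → ℂ) (L : List X) :
    der u ε θ L ∈ Submodule.span ℂ
      {a | ∃ (y : X) (M : List X), θ y ≠ 0 ∧ (L : Multiset X) = y ::ₘ (↑M : Multiset X) ∧
        a = mon u M} := by
  induction L with
  | nil => simp [der]
  | cons y L ih =>
    refine add_mem (Submodule.smul_mem _ _ ?_) ?_
    · refine mul_mem_of_span ?_ ih
      rintro _ ⟨z, M, hz, hM, rfl⟩
      refine Submodule.subset_span ⟨z, y :: M, hz, ?_, by simp⟩
      rw [← Multiset.cons_coe, hM, ← Multiset.cons_coe, Multiset.cons_swap]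
    · by_cases hy : θ y = 0
      · simp [hy]
      · exact Submodule.smul_mem _ _ (Submodule.subset_span ⟨y, L, hy, rfl, rfl⟩)

/-- On a word that begins with all occurrences of `x`, and with at most one if `x` is odd, so that
no cancellation takes place, the twisted derivation acts in the variable `x` like a derivative. -/
theorem der_replicate_append (u : X → A) (ε θ : X → ℂ) (x : X) (L : List X) (hx : x ∉ L) (n : ℕ)
    (hn : ε x = 1 ∨ n ≤ 1) :
    der u ε θ (List.replicate n x ++ L) -
        ((n : ℂ) * θ x) • mon u (List.replicate (n - 1) x ++ L) ∈
      Submodule.span ℂ {a | ∃ (y : X) (M : List X), y ≠ x ∧ θ y ≠ 0 ∧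
        (↑(List.replicate n x ++ L) : Multiset X) = y ::ₘ (↑M : Multiset X) ∧ a = mon u M} := by
  have h0 : der u ε θ L ∈ Submodule.span ℂ {a | ∃ (y : X) (M : List X), y ≠ x ∧ θ y ≠ 0 ∧
        (↑L : Multiset X) = y ::ₘ (↑M : Multiset X) ∧ a = mon u M} := by
    refine Submodule.span_mono ?_ (der_mem u ε θ L)
    rintro _ ⟨y, M, hy, hM, rfl⟩
    refine ⟨y, M, ?_, hy, hM, rfl⟩
    rintro rfl
    exact hx (Multiset.mem_coe.1 (hM ▸ Multiset.mem_cons_self _ _))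
  have hmul : ∀ (n : ℕ) (v : A), v ∈ Submodule.span ℂ {a | ∃ (y : X) (M : List X), y ≠ x ∧ θ y ≠ 0 ∧
        (↑(List.replicate n x ++ L) : Multiset X) = y ::ₘ (↑M : Multiset X) ∧ a = mon u M} →
      u x * v ∈ Submodule.span ℂ {a | ∃ (y : X) (M : List X), y ≠ x ∧ θ y ≠ 0 ∧
        (↑(List.replicate (n + 1) x ++ L) : Multiset X) = y ::ₘ (↑M : Multiset X) ∧
        a = mon u M} := by
    intro n v hv
    refine mul_mem_of_span ?_ hv
    rintro _ ⟨z, M, hzx, hz, hM, rfl⟩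
    refine Submodule.subset_span ⟨z, x :: M, hzx, hz, ?_, by simp⟩
    rw [List.replicate_succ, List.cons_append, ← Multiset.cons_coe, hM, ← Multiset.cons_coe,
      Multiset.cons_swap]
  rcases hn with hε | hn
  · induction n with
    | zero => simpa using h0
    | succ n ih =>
      have := hmul n _ ih
      rw [List.replicate_succ, List.cons_append, der, hε, one_smul] at *
      convert this using 1
      rcases n with _ | n
      · simp
      · simp only [Nat.add_sub_cancel, List.replicate_succ, List.cons_append, mon_cons,
          mul_sub, mul_add,
          Algebra.mul_smul_comm, Nat.cast_add, Nat.cast_one, add_mul, one_mul, add_smul]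
        abel
  · interval_cases n
    · simpa using h0
    · have := Submodule.smul_mem _ (ε x) (hmul 0 _ (by simpa using h0))
      simpa [der] using this

end Monomials

/-! ### Letters and the enveloping superalgebra -/

section Letters

variable {ι : Type}

/-- The indices of the standard basis of the queer Lie superalgebra: the parity, the row and the
column. -/
abbrev Letter (ι : Type) : Type := ZMod 2 × ι × ι

variable [DecidableEq ι]

/-- The standard basis `e a b`, `f a b` of the queer Lie superalgebra. -/
def letter (x : Letter ι) : Queer ι :=
  if x.1 = 0 then ⟨Matrix.single x.2.1 x.2.2 1, 0⟩ else ⟨0, Matrix.single x.2.1 x.2.2 1⟩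

theorem letter_mem_parity (x : Letter ι) : letter x ∈ Queer.parity x.1 := by
  obtain ⟨c, a, b⟩ := x
  rcases zmod_two_cases c with rfl | rfl
  · simp [Queer.mem_parity_zero, letter]
  · simp [Queer.mem_parity_one, letter]

variable [Fintype ι]

theorem eq_sum_letter (v : Queer ι) :
    v = ∑ a, ∑ b, (v.even a b • letter (0, a, b) + v.odd a b • letter (1, a, b)) := by
  have h1 : ∀ f : ι → ι → Queer ι, (∑ a, ∑ b, f a b).even = ∑ a, ∑ b, (f a b).even := by
    intro f
    let e : Queer ι →+ Matrix ι ι ℂ := ⟨⟨Queer.even, rfl⟩, fun _ _ => rfl⟩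
    change e _ = ∑ a, ∑ b, e _
    simp
  have h2 : ∀ f : ι → ι → Queer ι, (∑ a, ∑ b, f a b).odd = ∑ a, ∑ b, (f a b).odd := by
    intro f
    let e : Queer ι →+ Matrix ι ι ℂ := ⟨⟨Queer.odd, rfl⟩, fun _ _ => rfl⟩
    change e _ = ∑ a, ∑ b, e _
    simp
  ext1
  · rw [h1]
    conv_lhs => rw [Matrix.matrix_eq_sum_single v.even]
    simp [letter]
  · rw [h2]
    conv_lhs => rw [Matrix.matrix_eq_sum_single v.odd]
    simp [letter]

theorem letter_bracket (x y : Letter ι) : ⁅letter x, letter y⁆ =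
    (if x.2.2 = y.2.1 then letter (x.1 + y.1, x.2.1, y.2.2) else 0) -
      superSign x.1 y.1 • (if y.2.2 = x.2.1 then letter (x.1 + y.1, y.2.1, x.2.2) else 0) := by
  have neg_even : ∀ v : Queer ι, (-v).even = -v.even := fun _ => rfl
  have neg_odd : ∀ v : Queer ι, (-v).odd = -v.odd := fun _ => rfl
  obtain ⟨c, a, b⟩ := x
  obtain ⟨d, a', b'⟩ := y
  have h2 : (1 + 1 : ZMod 2) = 0 := rfl
  rcases zmod_two_cases c with rfl | rfl <;> rcases zmod_two_cases d with rfl | rfl <;>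
    by_cases h : b = a' <;> by_cases h' : b' = a <;>
    ext1 <;> simp [letter, superSign, h, h', h2, sub_eq_add_neg, neg_even, neg_odd,
      Matrix.single_mul_single_of_ne]

variable (ι) in
omit [DecidableEq ι] in
theorem Env.of_bracket {a b : ZMod 2} {x y : Queer ι} (hx : x ∈ Queer.parity a)
    (hy : y ∈ Queer.parity b) :
    Env.of ι x * Env.of ι y - superSign a b • (Env.of ι y * Env.of ι x) = Env.of ι ⁅x, y⁆ := by
  have h := RingQuot.mkAlgHom_rel ℂ (EnvRel.bracket a b x y hx hy)
  rw [map_sub, map_smul, map_mul, map_mul] at h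
  exact h

/-- The universal property of the enveloping superalgebra. -/
def Env.lift {A : Type} [Ring A] [Algebra ℂ A] (f : Queer ι →ₗ[ℂ] A)
    (hf : ∀ a b x y, x ∈ Queer.parity a → y ∈ Queer.parity b →
      f x * f y - superSign a b • (f y * f x) = f ⁅x, y⁆) : Env ι →ₐ[ℂ] A :=
  RingQuot.liftAlgHom ℂ ⟨TensorAlgebra.lift ℂ f, by
    rintro _ _ ⟨a, b, x, y, hx, hy⟩
    simpa using hf a b x y hx hy⟩

omit [DecidableEq ι] in
theorem Env.lift_of {A : Type} [Ring A] [Algebra ℂ A] (f : Queer ι →ₗ[ℂ] A) (hf) (x : Queer ι) :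
    Env.lift f hf (Env.of ι x) = f x := by
  change RingQuot.liftAlgHom ℂ _ (RingQuot.mkAlgHom ℂ (EnvRel ι) (TensorAlgebra.ι ℂ x)) = _
  rw [RingQuot.liftAlgHom_mkAlgHom_apply, TensorAlgebra.lift_ι_apply]

end Letters

/-! ### The comultiplication with values in matrices -/

section Comul

open scoped TensorProduct

variable {ι : Type} [DecidableEq ι]

/-- The `a`-th power of the parity operator of the superspace on which the block matrices act. -/
def signMatrix (a : ZMod 2) : Matrix (ι ⊕ ι) (ι ⊕ ι) ℂ :=
  Matrix.diagonal (Sum.elim (fun _ => 1) fun _ => superSign a 1)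

/-- The even part of an element. -/
def evenPart : Queer ι →ₗ[ℂ] Queer ι where
  toFun x := ⟨x.even, 0⟩
  map_add' x y := by ext1 <;> simp
  map_smul' c x := by ext1 <;> simp

/-- The odd part of an element. -/
def oddPart : Queer ι →ₗ[ℂ] Queer ι where
  toFun x := ⟨0, x.odd⟩
  map_add' x y := by ext1 <;> simp
  map_smul' c x := by ext1 <;> simp

/-- `Queer.toBlock` as a linear map. -/
def toBlockLin : Queer ι →ₗ[ℂ] Matrix (ι ⊕ ι) (ι ⊕ ι) ℂ where
  toFun := Queer.toBlock
  map_add' x y := by simp [Queer.toBlock, Matrix.fromBlocks_add]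
  map_smul' c x := by simp [Queer.toBlock, Matrix.fromBlocks_smul]

variable [Fintype ι]

theorem signMatrix_mul (a b : ZMod 2) :
    (signMatrix a * signMatrix b : Matrix (ι ⊕ ι) (ι ⊕ ι) ℂ) = signMatrix (a + b) := by
  unfold signMatrix
  rw [Matrix.diagonal_mul_diagonal]
  congr 1
  funext i
  cases i <;> simp [superSign_add_left]

omit [Fintype ι] in
theorem signMatrix_zero : (signMatrix 0 : Matrix (ι ⊕ ι) (ι ⊕ ι) ℂ) = 1 := by
  rw [signMatrix, ← Matrix.diagonal_one]
  congr 1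
  funext i
  cases i <;> simp [superSign_zero_left]

theorem toBlock_mul_signMatrix {a : ZMod 2} (b : ZMod 2) {x : Queer ι} (hx : x ∈ Queer.parity a) :
    Queer.toBlock x * signMatrix b = superSign a b • (signMatrix b * Queer.toBlock x) := by
  ext i j
  rw [signMatrix, Matrix.smul_apply, Matrix.mul_diagonal, Matrix.diagonal_mul]
  rcases zmod_two_cases a with rfl | rfl
  · rw [Queer.mem_parity_zero] at hx
    cases i <;> cases j <;> simp [Queer.toBlock, hx, superSign_zero_left, mul_comm]
  · rw [Queer.mem_parity_one] at hx
    rcases zmod_two_cases b with rfl | rfl <;>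
    cases i <;> cases j <;> simp [Queer.toBlock, hx, superSign, mul_comm]

/-- The restriction of `Env.comul` to the Lie superalgebra. -/
def comulAux : Queer ι →ₗ[ℂ] Matrix (ι ⊕ ι) (ι ⊕ ι) ℂ ⊗[ℂ] Env ι :=
  (TensorProduct.mk ℂ _ (Env ι)).flip 1 ∘ₗ toBlockLin +
    TensorProduct.mk ℂ _ (Env ι) 1 ∘ₗ Env.of ι ∘ₗ evenPart +
    TensorProduct.mk ℂ _ (Env ι) (signMatrix 1) ∘ₗ Env.of ι ∘ₗ oddPart

theorem comulAux_apply {a : ZMod 2} {x : Queer ι} (hx : x ∈ Queer.parity a) :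
    comulAux x = Queer.toBlock x ⊗ₜ 1 + signMatrix a ⊗ₜ Env.of ι x := by
  have h : comulAux x = Queer.toBlock x ⊗ₜ 1 + 1 ⊗ₜ Env.of ι (evenPart x) +
    signMatrix 1 ⊗ₜ Env.of ι (oddPart x) := rfl
  rw [h]
  rcases zmod_two_cases a with rfl | rfl
  · rw [Queer.mem_parity_zero] at hx
    rw [show evenPart x = x from Queer.ext rfl hx.symm,
      show oddPart x = 0 from Queer.ext rfl hx, map_zero, TensorProduct.tmul_zero, add_zero,
      signMatrix_zero]
  · rw [Queer.mem_parity_one] at hx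
    rw [show oddPart x = x from Queer.ext hx.symm rfl,
      show evenPart x = 0 from Queer.ext hx rfl, map_zero, TensorProduct.tmul_zero, add_zero]

theorem bracket_mem_parity {a b : ZMod 2} {x y : Queer ι} (hx : x ∈ Queer.parity a)
    (hy : y ∈ Queer.parity b) : ⁅x, y⁆ ∈ Queer.parity (a + b) := by
  have h2 : (1 + 1 : ZMod 2) = 0 := rfl
  rcases zmod_two_cases a with rfl | rfl <;> rcases zmod_two_cases b with rfl | rfl <;>
    simp only [add_zero, zero_add, h2, Queer.mem_parity_zero, Queer.mem_parity_one] at * <;>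
    simp [hx, hy]

variable (ι) in
/-- The comultiplication of the enveloping superalgebra, with the first factor represented by block
matrices. The parity operator in the first factor produces the signs of the super tensor product. -/
def Env.comul : Env ι →ₐ[ℂ] Matrix (ι ⊕ ι) (ι ⊕ ι) ℂ ⊗[ℂ] Env ι :=
  Env.lift comulAux fun a b x y hx hy => by
    rw [comulAux_apply hx, comulAux_apply hy, comulAux_apply (bracket_mem_parity hx hy),
      Queer.toBlock_bracket a b x y hx hy, ← Env.of_bracket ι hx hy]
    simp only [add_mul, mul_add, Algebra.TensorProduct.tmul_mul_tmul, one_mul, mul_one,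
      signMatrix_mul, toBlock_mul_signMatrix _ hx, toBlock_mul_signMatrix _ hy,
      TensorProduct.sub_tmul, TensorProduct.tmul_sub, smul_add, TensorProduct.smul_tmul',
      TensorProduct.tmul_smul, superSign_comm b a, add_comm b a, smul_smul, superSign_mul_self,
      one_smul]
    abel

theorem Env.comul_of {a : ZMod 2} {x : Queer ι} (hx : x ∈ Queer.parity a) :
    Env.comul ι (Env.of ι x) = Queer.toBlock x ⊗ₜ 1 + signMatrix a ⊗ₜ Env.of ι x := by
  rw [Env.comul, Env.lift_of, comulAux_apply hx]

/-- The matrix entry in row `i` and column `j` of the first factor. -/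
def entry (i j : ι ⊕ ι) : Matrix (ι ⊕ ι) (ι ⊕ ι) ℂ ⊗[ℂ] Env ι →ₗ[ℂ] Env ι :=
  TensorProduct.lift (LinearMap.mk₂ ℂ (fun M u => M i j • u)
    (fun _ _ _ => by simp [add_smul]) (fun _ _ _ => by simp [mul_smul])
    (fun _ _ _ => by simp) (fun _ _ _ => smul_comm _ _ _))

omit [DecidableEq ι] in
@[simp] theorem entry_tmul (i j : ι ⊕ ι) (M : Matrix (ι ⊕ ι) (ι ⊕ ι) ℂ) (u : Env ι) :
    entry i j (M ⊗ₜ u) = M i j • u := rfl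

theorem entry_tmul_mul (i j : ι ⊕ ι) (M : Matrix (ι ⊕ ι) (ι ⊕ ι) ℂ) (u : Env ι)
    (T : Matrix (ι ⊕ ι) (ι ⊕ ι) ℂ ⊗[ℂ] Env ι) :
    entry i j (M ⊗ₜ u * T) = ∑ k, M i k • (u * entry k j T) := by
  induction T using TensorProduct.induction_on with
  | zero => simp
  | tmul N v =>
    rw [Algebra.TensorProduct.tmul_mul_tmul, entry_tmul, Matrix.mul_apply, Finset.sum_smul]
    exact Finset.sum_congr rfl fun k _ => by
      rw [entry_tmul, mul_smul, Algebra.mul_smul_comm]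
  | add S T hS hT => simp [mul_add, hS, hT, Finset.sum_add_distrib]

/-- The operator on the enveloping superalgebra by which the matrix coefficient in row `i` and
column `j` of the defining representation, minus its value at `1`, acts. -/
def partialOp (i j : ι ⊕ ι) : Env ι →ₗ[ℂ] Env ι :=
  entry i j ∘ₗ (Env.comul ι).toLinearMap - (if i = j then LinearMap.id else 0)

theorem partialOp_apply (i j : ι ⊕ ι) (v : Env ι) :
    partialOp i j v = entry i j (Env.comul ι v) - if i = j then v else 0 := by
  unfold partialOp; split_ifs <;> simp

theorem partialOp_one (i j : ι ⊕ ι) : partialOp i j (1 : Env ι) = 0 := by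
  rw [partialOp_apply, map_one, Algebra.TensorProduct.one_def, entry_tmul, Matrix.one_apply]
  split_ifs <;> simp

/-- The parity of a row index of the block matrices. -/
def rowParity (i : ι ⊕ ι) : ZMod 2 := Sum.elim (fun _ => 0) (fun _ => 1) i

/-- The twisted Leibniz rule, with an error term that adds no letter. -/
theorem partialOp_of_mul {a : ZMod 2} {x : Queer ι} (hx : x ∈ Queer.parity a) (i : ι ⊕ ι) (b : ι)
    (v : Env ι) :
    partialOp i (Sum.inl b) (Env.of ι x * v) =
      superSign (rowParity i) a • (Env.of ι x * partialOp i (Sum.inl b) v) +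
      Queer.toBlock x i (Sum.inl b) • v +
      ∑ k, Queer.toBlock x i k • partialOp k (Sum.inl b) v := by
  have e : ∀ k, entry k (Sum.inl b) (Env.comul ι v) =
      partialOp k (Sum.inl b) v + if k = Sum.inl b then v else 0 := by
    intro k; rw [partialOp_apply, sub_add_cancel]
  have hs : ∀ k, (signMatrix a : Matrix (ι ⊕ ι) (ι ⊕ ι) ℂ) i k =
      if i = k then superSign (rowParity i) a else 0 := by
    intro k
    rw [signMatrix, Matrix.diagonal_apply]
    cases i <;> simp [rowParity, superSign_zero_left, superSign_comm a]
  have hi : (if i = Sum.inl b then v else 0 : Env ι) =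
      superSign (rowParity i) a • if i = Sum.inl b then v else 0 := by
    split_ifs with h
    · simp [h, rowParity, superSign_zero_left]
    · simp
  rw [partialOp_apply, map_mul, Env.comul_of hx, add_mul, map_add, entry_tmul_mul, entry_tmul_mul]
  simp only [e, hs, one_mul, smul_add, mul_add, Finset.sum_add_distrib, ite_smul, zero_smul,
    Finset.sum_ite_eq, Finset.mem_univ, if_true, smul_ite, smul_zero, mul_ite, mul_zero,
    Finset.sum_ite_eq']
  have hi' : (if i = Sum.inl b then Env.of ι x * v else 0 : Env ι) =
      if i = Sum.inl b then superSign (rowParity i) a • (Env.of ι x * v) else 0 := by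
    split_ifs with h
    · simp [h, rowParity, superSign_zero_left]
    · rfl
  rw [hi']
  abel

end Comul

/-! ### Linear independence of normal monomials -/

section Independence

variable {ι : Type} [DecidableEq ι] [Fintype ι]

/-- The Kazhdan degree of a letter, for the grading by the function `lev` on rows and columns. -/
def wt (lev : ι → ℕ) (x : Letter ι) : ℤ := 2 * ((lev x.2.2 : ℤ) - lev x.2.1) + 2

/-- The letter `x` shifted by its value under the functional `χ`. -/
def shifted (χ : Queer ι →ₗ[ℂ] ℂ) (x : Letter ι) : Env ι :=
  Env.of ι (letter x) - algebraMap ℂ (Env ι) (χ (letter x))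

/-- The words of length at most one whose degree and parity are those of the bracket of the letters
`x` and `y`. -/
def commWords (lev : ι → ℕ) (x y : Letter ι) : Set (List (Letter ι)) :=
  {M | M.length ≤ 1 ∧ (M.map (wt lev)).sum = wt lev x + wt lev y - 2 ∧
    (M.map Prod.fst).sum = x.1 + y.1}

/-- The functional is even and lives in Kazhdan degree zero. -/
def IsKazhdanEven (lev : ι → ℕ) (χ : Queer ι →ₗ[ℂ] ℂ) : Prop :=
  ∀ x : Letter ι, χ (letter x) ≠ 0 → wt lev x = 0 ∧ x.1 = 0

variable {lev : ι → ℕ} {χ : Queer ι →ₗ[ℂ] ℂ}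

theorem of_letter_eq (χ : Queer ι →ₗ[ℂ] ℂ) (x : Letter ι) :
    Env.of ι (letter x) = shifted χ x + algebraMap ℂ (Env ι) (χ (letter x)) := by
  rw [shifted, sub_add_cancel]

/-- Passing from basis vectors to shifted letters respects the Kazhdan degree and the parity, since
a nonzero constant `χ(x)` occurs only for even `x` of degree zero. -/
theorem of_letter_mem (hχ : IsKazhdanEven lev χ) (x : Letter ι) :
    Env.of ι (letter x) ∈ Submodule.span ℂ (mon (shifted χ) '' {M | M.length ≤ 1 ∧
      (M.map (wt lev)).sum = wt lev x ∧ (M.map Prod.fst).sum = x.1}) := by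
  rw [of_letter_eq χ]
  refine add_mem (Submodule.subset_span ⟨[x], by simp, by simp⟩) ?_
  by_cases h : χ (letter x) = 0
  · simp [h]
  · rw [Algebra.algebraMap_eq_smul_one]
    refine Submodule.smul_mem _ _ (Submodule.subset_span ⟨[], ?_, rfl⟩)
    simp [hχ x h]

theorem shifted_comm (hχ : IsKazhdanEven lev χ) (x y : Letter ι) :
    shifted χ x * shifted χ y - superSign x.1 y.1 • (shifted χ y * shifted χ x) =
      Env.of ι ⁅letter x, letter y⁆ := by
  have h := Env.of_bracket ι (letter_mem_parity x) (letter_mem_parity y)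
  rw [← h]
  by_cases hxy : x.1 = 1 ∧ y.1 = 1
  · have hx : χ (letter x) = 0 := by
      by_contra h0; exact zero_ne_one ((hχ x h0).2.symm.trans hxy.1)
    have hy : χ (letter y) = 0 := by
      by_contra h0; exact zero_ne_one ((hχ y h0).2.symm.trans hxy.2)
    simp [shifted, hx, hy]
  · rw [superSign, if_neg hxy, one_smul, one_smul]
    simp only [shifted, sub_mul, mul_sub, Algebra.commutes (χ (letter x)),
      Algebra.commutes (χ (letter y)) (Env.of ι (letter x))]
    rw [← Algebra.commutes (χ (letter x)) (algebraMap ℂ (Env ι) (χ (letter y)))]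
    abel

theorem shifted_superComm (hχ : IsKazhdanEven lev χ) :
    SuperComm (shifted χ) Prod.fst (commWords lev) where
  length_le _ _ _ h := h.1
  comm_mem x y := by
    rw [shifted_comm hχ, letter_bracket, map_sub, map_smul]
    refine sub_mem ?_ (Submodule.smul_mem _ _ ?_)
    · split_ifs with h
      · refine Submodule.span_mono (Set.image_mono ?_) (of_letter_mem hχ _)
        rintro M ⟨h1, h2, h3⟩
        refine ⟨h1, ?_, h3⟩
        rw [h2]; simp only [wt, h]; ring
      · simp
    · split_ifs with h
      · refine Submodule.span_mono (Set.image_mono ?_) (of_letter_mem hχ _)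
        rintro M ⟨h1, h2, h3⟩
        refine ⟨h1, ?_, h3⟩
        rw [h2]; simp only [wt, h]; ring
      · simp

theorem partialOp_shifted_mul (hχ : IsKazhdanEven lev χ) (x : Letter ι) (i : ι ⊕ ι) (b : ι)
    (v : Env ι) :
    partialOp i (Sum.inl b) (shifted χ x * v) =
      superSign (rowParity i) x.1 • (shifted χ x * partialOp i (Sum.inl b) v) +
      Queer.toBlock (letter x) i (Sum.inl b) • v +
      ∑ k, Queer.toBlock (letter x) i k • partialOp k (Sum.inl b) v := by
  have hs : superSign (rowParity i) x.1 * χ (letter x) = χ (letter x) := by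
    by_cases h : χ (letter x) = 0
    · simp [h]
    · simp [(hχ x h).2, superSign_zero_right]
  rw [shifted, sub_mul, map_sub, partialOp_of_mul (letter_mem_parity x), ← Algebra.smul_def,
    map_smul, sub_mul, ← Algebra.smul_def, smul_sub, smul_smul, hs]
  abel

theorem partialOp_mon_mem (hχ : IsKazhdanEven lev χ) (b : ι) (L : List (Letter ι)) : ∀ i : ι ⊕ ι,
    partialOp i (Sum.inl b) (mon (shifted χ) L) ∈ below (shifted χ) (fun _ => True) L.length := by
  induction L with
  | nil => intro i; simp [partialOp_one]
  | cons x L ih =>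
    intro i
    rw [mon_cons, partialOp_shifted_mul hχ]
    refine add_mem (add_mem (Submodule.smul_mem _ _ ?_) (Submodule.smul_mem _ _ ?_)) ?_
    · exact mul_below_le x (by simp) (fun _ => id) (ih i)
    · exact mon_mem_below (by simp) trivial
    · exact sum_mem fun k _ => Submodule.smul_mem _ _ (below_mono (by simp) (fun _ => id) (ih k))

/-- Up to words shorter by at least two letters, the operators `partialOp` act on words as twisted
derivations. -/
theorem partialOp_mon_sub_der_mem (hχ : IsKazhdanEven lev χ) (b : ι) (i : ι ⊕ ι)
    (L : List (Letter ι)) :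
    partialOp i (Sum.inl b) (mon (shifted χ) L) -
      der (shifted χ) (fun x => superSign (rowParity i) x.1)
        (fun x => Queer.toBlock (letter x) i (Sum.inl b)) L ∈
      below (shifted χ) (fun _ => True) (L.length - 1) := by
  induction L with
  | nil => simp [partialOp_one, der]
  | cons x L ih =>
    rw [mon_cons, partialOp_shifted_mul hχ, der]
    have h1 : ∑ k, Queer.toBlock (letter x) i k • partialOp k (Sum.inl b) (mon (shifted χ) L) ∈
        below (shifted χ) (fun _ => True) ((x :: L).length - 1) :=
      sum_mem fun k _ => Submodule.smul_mem _ _ (partialOp_mon_mem hχ b L k)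
    have h2 : shifted χ x * (partialOp i (Sum.inl b) (mon (shifted χ) L) -
      der (shifted χ) (fun x => superSign (rowParity i) x.1)
        (fun x => Queer.toBlock (letter x) i (Sum.inl b)) L) ∈
        below (shifted χ) (fun _ => True) ((x :: L).length - 1) := by
      rcases L with _ | ⟨y, L⟩
      · simp [partialOp_one, der]
      · exact mul_below_le x (by simp) (fun _ => id) ih
    have h3 := add_mem (Submodule.smul_mem _ (superSign (rowParity i) x.1) h2) h1
    convert h3 using 1
    rw [mul_sub, smul_sub]
    abel

theorem partialOp_mem_below (hχ : IsKazhdanEven lev χ) (b : ι) (i : ι ⊕ ι) {n : ℕ} {v : Env ι}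
    (hv : v ∈ below (shifted χ) (fun _ => True) (n + 1)) :
    partialOp i (Sum.inl b) v ∈ below (shifted χ) (fun _ => True) n := by
  refine map_mem_of_span (partialOp i (Sum.inl b)) ?_ hv
  rintro _ ⟨M, hM, -, rfl⟩
  exact below_mono (Nat.lt_succ_iff.1 hM) (fun _ => id) (partialOp_mon_mem hχ b M i)

/-- The row index whose matrix coefficients in the even columns detect the letters of parity `c` in
row `a`. -/
def rowIndex (c : ZMod 2) (a : ι) : ι ⊕ ι := if c = 0 then Sum.inl a else Sum.inr a

omit [DecidableEq ι] [Fintype ι] in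
theorem rowParity_rowIndex (c : ZMod 2) (a : ι) : rowParity (rowIndex c a) = c := by
  rcases zmod_two_cases c with rfl | rfl <;> simp [rowParity, rowIndex]

omit [Fintype ι] in
/-- The twisted derivation belonging to the letter `z` removes only the letter `z`. -/
theorem toBlock_letter_rowIndex (x z : Letter ι) :
    Queer.toBlock (letter x) (rowIndex z.1 z.2.1) (Sum.inl z.2.2) = if x = z then 1 else 0 := by
  obtain ⟨c, a, b⟩ := x
  obtain ⟨d, a', b'⟩ := z
  rcases zmod_two_cases c with rfl | rfl <;> rcases zmod_two_cases d with rfl | rfl <;>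
    simp [rowIndex, Queer.toBlock, letter, Matrix.single_apply, Prod.ext_iff]

theorem Good.count_le {X : Type} [DecidableEq X] {par : X → ZMod 2} {s : Multiset X}
    (h : Good par s) {x : X} (hx : par x = 1) : s.count x ≤ 1 := by
  by_contra hc
  push Not at hc
  obtain ⟨t, ht⟩ := Multiset.exists_cons_of_mem (Multiset.count_pos.1 (by omega : 0 < s.count x))
  rw [ht, Multiset.count_cons_self] at hc
  obtain ⟨t', ht'⟩ := Multiset.exists_cons_of_mem (Multiset.count_pos.1 (by omega : 0 < t.count x))
  exact h x hx t' (by rw [ht, ht'])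

theorem Good.of_cons {X : Type} {par : X → ZMod 2} {s : Multiset X} {x : X}
    (h : Good par (x ::ₘ s)) : Good par s := by
  intro y hy t ht
  refine h y hy (x ::ₘ t) ?_
  rw [ht, Multiset.cons_swap x y, Multiset.cons_swap x y]

/-- A word with multiset of letters `s` in which the letter `x` comes first. -/
def frontWord {X : Type} [DecidableEq X] (x : X) (s : Multiset X) : List X :=
  List.replicate (s.count x) x ++ (s.filter (· ≠ x)).toList

theorem coe_frontWord {X : Type} [DecidableEq X] (x : X) (s : Multiset X) :
    (frontWord x s : Multiset X) = s := by
  rw [frontWord, ← Multiset.coe_add, Multiset.coe_toList, Multiset.coe_replicate]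
  ext y
  rw [Multiset.count_add, Multiset.count_replicate, Multiset.count_filter]
  by_cases h : x = y
  · subst h; simp
  · simp [h, Ne.symm h]

/-- A functional on the enveloping superalgebra that detects the leading part of the normal
monomials with multiset of letters `s`. -/
theorem exists_detecting_functional (hχ : IsKazhdanEven lev χ) (s : Multiset (Letter ι))
    (hs : Good Prod.fst s) : ∃ φ : Env ι →ₗ[ℂ] ℂ,
      (∀ v ∈ below (shifted χ) (fun _ => True) s.card, φ v = 0) ∧
      (∀ L : List (Letter ι), (L : Multiset (Letter ι)) = s → φ (mon (shifted χ) L) ≠ 0) ∧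
      (∀ L : List (Letter ι), L.length = s.card → (L : Multiset (Letter ι)) ≠ s →
        φ (mon (shifted χ) L) = 0) := by
  induction s using Multiset.induction with
  | empty =>
    refine ⟨(Env.lift (0 : Queer ι →ₗ[ℂ] ℂ) (by simp)).toLinearMap, ?_, ?_, ?_⟩
    · intro v hv
      have : below (shifted χ) (fun _ => True) (0 : Multiset (Letter ι)).card = ⊥ := by
        simp [below]
      rw [this, Submodule.mem_bot] at hv
      rw [hv, map_zero]
    · intro L hL
      rw [Multiset.coe_eq_zero] at hL
      subst hL
      simp
    · intro L hL hne
      rw [Multiset.card_zero, List.length_eq_zero_iff] at hL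
      exact absurd (by rw [hL]; rfl) hne
  | cons z t ih =>
    obtain ⟨φ, h1, h2, h3⟩ := ih hs.of_cons
    set i := rowIndex z.1 z.2.1 with hi
    have hθ : (fun x : Letter ι => Queer.toBlock (letter x) i (Sum.inl z.2.2)) =
        fun x => if x = z then 1 else 0 := funext fun x => toBlock_letter_rowIndex x z
    have hder : ∀ L : List (Letter ι), L.length = t.card + 1 →
        φ (partialOp i (Sum.inl z.2.2) (mon (shifted χ) L)) =
        φ (der (shifted χ) (fun x => superSign z.1 x.1) (fun x => if x = z then 1 else 0) L) := by
      intro L hL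
      have h := h1 _ (by simpa [hL] using partialOp_mon_sub_der_mem hχ z.2.2 i L)
      rw [map_sub, sub_eq_zero, hθ, hi, rowParity_rowIndex] at h
      exact h
    have hlow : ∀ v ∈ below (shifted χ) (fun _ => True) (z ::ₘ t).card,
        φ (partialOp i (Sum.inl z.2.2) v) = 0 := by
      intro v hv
      rw [Multiset.card_cons] at hv
      exact h1 _ (partialOp_mem_below hχ _ _ hv)
    refine ⟨φ ∘ₗ partialOp i (Sum.inl z.2.2), hlow, ?_, ?_⟩
    · intro L hL
      have hlen : L.length = t.card + 1 := by
        rw [← Multiset.coe_card, hL, Multiset.card_cons]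
      -- move the occurrences of `z` to the front
      set L₀ := frontWord z (z ::ₘ t) with hL₀
      have hc₀ : (L₀ : Multiset (Letter ι)) = z ::ₘ t := coe_frontWord _ _
      have hlen₀ : L₀.length = t.card + 1 := by
        rw [← Multiset.coe_card, hc₀, Multiset.card_cons]
      obtain ⟨c, hc, hm⟩ := (shifted_superComm hχ).perm_mem (J := fun _ => True)
        (J' := fun _ => True) (fun _ _ _ _ _ _ => trivial)
        (Multiset.coe_eq_coe.1 (hL.trans hc₀.symm)) [] trivial
      have h := hlow _ (by simpa [hlen] using hm)
      rw [map_sub, map_sub, sub_eq_zero, map_smul, map_smul] at h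
      rw [LinearMap.comp_apply, h, hder _ hlen₀]
      have hd := der_replicate_append (shifted χ) (fun x => superSign z.1 x.1)
        (fun x => if x = z then 1 else 0) z ((z ::ₘ t).filter (· ≠ z)).toList (by simp)
        ((z ::ₘ t).count z) (by
          rcases zmod_two_cases z.1 with h0 | h0
          · left; simp [h0, superSign_zero_left]
          · right; exact hs.count_le h0)
      have hempty : {a | ∃ (y : Letter ι) (M : List (Letter ι)), y ≠ z ∧
          (if y = z then (1 : ℂ) else 0) ≠ 0 ∧ (↑(List.replicate ((z ::ₘ t).count z) z ++
          ((z ::ₘ t).filter (· ≠ z)).toList) : Multiset (Letter ι)) = y ::ₘ ↑M ∧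
          a = mon (shifted χ) M} = ∅ := by
        refine Set.eq_empty_of_forall_notMem ?_
        rintro _ ⟨y, M, hy, hy', -⟩
        simp [hy] at hy'
      rw [hempty, Submodule.span_empty, Submodule.mem_bot, sub_eq_zero] at hd
      rw [hL₀, frontWord, hd, map_smul]
      refine smul_ne_zero (by rcases hc with rfl | rfl <;> simp) (smul_ne_zero ?_ (h2 _ ?_))
      · rw [if_pos rfl, mul_one, Multiset.count_cons_self]
        exact_mod_cast Nat.succ_ne_zero (t.count z)
      · have := coe_frontWord z (z ::ₘ t)
        rw [frontWord, Multiset.count_cons_self, List.replicate_succ, List.cons_append,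
          ← Multiset.cons_coe, Multiset.cons_inj_right] at this
        rw [Multiset.count_cons_self, Nat.add_sub_cancel]
        exact this
    · intro L hlen hne
      rw [Multiset.card_cons] at hlen
      rw [LinearMap.comp_apply, hder L hlen]
      refine (Submodule.span_le.2 ?_ : _ ≤ LinearMap.ker φ) (der_mem (shifted χ) _ _ L)
      rintro _ ⟨y, M, hy, hM, rfl⟩
      obtain rfl : y = z := by
        by_contra h; simp [h] at hy
      refine h3 M ?_ fun h => hne (by rw [hM, h])
      have := congrArg Multiset.card hM
      simp only [Multiset.coe_card, Multiset.card_cons] at this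
      omega

/-- The Poincaré–Birkhoff–Witt theorem: the normal monomials are linearly independent. -/
theorem linearIndependent_normal (hχ : IsKazhdanEven lev χ)
    (nf : Multiset (Letter ι) → List (Letter ι)) (hnf : ∀ s, (nf s : Multiset (Letter ι)) = s) :
    LinearIndependent ℂ (fun s : {s : Multiset (Letter ι) // Good Prod.fst s} =>
      mon (shifted χ) (nf s)) := by
  rw [linearIndependent_iff]
  intro f hf
  by_contra hne
  obtain ⟨s, hs, hmax⟩ := f.support.exists_max_image (fun s => s.1.card)
    (Finsupp.support_nonempty_iff.2 hne)
  obtain ⟨φ, h1, h2, h3⟩ := exists_detecting_functional hχ s.1 s.2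
  have := congrArg φ hf
  rw [map_zero, Finsupp.linearCombination_apply, Finsupp.sum, map_sum,
    Finset.sum_eq_single_of_mem s hs] at this
  · rw [map_smul, smul_eq_zero] at this
    exact this.elim (Finsupp.mem_support_iff.1 hs) (h2 _ (hnf _))
  · intro t ht hts
    rw [map_smul]
    have hl : (nf t).length = t.1.card := by rw [← Multiset.coe_card, hnf]
    rcases (hmax t ht).lt_or_eq with h | h
    · rw [h1 _ (mon_mem_below (hl.trans_lt h) trivial), smul_zero]
    · rw [h3 _ (hl.trans h) (by rw [hnf]; exact fun h => hts (Subtype.ext h)), smul_zero]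

end Independence

/-! ### Graded pieces spanned by words -/

section DegreePart

variable {V A κ X : Type} [AddCommGroup V] [Module ℂ V] [Ring A] [Algebra ℂ A] [AddMonoid κ]

theorem degreePart_le_span {f : V →ₗ[ℂ] A} {D : κ → Submodule ℂ V} {b : X → V} {w : X → κ}
    (hD : ∀ d, D d ≤ Submodule.span ℂ (b '' {x | w x = d})) (k : κ) :
    degreePart f D k ≤
      Submodule.span ℂ (mon (fun x => f (b x)) '' {L | (L.map w).sum = k}) := by
  refine Submodule.span_le.2 ?_
  rintro _ ⟨L, hL, rfl, rfl⟩
  induction L with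
  | nil => exact Submodule.subset_span ⟨[], by simp, by simp⟩
  | cons p L ih =>
    have h1 := ih fun q hq => hL q (List.mem_cons_of_mem _ hq)
    have h2 : f p.2 ∈ Submodule.span ℂ ((fun x => f (b x)) '' {x | w x = p.1}) := by
      refine map_mem_of_span f ?_ (hD p.1 (hL p List.mem_cons_self))
      rintro _ ⟨x, hx, rfl⟩
      exact Submodule.subset_span ⟨x, hx, rfl⟩
    have h3 := Submodule.mul_mem_mul h2 h1
    rw [Submodule.span_mul_span] at h3
    simp only [List.map_cons, List.prod_cons, List.sum_cons]
    refine Submodule.span_mono ?_ h3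
    rintro _ ⟨_, ⟨x, hx, rfl⟩, _, ⟨M, hM, rfl⟩, rfl⟩
    refine ⟨x :: M, ?_, by simp⟩
    simp only [Set.mem_ofPred_eq, List.map_cons, List.sum_cons] at *
    rw [hx, hM]

theorem mon_mem_degreePart {f : V →ₗ[ℂ] A} {D : κ → Submodule ℂ V} {b : X → V} {w : X → κ}
    (hb : ∀ x, b x ∈ D (w x)) (L : List X) :
    mon (fun x => f (b x)) L ∈ degreePart f D (L.map w).sum := by
  refine Submodule.subset_span ⟨L.map fun x => (w x, b x), ?_, ?_, ?_⟩
  · simp only [List.mem_map, forall_exists_index, and_imp]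
    rintro _ x - rfl
    exact hb x
  · rw [List.map_map]; rfl
  · rw [List.map_map]; rfl

end DegreePart

/-- The enveloping superalgebra is spanned by words. -/
theorem env_induction {ι : Type} [Fintype ι] [DecidableEq ι] (χ : Queer ι →ₗ[ℂ] ℂ) (v : Env ι) :
    v ∈ Submodule.span ℂ (Set.range (mon (shifted χ))) := by
  obtain ⟨t, rfl⟩ := RingQuot.mkAlgHom_surjective ℂ (EnvRel ι) v
  induction t using TensorAlgebra.induction with
  | algebraMap c =>
    rw [AlgHom.commutes, Algebra.algebraMap_eq_smul_one]
    exact Submodule.smul_mem _ _ (Submodule.subset_span ⟨[], rfl⟩)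
  | ι x =>
    change Env.of ι x ∈ _
    have hl : ∀ z, Env.of ι (letter z) ∈ Submodule.span ℂ (Set.range (mon (shifted χ))) := by
      intro z
      rw [of_letter_eq χ]
      refine add_mem (Submodule.subset_span ⟨[z], by simp⟩) ?_
      rw [Algebra.algebraMap_eq_smul_one]
      exact Submodule.smul_mem _ _ (Submodule.subset_span ⟨[], rfl⟩)
    rw [eq_sum_letter x, map_sum]
    refine sum_mem fun a _ => ?_
    rw [map_sum]
    refine sum_mem fun b _ => ?_
    rw [map_add, map_smul, map_smul]
    exact add_mem (Submodule.smul_mem _ _ (hl _)) (Submodule.smul_mem _ _ (hl _))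
  | mul s t hs ht =>
    rw [map_mul]
    have h3 := Submodule.mul_mem_mul hs ht
    rw [Submodule.span_mul_span] at h3
    refine Submodule.span_mono ?_ h3
    rintro _ ⟨_, ⟨x, rfl⟩, _, ⟨M, rfl⟩, rfl⟩
    exact ⟨x ++ M, by simp⟩
  | add s t hs ht =>
    rw [map_add]
    exact add_mem hs ht

/-! ### The generalized Whittaker module -/

section Whittaker

variable {r l : ℕ}

variable (r l) in
/-- The position of a row or column in its Jordan block. -/
abbrev lev : Fin r × Fin l → ℕ := fun a => a.2

variable (r l) in
/-- The letters for the index set of `Q(n)`, `n = r l`. -/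
abbrev Lt : Type := Letter (Fin r × Fin l)

/-- The letters `x - χ(x)` of the enveloping superalgebra. -/
abbrev gen (x : Lt r l) : UQ r l := shifted (chi r l) x

/-- The Kazhdan degree of a multiset of letters. -/
abbrev kdegS (s : Multiset (Lt r l)) : ℤ := (s.map (wt (lev r l))).sum

theorem chi_letter (x : Lt r l) : chi r l (letter x) =
    if x.1 = 0 ∧ x.2.2.1 = x.2.1.1 ∧ (x.2.1.2 : ℕ) = x.2.2.2 + 1 then 1 else 0 := by
  obtain ⟨c, a, b⟩ := x
  change Matrix.trace (Queer.mul _ _).odd = _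
  rcases zmod_two_cases c with rfl | rfl
  · simp [letter, Queer.mul, oddE, jordan, Matrix.trace_single_mul, Matrix.of_apply]
  · simp [letter, Queer.mul, oddE]

theorem isKazhdanEven_chi : IsKazhdanEven (lev r l) (chi r l) := by
  intro x hx
  rw [chi_letter] at hx
  have h : x.1 = 0 ∧ x.2.2.1 = x.2.1.1 ∧ (x.2.1.2 : ℕ) = x.2.2.2 + 1 := by
    by_contra h; exact hx (if_neg h)
  refine ⟨?_, h.1⟩
  simp only [wt, lev, h.2.2]
  push_cast
  ring

theorem gen_superComm :
    SuperComm (gen (r := r) (l := l)) Prod.fst (commWords (lev r l)) :=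
  shifted_superComm isKazhdanEven_chi

theorem letter_mem_dynkin (x : Lt r l) : letter x ∈ dynkin r l (wt (lev r l) x - 2) := by
  obtain ⟨c, a, b⟩ := x
  change ⁅cartanH r l, letter _⁆ = _
  rcases zmod_two_cases c with rfl | rfl <;>
  · ext1 <;> simp only [letter, cartanH, Queer.bracket_even, Queer.bracket_odd, Queer.smul_even,
      Queer.smul_odd, if_true, one_ne_zero, if_false] <;>
    ext i j <;>
    simp [Matrix.diagonal_mul, Matrix.mul_diagonal, Matrix.single_apply, wt] <;>
    · split_ifs with h
      · rw [h.1, h.2]; ring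
      · simp

theorem entry_eq_zero_of_mem_dynkin {j : ℤ} {v : Queer (Fin r × Fin l)} (hv : v ∈ dynkin r l j)
    (a b : Fin r × Fin l) (h : 2 * ((b.2 : ℤ) - a.2) ≠ j) : v.even a b = 0 ∧ v.odd a b = 0 := by
  have hv' : ⁅cartanH r l, v⁆ = (j : ℂ) • v := hv
  have h1 := congrFun₂ (congrArg Queer.even hv') a b
  have h2 := congrFun₂ (congrArg Queer.odd hv') a b
  simp only [cartanH, Queer.bracket_even, Queer.bracket_odd, Queer.smul_even, Queer.smul_odd,
    Matrix.zero_mul, Matrix.mul_zero, sub_zero, Matrix.add_apply, Matrix.sub_apply,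
    Matrix.zero_apply,
    Matrix.diagonal_mul, Matrix.mul_diagonal, Matrix.smul_apply, smul_eq_mul, add_zero] at h1 h2
  have hne : (2 * ((b.2 : ℂ) - (a.2 : ℕ)) - j) ≠ 0 := by
    intro h0
    apply h
    have : ((2 * ((b.2 : ℤ) - a.2) - j : ℤ) : ℂ) = 0 := by push_cast; exact h0
    have := Int.cast_eq_zero.1 this
    omega
  constructor
  · refine (mul_eq_zero.1
      (?_ : (2 * ((b.2 : ℂ) - (a.2 : ℕ)) - j) * v.even a b = 0)).resolve_left hne
    linear_combination h1
  · refine (mul_eq_zero.1 (?_ : (2 * ((b.2 : ℂ) - (a.2 : ℕ)) - j) * v.odd a b = 0)).resolve_left hne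
    linear_combination h2

theorem dynkin_le_span (j : ℤ) : dynkin r l j ≤
    Submodule.span ℂ (letter '' {x : Lt r l | wt (lev r l) x - 2 = j}) := by
  intro v hv
  rw [eq_sum_letter v]
  refine sum_mem fun a _ => sum_mem fun b _ => ?_
  by_cases h : 2 * ((b.2 : ℤ) - a.2) = j
  · refine add_mem (Submodule.smul_mem _ _ (Submodule.subset_span ⟨(0, a, b), ?_, rfl⟩))
      (Submodule.smul_mem _ _ (Submodule.subset_span ⟨(1, a, b), ?_, rfl⟩)) <;>
    simp [wt, h]
  · obtain ⟨h1, h2⟩ := entry_eq_zero_of_mem_dynkin hv a b h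
    simp [h1, h2]

theorem letter_mem_nilM {x : Lt r l} (hx : wt (lev r l) x ≤ 0) : letter x ∈ nilM r l :=
  (le_iSup₂_of_le (f := fun (j : ℤ) (_ : j ≤ -2) => dynkin r l j) (wt (lev r l) x - 2)
    (by omega) le_rfl) (letter_mem_dynkin x)

theorem nilM_le_span : nilM r l ≤
    Submodule.span ℂ (letter '' {x : Lt r l | wt (lev r l) x ≤ 0}) := by
  refine iSup_le fun j => iSup_le fun hj => (dynkin_le_span j).trans (Submodule.span_mono ?_)
  refine Set.image_mono fun x hx => ?_
  simp only [Set.mem_ofPred_eq] at *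
  omega

theorem mon_of_letter_mem (L : List (Lt r l)) :
    mon (fun x => Env.of _ (letter x)) L ∈ Submodule.span ℂ (mon gen '' {M |
      (M.map (wt (lev r l))).sum = (L.map (wt (lev r l))).sum ∧
      (M.map Prod.fst).sum = (L.map Prod.fst).sum}) := by
  induction L with
  | nil => exact Submodule.subset_span ⟨[], by simp, by simp⟩
  | cons x L ih =>
    have h3 := Submodule.mul_mem_mul (of_letter_mem isKazhdanEven_chi x) ih
    rw [Submodule.span_mul_span] at h3
    rw [mon_cons]
    refine Submodule.span_mono ?_ h3
    rintro _ ⟨_, ⟨x, ⟨-, hx, hx'⟩, rfl⟩, _, ⟨M, ⟨hM, hM'⟩, rfl⟩, rfl⟩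
    refine ⟨x ++ M, ?_, by simp⟩
    simp only [Set.mem_ofPred_eq, List.map_append, List.sum_append, List.map_cons, List.sum_cons]
    exact ⟨by rw [hx, hM], by rw [hx', hM']⟩

/-- The span of the monomials of Kazhdan degree at most `k` and of parity `a`. -/
def kazhdanParity (k : ℤ) (a : ZMod 2) : Submodule ℂ (UQ r l) :=
  Submodule.span ℂ (mon gen '' {M | (M.map (wt (lev r l))).sum ≤ k ∧ (M.map Prod.fst).sum = a})

theorem gen_mem_kazhdanU (x : Lt r l) : gen x ∈ kazhdanU r l (wt (lev r l) x) := by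
  have h1 : Env.of _ (letter x) ∈ kazhdanU r l (wt (lev r l) x) := by
    refine (le_iSup₂_of_le (f := fun (d : ℤ) (_ : d ≤ wt (lev r l) x) =>
      degreePart (Env.of _) (fun d => dynkin r l (d - 2)) d) _ le_rfl le_rfl) ?_
    have := mon_mem_degreePart (f := Env.of _) (D := fun d => dynkin r l (d - 2))
      (b := letter) (w := (wt (lev r l))) letter_mem_dynkin [x]
    simpa using this
  refine sub_mem h1 ?_
  by_cases h : chi r l (letter x) = 0
  · simp [h]
  · rw [Algebra.algebraMap_eq_smul_one, (isKazhdanEven_chi x h).1]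
    exact Submodule.smul_mem _ _ (one_mem_kazhdanU r l)

theorem mon_mem_kazhdanU (L : List (Lt r l)) :
    mon gen L ∈ kazhdanU r l (L.map (wt (lev r l))).sum := by
  induction L with
  | nil => exact one_mem_kazhdanU r l
  | cons x L ih => simpa using mul_mem_kazhdanU r l (gen_mem_kazhdanU x) ih

theorem kazhdanU_eq_span (k : ℤ) : kazhdanU r l k =
    Submodule.span ℂ (mon gen '' {M | (M.map (wt (lev r l))).sum ≤ k}) := by
  apply le_antisymm
  · refine iSup_le fun d => iSup_le fun hd => ?_
    refine (degreePart_le_span (b := letter) (w := (wt (lev r l))) (fun d => ?_) d).trans ?_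
    · refine (dynkin_le_span _).trans (Submodule.span_mono (Set.image_mono fun x hx => ?_))
      simp only [Set.mem_ofPred_eq] at *
      omega
    · refine Submodule.span_le.2 ?_
      rintro _ ⟨L, hL, rfl⟩
      refine Submodule.span_mono (Set.image_mono ?_) (mon_of_letter_mem L)
      rintro M ⟨hM, -⟩
      simp only [Set.mem_ofPred_eq] at *
      omega
  · refine Submodule.span_le.2 ?_
    rintro _ ⟨L, hL, rfl⟩
    exact kazhdanU_mono r l hL (mon_mem_kazhdanU L)

theorem proj_mul (a b : UQ r l) : proj r l (a * b) = a • proj r l b := rfl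

theorem proj_eq_zero {a : UQ r l} : proj r l a = 0 ↔ a ∈ whittakerIdeal r l :=
  Submodule.Quotient.mk_eq_zero _

/-- Letters of nonpositive Kazhdan degree, on the right of a word, vanish in the Whittaker module.
-/
theorem proj_mul_gen (a : UQ r l) {z : Lt r l} (hz : wt (lev r l) z ≤ 0) :
    proj r l (a * gen z) = 0 :=
  proj_eq_zero.2 (Ideal.mul_mem_left _ _ (Ideal.subset_span ⟨_, letter_mem_nilM hz, rfl⟩))

theorem proj_mon_append_gen (L : List (Lt r l)) {z : Lt r l}
    (hz : wt (lev r l) z ≤ 0) : proj r l (mon gen (L ++ [z])) = 0 := by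
  simpa using proj_mul_gen (mon gen L) hz

/-- The word with multiset of letters `s` in which the letters of positive Kazhdan degree come
first. -/
def nfWord (s : Multiset (Lt r l)) : List (Lt r l) :=
  (s.filter fun x => 0 < wt (lev r l) x).toList ++ (s.filter fun x => ¬ 0 < wt (lev r l) x).toList

theorem coe_nfWord (s : Multiset (Lt r l)) :
    (nfWord s : Multiset (Lt r l)) = s := by
  rw [nfWord, ← Multiset.coe_add, Multiset.coe_toList, Multiset.coe_toList,
    Multiset.filter_add_not]

/-- A normal word that contains a letter of nonpositive degree ends with such a letter. -/
theorem proj_mon_nfWord_eq_zero {s : Multiset (Lt r l)} {z} (hz : z ∈ s)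
    (hz' : wt (lev r l) z ≤ 0) : proj r l (mon gen (nfWord s)) = 0 := by
  have hne : (s.filter fun x => ¬ 0 < wt (lev r l) x).toList ≠ [] := by
    rw [Ne, Multiset.toList_eq_nil]
    intro h
    exact Multiset.filter_eq_nil.1 h z hz (not_lt.2 hz')
  rw [nfWord, ← List.dropLast_append_getLast hne, ← List.append_assoc]
  refine proj_mon_append_gen _ ?_
  have := List.getLast_mem hne
  rw [Multiset.mem_toList, Multiset.mem_filter] at this
  exact not_lt.1 this.2

/-- A formulation of `Good` that needs decidable equality. -/
theorem good_iff_count {X : Type} [DecidableEq X] {par : X → ZMod 2} {s : Multiset X} :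
    Good par s ↔ ∀ x, par x = 1 → s.count x ≤ 1 := by
  refine ⟨fun h x hx => h.count_le hx, fun h x hx t ht => ?_⟩
  have := h x hx
  rw [ht, Multiset.count_cons_self, Multiset.count_cons_self] at this
  omega

/-- The left ideal of the generalized Whittaker module is spanned by the normal monomials that
contain a letter of nonpositive Kazhdan degree. -/
theorem whittakerIdeal_le_span {v : UQ r l} (hv : v ∈ whittakerIdeal r l) :
    v ∈ Submodule.span ℂ {a | ∃ s : Multiset (Lt r l), Good Prod.fst s ∧
      (∃ z ∈ s, ¬ 0 < wt (lev r l) z) ∧ a = mon gen (nfWord s)} := by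
  set N := Submodule.span ℂ {a | ∃ s : Multiset (Lt r l), Good Prod.fst s ∧
      (∃ z ∈ s, ¬ 0 < wt (lev r l) z) ∧ a = mon gen (nfWord s)} with hN
  -- a normal word followed by a letter of nonpositive degree
  have h1 : ∀ (s : Multiset (Lt r l)), Good Prod.fst s → ∀ z, wt (lev r l) z ≤ 0 →
      mon gen (nfWord s) * gen z ∈ N := by
    intro s hs z hz
    set p := s.filter fun x => 0 < wt (lev r l) x with hp
    set q := s.filter fun x => ¬ 0 < wt (lev r l) x with hq
    have h2 := gen_superComm.mem_span_normal
      (J := fun t => t ≠ 0 ∧ ∀ x ∈ t, wt (lev r l) x ≤ 0) (by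
        rintro x y t M ⟨hM1, hM2, -⟩ ⟨-, hJ⟩
        have hx := hJ x (by simp)
        have hy := hJ y (by simp)
        rcases M with _ | ⟨w, _ | ⟨w', M⟩⟩
        · simp at hM2
          omega
        · refine ⟨by simp, fun u hu => ?_⟩
          simp only [List.map_cons, List.map_nil, List.sum_cons, List.sum_nil] at hM2
          rw [Multiset.mem_add] at hu
          rcases hu with hu | hu
          · obtain rfl : u = w := by simpa using hu
            omega
          · exact hJ u (by simp [hu])
        · simp at hM1)
      Multiset.toList Multiset.coe_toList (q.toList ++ [z]) (by
        refine ⟨by simp, fun x hx => ?_⟩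
        simp only [Multiset.mem_coe, List.mem_append, Multiset.mem_toList, List.mem_singleton] at hx
        rcases hx with hx | rfl
        · exact not_lt.1 (Multiset.mem_filter.1 hx).2
        · exact hz)
    rw [nfWord, mon_append, mul_assoc]
    have h3 : mon gen q.toList * gen z = mon gen (q.toList ++ [z]) := by simp
    rw [h3]
    refine mul_mem_of_span ?_ h2
    rintro _ ⟨t, ht, ⟨ht0, hJ⟩, rfl⟩
    have hpp : ∀ x ∈ p, 0 < wt (lev r l) x := fun x hx => (Multiset.mem_filter.1 hx).2
    refine Submodule.subset_span ⟨p + t, ?_, ?_, ?_⟩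
    · rw [good_iff_count] at hs ht ⊢
      intro x hx
      rw [Multiset.count_add]
      by_cases hx' : 0 < wt (lev r l) x
      · rw [Multiset.count_eq_zero.2 (fun h => absurd (hJ x h) (not_le.2 hx')), add_zero]
        exact (Multiset.count_le_of_le x (Multiset.filter_le _ _)).trans (hs x hx)
      · rw [Multiset.count_eq_zero.2 (fun h => hx' (hpp x h)), zero_add]
        exact ht x hx
    · obtain ⟨x, hx⟩ := Multiset.exists_mem_of_ne_zero ht0
      exact ⟨x, by simp [hx], not_lt.2 (hJ x hx)⟩
    · rw [nfWord, Multiset.filter_add, Multiset.filter_add, Multiset.filter_eq_self.2 hpp,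
        (Multiset.filter_eq_nil (s := t)).2 (fun x hx => not_lt.2 (hJ x hx)),
        (Multiset.filter_eq_nil (s := p)).2 (by simpa using hpp),
        (Multiset.filter_eq_self (s := t)).2 (fun x hx => not_lt.2 (hJ x hx))]
      simp [hp]
  have h2 : ∀ (a : UQ r l) z, wt (lev r l) z ≤ 0 → a * gen z ∈ N := by
    intro a z hz
    refine map_mem_of_span (LinearMap.mulRight ℂ (gen z)) ?_ (env_induction (chi r l) a)
    rintro _ ⟨L, rfl⟩
    refine map_mem_of_span (LinearMap.mulRight ℂ (gen z)) ?_
      (gen_superComm.mem_span_normal (J := fun _ => True) (fun _ _ _ _ _ _ => trivial)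
        nfWord coe_nfWord L trivial)
    rintro _ ⟨s, hs, -, rfl⟩
    exact h1 s hs z hz
  have h3 : ∀ x ∈ nilM r l, ∀ a : UQ r l,
      a * (Env.of _ x - algebraMap ℂ (UQ r l) (chi r l x)) ∈ N := by
    intro x hx a
    have := map_mem_of_span (N := N) (LinearMap.mulLeft ℂ a ∘ₗ (Env.of _ -
      (Algebra.linearMap ℂ (UQ r l)) ∘ₗ chi r l)) ?_ (nilM_le_span hx)
    · exact this
    · rintro _ ⟨z, hz, rfl⟩
      exact h2 a z hz
  have h4 : ∀ a : UQ r l, a * v ∈ N := by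
    refine Submodule.span_induction (p := fun v _ => ∀ a : UQ r l, a * v ∈ N) ?_ ?_ ?_ ?_ hv
    · rintro _ ⟨x, hx, rfl⟩ a
      exact h3 x hx a
    · intro a; simp
    · intro x y _ _ hx hy a
      rw [mul_add]; exact add_mem (hx a) (hy a)
    · intro b x _ hx a
      rw [smul_eq_mul, ← mul_assoc]; exact hx _
  simpa using h4 1

variable (r l) in
/-- The exponents of the normal monomials in letters of positive Kazhdan degree. -/
abbrev Expo : Type :=
  {s : Multiset (Lt r l) // Good Prod.fst s ∧ ∀ x ∈ s, 0 < wt (lev r l) x}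

/-- The normal monomials in the generalized Whittaker module. -/
def qmon (s : Expo r l) : WhittakerModule r l := proj r l (mon gen (nfWord s.1))

variable (r l) in
/-- The normal monomials in letters of positive degree are linearly independent modulo the left
ideal, which is spanned by the other normal monomials. -/
theorem linearIndependent_qmon : LinearIndependent ℂ (qmon (r := r) (l := l)) := by
  have h := linearIndependent_normal (isKazhdanEven_chi (r := r) (l := l)) nfWord coe_nfWord
  have h1 : LinearIndependent ℂ (fun s : Expo r l => mon gen (nfWord s.1)) :=
    h.comp (fun s : Expo r l => ⟨s.1, s.2.1⟩) fun s t hst => Subtype.ext (Subtype.mk.inj hst)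
  refine h1.map (f := proj r l) ?_
  have h2 := h.disjoint_span_image (s := {s | ∀ x ∈ s.1, 0 < wt (lev r l) x})
    (t := {s | ∃ x ∈ s.1, ¬ 0 < wt (lev r l) x}) (by
      rw [Set.disjoint_left]
      rintro s hs ⟨x, hx, hx'⟩
      exact hx' (hs x hx))
  refine h2.mono (Submodule.span_mono ?_) ?_
  · rintro _ ⟨s, rfl⟩
    exact ⟨⟨s.1, s.2.1⟩, s.2.2, rfl⟩
  · intro v hv
    refine Submodule.span_mono ?_ (whittakerIdeal_le_span (proj_eq_zero.1 hv))
    rintro _ ⟨s, hs, hz, rfl⟩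
    exact ⟨⟨s, hs⟩, hz, rfl⟩

/-- The Kazhdan filtration of the generalized Whittaker module. -/
abbrev kazhdanQ (k : ℤ) : Submodule ℂ (WhittakerModule r l) := (kazhdanU r l k).map (proj r l)

theorem kdegS_coe (L : List (Lt r l)) :
    kdegS (L : Multiset (Lt r l)) = (L.map (wt (lev r l))).sum := by
  simp [kdegS]

/-- The supercommutator of two letters lowers the Kazhdan degree by two. -/
theorem kdegS_comm {x y : Lt r l} {s : Multiset (Lt r l)}
    {M : List (Lt r l)} (hM : M ∈ commWords (lev r l) x y) :
    kdegS ((M : Multiset (Lt r l)) + s) = kdegS (x ::ₘ y ::ₘ s) - 2 := by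
  have := hM.2.1
  simp only [kdegS, Multiset.map_add, Multiset.sum_add, Multiset.map_cons, Multiset.sum_cons,
    Multiset.map_coe, Multiset.sum_coe, this]
  ring

theorem kazhdanQ_eq_span (k : ℤ) : kazhdanQ (r := r) (l := l) k =
    Submodule.span ℂ (qmon '' {s | kdegS s.1 ≤ k}) := by
  apply le_antisymm
  · rw [kazhdanQ, kazhdanU_eq_span, Submodule.map_span_le]
    rintro _ ⟨L, hL, rfl⟩
    have h := gen_superComm.mem_span_normal (J := fun s => kdegS s ≤ k) (by
      intro x y s M hM hs
      rw [kdegS_comm hM]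
      omega) nfWord coe_nfWord L (by rw [kdegS_coe]; exact hL)
    refine map_mem_of_span (proj r l) ?_ h
    rintro _ ⟨s, hs, hk, rfl⟩
    by_cases hpos : ∀ x ∈ s, 0 < wt (lev r l) x
    · exact Submodule.subset_span ⟨⟨s, hs, hpos⟩, hk, rfl⟩
    · push Not at hpos
      obtain ⟨z, hz, hz'⟩ := hpos
      rw [proj_mon_nfWord_eq_zero hz hz']
      exact zero_mem _
  · refine Submodule.span_le.2 ?_
    rintro _ ⟨s, hs, rfl⟩
    refine ⟨_, kazhdanU_mono r l hs ?_, rfl⟩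
    have := mon_mem_kazhdanU (nfWord s.1)
    rwa [← kdegS_coe, coe_nfWord] at this

theorem kazhdanQ_mono : Monotone (kazhdanQ (r := r) (l := l)) :=
  fun _ _ h => Submodule.map_mono (kazhdanU_mono r l h)

theorem proj_mon_mem (L : List (Lt r l)) {k : ℤ} (h : kdegS (L : Multiset (Lt r l)) ≤ k) :
    proj r l (mon gen L) ∈ kazhdanQ k :=
  ⟨_, kazhdanU_mono r l h (by rw [kdegS_coe]; exact mon_mem_kazhdanU L), rfl⟩

variable (r l) in
/-- The basis of the generalized Whittaker module by normal monomials. -/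
def qbasis : Module.Basis (Expo r l) ℂ (WhittakerModule r l) :=
  Module.Basis.mk (linearIndependent_qmon r l) (by
    intro v _
    obtain ⟨a, rfl⟩ := Submodule.Quotient.mk_surjective _ v
    have h := map_mem_of_span (N := Submodule.span ℂ (Set.range qmon)) (proj r l) (by
      rintro _ ⟨L, rfl⟩
      have h1 := proj_mon_mem L le_rfl
      rw [kazhdanQ_eq_span] at h1
      exact Submodule.span_mono (Set.image_subset_range _ _) h1) (env_induction (chi r l) a)
    exact h)

/-- The coefficient of a normal monomial. -/
def coeff (s : Expo r l) : WhittakerModule r l →ₗ[ℂ] ℂ := (qbasis r l).coord s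

theorem coeff_qmon (s t : Expo r l) : coeff s (qmon t) = if t = s then 1 else 0 := by
  have : qmon t = qbasis r l t := by simp [qbasis]
  rw [coeff, this, Module.Basis.coord_apply, Module.Basis.repr_self, Finsupp.single_apply]

theorem mem_kazhdanQ_iff {k : ℤ} {v : WhittakerModule r l} :
    v ∈ kazhdanQ k ↔ ∀ s : Expo r l, k < kdegS s.1 → coeff s v = 0 := by
  constructor
  · intro hv s hs
    rw [kazhdanQ_eq_span] at hv
    have := map_mem_of_span (N := ⊥) (coeff s) ?_ hv
    · simpa using this
    · rintro _ ⟨t, ht, rfl⟩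
      rw [coeff_qmon, if_neg, Submodule.mem_bot]
      rintro rfl
      exact absurd ht (not_le.2 hs)
  · intro h
    rw [← (qbasis r l).linearCombination_repr v, Finsupp.linearCombination_apply, Finsupp.sum]
    refine sum_mem fun s hs => ?_
    by_cases hk : kdegS s.1 ≤ k
    · refine Submodule.smul_mem _ _ ?_
      have : qbasis r l s = qmon s := by simp [qbasis]
      rw [this, kazhdanQ_eq_span]
      exact Submodule.subset_span ⟨s, hk, rfl⟩
    · exact absurd (h s (not_le.1 hk)) (Finsupp.mem_support_iff.1 hs)

theorem coeff_eq_zero {k : ℤ} {v : WhittakerModule r l} (hv : v ∈ kazhdanQ k) {s : Expo r l}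
    (hs : k < kdegS s.1) : coeff s v = 0 := mem_kazhdanQ_iff.1 hv s hs

theorem kdegS_nonneg (s : Expo r l) : 0 ≤ kdegS s.1 :=
  Multiset.sum_nonneg (by
    intro x hx
    obtain ⟨y, hy, rfl⟩ := Multiset.mem_map.1 hx
    exact (s.2.2 y hy).le)

theorem eq_zero_of_mem_kazhdanQ {k : ℤ} (hk : k < 0) {v : WhittakerModule r l}
    (hv : v ∈ kazhdanQ k) : v = 0 := by
  apply (qbasis r l).repr.injective
  ext s
  rw [map_zero, Finsupp.zero_apply]
  exact coeff_eq_zero hv (hk.trans_le (kdegS_nonneg s))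

theorem gen_smul_mem {k : ℤ} {x : Lt r l} {v : WhittakerModule r l}
    (hv : v ∈ kazhdanQ k) : gen x • v ∈ kazhdanQ (wt (lev r l) x + k) := by
  obtain ⟨y, hy, rfl⟩ := hv
  exact ⟨gen x * y, mul_mem_kazhdanU r l (gen_mem_kazhdanU x) hy, rfl⟩

theorem proj_below_mem {k : ℤ} {n : ℕ} {v : UQ r l}
    (hv : v ∈ below gen (fun s => kdegS s ≤ k) n) : proj r l v ∈ kazhdanQ k := by
  refine map_mem_of_span (proj r l) ?_ hv
  rintro _ ⟨M, -, hM, rfl⟩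
  exact proj_mon_mem M hM

/-- Reordering a word changes its image in the generalized Whittaker module by a sign, up to terms
of lower Kazhdan degree. -/
theorem proj_mon_perm {L L' : List (Lt r l)}
    (h : (L : Multiset (Lt r l)) = ↑L') :
    ∃ c : ℂ, (c = 1 ∨ c = -1) ∧
      proj r l (mon gen L) - c • proj r l (mon gen L') ∈
        kazhdanQ (kdegS (L : Multiset (Lt r l)) - 1) := by
  obtain ⟨c, hc, hm⟩ := gen_superComm.perm_mem
    (J := fun s => kdegS s ≤ kdegS (L : Multiset (Lt r l)))
    (J' := fun s => kdegS s ≤ kdegS (L : Multiset (Lt r l)) - 1) (by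
      intro x y s M hM hs
      rw [kdegS_comm hM]
      omega) (Multiset.coe_eq_coe.1 h) [] le_rfl
  refine ⟨c, hc, ?_⟩
  simpa using proj_below_mem hm

/-- Words with a letter of nonpositive degree have no leading term. -/
theorem proj_mon_mem_of_nonpos {L : List (Lt r l)} {z} (hz : z ∈ L)
    (hz' : wt (lev r l) z ≤ 0) :
    proj r l (mon gen L) ∈ kazhdanQ (kdegS (L : Multiset (Lt r l)) - 1) := by
  obtain ⟨c, -, hm⟩ := proj_mon_perm (coe_nfWord (L : Multiset (Lt r l))).symm
  rwa [proj_mon_nfWord_eq_zero (Multiset.mem_coe.2 hz) hz', smul_zero, sub_zero] at hm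

/-- Up to lower degrees, a word is zero or a multiple of the normal monomial with the same letters.
-/
theorem coeff_mon_of_ne {L : List (Lt r l)} {s : Expo r l}
    (hne : (L : Multiset (Lt r l)) ≠ s.1) (hk : kdegS (L : Multiset (Lt r l)) ≤ kdegS s.1) :
    coeff s (proj r l (mon gen L)) = 0 := by
  by_cases hp : ∀ x ∈ L, 0 < wt (lev r l) x
  · by_cases hg : Good Prod.fst (L : Multiset (Lt r l))
    · obtain ⟨c, -, hm⟩ := proj_mon_perm (coe_nfWord (L : Multiset (Lt r l))).symm
      have h1 := coeff_eq_zero hm (s := s) (by omega)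
      have h2 : coeff s (qmon ⟨↑L, hg, hp⟩) = 0 := by
        rw [coeff_qmon, if_neg]
        rintro rfl
        exact hne rfl
      rw [map_sub, map_smul, show proj r l (mon gen (nfWord ↑L)) = qmon ⟨↑L, hg, hp⟩ from rfl,
        h2, smul_zero, sub_zero] at h1
      exact h1
    · simp only [Good, not_forall, not_not] at hg
      obtain ⟨x, hx, t, ht⟩ := hg
      have := gen_superComm.mem_of_odd_repeat
        (J := fun s => kdegS s ≤ kdegS (L : Multiset (Lt r l)))
        (J' := fun s => kdegS s ≤ kdegS (L : Multiset (Lt r l)) - 1) (by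
          intro x y s M hM hs
          rw [kdegS_comm hM]
          omega) le_rfl hx ht
      exact coeff_eq_zero (proj_below_mem this) (by omega)
  · push Not at hp
    obtain ⟨z, hz, hz'⟩ := hp
    exact coeff_eq_zero (proj_mon_mem_of_nonpos hz hz') (by omega)

theorem coeff_mon_of_eq {L : List (Lt r l)} {s : Expo r l}
    (he : (L : Multiset (Lt r l)) = s.1) :
    coeff s (proj r l (mon gen L)) ≠ 0 := by
  obtain ⟨c, hc, hm⟩ := proj_mon_perm (he.trans (coe_nfWord s.1).symm)
  have h1 := coeff_eq_zero hm (s := s) (by rw [he]; omega)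
  rw [map_sub, map_smul, show proj r l (mon gen (nfWord s.1)) = qmon s from rfl, coeff_qmon,
    if_pos rfl, sub_eq_zero] at h1
  rw [h1]
  rcases hc with rfl | rfl <;> simp

end Whittaker

/-! ### Whittaker vectors are determined by their coefficients along the first rows -/

section UpperBound

variable {r l : ℕ}

/-- The words of degree `K` with at least `d` letters, together with everything of lower degree. -/
def longPart (K : ℤ) (d : ℕ) : Submodule ℂ (WhittakerModule r l) :=
  kazhdanQ (K - 1) ⊔ Submodule.span ℂ {v | ∃ M : List (Lt r l),
    kdegS (M : Multiset (Lt r l)) = K ∧ d ≤ M.length ∧ v = proj r l (mon gen M)}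

theorem longPart_le_kazhdanQ (K : ℤ) (d : ℕ) : longPart (r := r) (l := l) K d ≤ kazhdanQ K := by
  refine sup_le (kazhdanQ_mono (by omega)) (Submodule.span_le.2 ?_)
  rintro _ ⟨M, hM, -, rfl⟩
  exact proj_mon_mem M hM.le

theorem coeff_eq_zero_of_mem_longPart {K : ℤ} {d : ℕ} {v : WhittakerModule r l}
    (hv : v ∈ longPart K d) {s : Expo r l} (hs : kdegS s.1 = K) (hd : s.1.card < d) :
    coeff s v = 0 := by
  have : longPart (r := r) (l := l) K d ≤ LinearMap.ker (coeff s) := by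
    refine sup_le (fun v hv => coeff_eq_zero hv (by omega)) (Submodule.span_le.2 ?_)
    rintro _ ⟨M, hM, hl, rfl⟩
    refine coeff_mon_of_ne (fun h => ?_) (by omega)
    rw [← h, Multiset.coe_card] at hd
    omega
  exact this hv

theorem gen_smul_mem_longPart {K K' : ℤ} {d : ℕ} {x : Lt r l} {v : WhittakerModule r l}
    (hv : v ∈ longPart K d) (hK : wt (lev r l) x + K = K') : gen x • v ∈ longPart K' (d + 1) := by
  have : longPart K d ≤ (longPart K' (d + 1)).comap
      (Algebra.lsmul ℂ ℂ (WhittakerModule r l) (gen x)) := by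
    refine sup_le (fun v hv => ?_) (Submodule.span_le.2 ?_)
    · refine Submodule.mem_sup_left ?_
      have := gen_smul_mem (x := x) hv
      rw [show wt (lev r l) x + (K - 1) = K' - 1 by omega] at this
      exact this
    · rintro _ ⟨M, hM, hl, rfl⟩
      refine Submodule.mem_sup_right (Submodule.subset_span ⟨x :: M, ?_, by simp; omega, ?_⟩)
      · rw [← Multiset.cons_coe, kdegS, Multiset.map_cons, Multiset.sum_cons]
        change _ + kdegS _ = _
        rw [hM, hK]
      · rw [mon_cons, proj_mul]; rfl
  exact this hv

/-- The pairing of letters given by `χ` of their bracket. -/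
def pairing (z y : Lt r l) : ℂ := chi r l ⁅letter z, letter y⁆

theorem of_bracket_sub_mem (z y : Lt r l) :
    Env.of _ ⁅letter z, letter y⁆ - algebraMap ℂ (UQ r l) (pairing z y) ∈
      Submodule.span ℂ (gen '' {w | wt (lev r l) w = wt (lev r l) z + wt (lev r l) y - 2}) := by
  let φ : Queer (Fin r × Fin l) →ₗ[ℂ] UQ r l :=
    Env.of _ - Algebra.linearMap ℂ (UQ r l) ∘ₗ chi r l
  change φ ⁅letter z, letter y⁆ ∈ _
  rw [letter_bracket, map_sub, map_smul]
  refine sub_mem ?_ (Submodule.smul_mem _ _ ?_)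
  · split_ifs with h
    · refine Submodule.subset_span ⟨_, ?_, rfl⟩
      simp only [Set.mem_ofPred_eq, wt, h]; ring
    · simp
  · split_ifs with h
    · refine Submodule.subset_span ⟨_, ?_, rfl⟩
      simp only [Set.mem_ofPred_eq, wt, h]; ring
    · simp

/-- Letters `z` of nonpositive degree act on words as derivations contracting with `pairing z`, up
to words that are longer or of lower degree. -/
theorem gen_smul_mon_sub_der_mem {z : Lt r l} (hz : wt (lev r l) z ≤ 0) (L : List (Lt r l)) :
    proj r l (gen z * mon gen L) -
      proj r l (der gen (fun y => superSign z.1 y.1) (pairing z) L) ∈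
      longPart (wt (lev r l) z + kdegS (L : Multiset (Lt r l)) - 2) L.length := by
  induction L with
  | nil =>
    have := proj_mul_gen 1 hz
    rw [one_mul] at this
    simp [der, this]
  | cons y L ih =>
    have hk : kdegS ((y :: L : List (Lt r l)) : Multiset (Lt r l)) =
        wt (lev r l) y + kdegS (L : Multiset (Lt r l)) := by
      rw [← Multiset.cons_coe, kdegS, Multiset.map_cons, Multiset.sum_cons]
    have h1 := gen_smul_mem_longPart (x := y) (K' := wt (lev r l) z + kdegS
      ((y :: L : List (Lt r l)) : Multiset (Lt r l)) - 2) ih (by rw [hk]; ring)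
    have h2 : proj r l ((Env.of _ ⁅letter z, letter y⁆ -
        algebraMap ℂ (UQ r l) (pairing z y)) * mon gen L) ∈
        longPart (wt (lev r l) z + kdegS ((y :: L : List (Lt r l)) : Multiset (Lt r l)) - 2)
          (y :: L).length := by
      refine map_mem_of_span (proj r l ∘ₗ LinearMap.mulRight ℂ (mon gen L)) ?_
        (of_bracket_sub_mem z y)
      rintro _ ⟨w, hw, rfl⟩
      refine Submodule.mem_sup_right (Submodule.subset_span ⟨w :: L, ?_, by simp, by simp⟩)
      rw [hk, ← Multiset.cons_coe, kdegS, Multiset.map_cons, Multiset.sum_cons, hw]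
      ring
    have h3 := add_mem (Submodule.smul_mem _ (superSign z.1 y.1) h1) h2
    rw [List.length_cons]
    convert h3 using 1
    have h4 := shifted_comm (isKazhdanEven_chi (r := r) (l := l)) z y
    rw [sub_eq_iff_eq_add] at h4
    have hder : der gen (fun y => superSign z.1 y.1) (pairing z) (y :: L) =
      superSign z.1 y.1 • (gen y * der gen (fun y => superSign z.1 y.1) (pairing z) L) +
        pairing z y • mon gen L := rfl
    rw [hder, mon_cons, ← mul_assoc]
    change proj r l (shifted (chi r l) z * shifted (chi r l) y * _) - _ = _
    rw [h4, smul_sub, ← proj_mul, ← proj_mul, ← (proj r l).map_sub, ← (proj r l).map_sub,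
      ← (proj r l).map_smul, ← (proj r l).map_add]
    congr 1
    rw [smul_sub, sub_mul, add_mul, ← Algebra.smul_def, smul_mul_assoc, mul_assoc]
    abel

theorem wt_of_pairing_ne_zero {z y : Lt r l} (h : pairing z y ≠ 0) :
    wt (lev r l) z + wt (lev r l) y = 2 := by
  by_contra hne
  apply h
  have key : ∀ w : Lt r l, wt (lev r l) w = wt (lev r l) z + wt (lev r l) y - 2 →
      chi r l (letter w) = 0 := by
    intro w hw
    by_contra h0
    have := (isKazhdanEven_chi w h0).1
    omega
  rw [pairing, letter_bracket, map_sub, map_smul]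
  have h1 : chi r l (if z.2.2 = y.2.1 then letter (z.1 + y.1, z.2.1, y.2.2) else 0) = 0 := by
    split_ifs with h
    · apply key; simp only [wt, h]; ring
    · simp
  have h2 : chi r l (if y.2.2 = z.2.1 then letter (z.1 + y.1, y.2.1, z.2.2) else 0) = 0 := by
    split_ifs with h
    · apply key; simp only [wt, h]; ring
    · simp
  rw [h1, h2]; simp

theorem kdegS_of_eq_cons {L M : List (Lt r l)} {y : Lt r l}
    (h : (L : Multiset (Lt r l)) = y ::ₘ (M : Multiset (Lt r l))) :
    kdegS (L : Multiset (Lt r l)) = wt (lev r l) y + kdegS (M : Multiset (Lt r l)) := by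
  rw [h, kdegS, Multiset.map_cons, Multiset.sum_cons]

/-- A letter of nonpositive degree acts on a word through its supercommutators with the letters of
the word, so the degree is lower by two than for a general letter. -/
theorem gen_smul_mem_of_nonpos {z : Lt r l} (hz : wt (lev r l) z ≤ 0) {k : ℤ}
    {v : WhittakerModule r l} (hv : v ∈ kazhdanQ k) :
    gen z • v ∈ kazhdanQ (wt (lev r l) z + k - 2) := by
  rw [kazhdanQ_eq_span] at hv
  refine map_mem_of_span (Algebra.lsmul ℂ ℂ (WhittakerModule r l) (gen z)) ?_ hv
  rintro _ ⟨s, hs, rfl⟩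
  change gen z • proj r l _ ∈ _
  rw [← proj_mul]
  have h1 := longPart_le_kazhdanQ _ _ (gen_smul_mon_sub_der_mem hz (nfWord s.1))
  have h2 : proj r l (der gen (fun y => superSign z.1 y.1) (pairing z) (nfWord s.1)) ∈
      kazhdanQ (wt (lev r l) z + kdegS (nfWord s.1 : Multiset (Lt r l)) - 2) := by
    refine map_mem_of_span (proj r l) ?_ (der_mem gen _ _ (nfWord s.1))
    rintro _ ⟨y, M, hy, hM, rfl⟩
    refine proj_mon_mem M ?_
    have := wt_of_pairing_ne_zero hy
    have := kdegS_of_eq_cons hM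
    omega
  have h3 := add_mem h1 h2
  rw [sub_add_cancel, coe_nfWord] at h3
  refine kazhdanQ_mono ?_ h3
  simp only [Set.mem_ofPred_eq] at hs
  omega

theorem coe_frontWord_erase {X : Type} [DecidableEq X] {x : X} {s : Multiset X} (hx : x ∈ s) :
    ((List.replicate (s.count x - 1) x ++ (s.filter (· ≠ x)).toList : List X) : Multiset X) =
      s.erase x := by
  have h := coe_frontWord x s
  have hc : s.count x = (s.count x - 1) + 1 := by
    have := Multiset.count_pos.2 hx
    omega
  rw [frontWord, hc, List.replicate_succ, List.cons_append, ← Multiset.cons_coe] at h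
  rw [← Multiset.cons_inj_right x, h, Multiset.cons_erase hx]

theorem Good.erase {X : Type} [DecidableEq X] {par : X → ZMod 2} {s : Multiset X} (h : Good par s)
    (x : X) : Good par (s.erase x) := by
  rw [good_iff_count] at h ⊢
  exact fun y hy => (Multiset.count_le_of_le y (Multiset.erase_le x s)).trans (h y hy)

/-- The letters paired nontrivially with a letter `z` of degree `j ≤ 0` are the letter `x`
transposed to `z` with its row moved down by one, and its shift `x'` along the diagonal. -/
theorem eq_or_eq_of_pairing_ne_zero {z x x' y : Lt r l} (hxz : x.1 = z.1) (hxz' : x'.1 = z.1)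
    (h1 : x.2.2 = z.2.1) (h2 : x.2.1.1 = z.2.2.1) (h3 : (x.2.1.2 : ℕ) = z.2.2.2 + 1)
    (h4 : x'.2.1 = z.2.2) (h5 : x'.2.2.1 = z.2.1.1) (h6 : (x'.2.2.2 : ℕ) + 1 = z.2.1.2)
    (h : pairing z y ≠ 0) : y = x ∨ y = x' := by
  by_contra hne
  rw [not_or] at hne
  apply h
  have hc : z.1 + y.1 = 0 → y.1 = z.1 := by
    rcases zmod_two_cases z.1 with h | h <;> rcases zmod_two_cases y.1 with h' | h' <;>
      simp [h, h']
  rw [pairing, letter_bracket, map_sub, map_smul]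
  have e1 : chi r l (if z.2.2 = y.2.1 then letter (z.1 + y.1, z.2.1, y.2.2) else 0) = 0 := by
    split_ifs with h
    · rw [chi_letter, if_neg]
      rintro ⟨g1, g2, g3⟩
      simp only at g1 g2 g3
      refine hne.2 (Prod.ext ?_ (Prod.ext ?_ (Prod.ext ?_ (Fin.ext ?_))))
      · rw [hxz', hc g1]
      · rw [h4, h]
      · rw [h5, g2]
      · omega
    · simp
  have e2 : chi r l (if y.2.2 = z.2.1 then letter (z.1 + y.1, y.2.1, z.2.2) else 0) = 0 := by
    split_ifs with h
    · rw [chi_letter, if_neg]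
      rintro ⟨g1, g2, g3⟩
      simp only at g1 g2 g3
      refine hne.1 (Prod.ext ?_ (Prod.ext (Prod.ext ?_ (Fin.ext ?_)) ?_))
      · rw [hxz, hc g1]
      · rw [h2, g2]
      · omega
      · rw [h1, h]
    · simp
  rw [e1, e2]; simp

theorem pairing_ne_zero {z x : Lt r l} (hxz : x.1 = z.1)
    (h1 : x.2.2 = z.2.1) (h2 : x.2.1.1 = z.2.2.1) (h3 : (x.2.1.2 : ℕ) = z.2.2.2 + 1) :
    pairing z x ≠ 0 := by
  have hc : z.1 + x.1 = 0 := by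
    rw [hxz]
    rcases zmod_two_cases z.1 with h | h <;> rw [h] <;> rfl
  have hne : z.2.2 ≠ x.2.1 := by
    intro h
    rw [h] at h3
    omega
  rw [pairing, letter_bracket, if_neg hne, if_pos h1, map_sub, map_smul, chi_letter, if_pos
    ⟨hc, h2.symm, h3⟩]
  rcases superSign_eq z.1 x.1 with h | h <;> simp [h]

/-- A vector of degree at most `k` annihilated by all `a - χ(a)`, `a ∈ m`, is of lower degree if its
coefficients vanish at the monomials of degree `k` in letters from the first rows of the blocks.
Indeed, among the remaining monomials of degree `k` that occur, take one of the least number of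
letters and then of the least sum of rows: contracting one of its letters would give a term which
nothing can cancel. -/
theorem mem_kazhdanQ_pred_of_whittaker {k : ℤ} {w : WhittakerModule r l} (hw : w ∈ kazhdanQ k)
    (hinv : ∀ z : Lt r l, wt (lev r l) z ≤ 0 → gen z • w = 0)
    (h0 : ∀ s : Expo r l, kdegS s.1 = k → (∀ x ∈ s.1, (x.2.1.2 : ℕ) = 0) → coeff s w = 0) :
    w ∈ kazhdanQ (k - 1) := by
  rw [mem_kazhdanQ_iff]
  by_contra hcon
  push Not at hcon
  obtain ⟨s₀, hs₀, hs₀'⟩ := hcon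
  have hs₀k : kdegS s₀.1 = k := by
    by_contra hne
    exact hs₀' (coeff_eq_zero hw (by omega))
  let T : Set (Expo r l) := {s | kdegS s.1 = k ∧ coeff s w ≠ 0}
  let rowSum : Expo r l → ℕ := fun s => (s.1.map fun x => (x.2.1.2 : ℕ)).sum
  let m : Expo r l → ℕ ×ₗ ℕ := fun s => toLex (s.1.card, rowSum s)
  obtain ⟨s, ⟨hsk, hsw⟩, hmin⟩ :=
    WellFounded.has_min (InvImage.wf m wellFounded_lt) T ⟨s₀, hs₀k, hs₀'⟩
  have hmin' : ∀ t ∈ T, s.1.card < t.1.card ∨ (s.1.card = t.1.card ∧ rowSum s ≤ rowSum t) := by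
    intro t ht
    have := hmin t ht
    change ¬ (toLex (t.1.card, rowSum t) < toLex (s.1.card, rowSum s)) at this
    rw [Prod.Lex.toLex_lt_toLex] at this
    push Not at this
    simp only at this
    rcases lt_or_eq_of_le this.1 with h | h
    · exact Or.inl h
    · exact Or.inr ⟨h, this.2 h.symm⟩
  have hex : ∃ x ∈ s.1, (x.2.1.2 : ℕ) ≠ 0 := by
    by_contra hno
    push Not at hno
    exact hsw (h0 s hsk hno)
  obtain ⟨x, hxs, hx0⟩ := hex
  have hxpos := s.2.2 x hxs
  obtain ⟨c, ⟨p, i⟩, ⟨q, j⟩⟩ := x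
  have hij : (i : ℕ) ≤ j := by
    simp only [wt, lev] at hxpos
    omega
  simp only at hx0
  set x : Lt r l := (c, (p, i), (q, j)) with hx
  set z : Lt r l := (c, (q, j), (p, ⟨i - 1, by omega⟩)) with hz
  set x' : Lt r l := (c, (p, ⟨i - 1, by omega⟩), (q, ⟨j - 1, by omega⟩)) with hx'
  have hzx : wt (lev r l) z + wt (lev r l) x = 2 := by
    simp only [wt, lev, hz, hx]
    rw [Nat.cast_sub (by omega)]
    push_cast
    ring
  have hx'x : wt (lev r l) x' = wt (lev r l) x := by
    simp only [wt, lev, hx', hx]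
    rw [Nat.cast_sub (by omega), Nat.cast_sub (by omega)]
    push_cast
    ring
  have hz0 : wt (lev r l) z ≤ 0 := by
    have hpar : ∃ n : ℤ, wt (lev r l) x = 2 * n := ⟨_, by simp only [wt]; rw [← mul_add_one]⟩
    obtain ⟨n, hn⟩ := hpar
    omega
  have hor : ∀ y, pairing z y ≠ 0 → y = x ∨ y = x' := fun y hy =>
    eq_or_eq_of_pairing_ne_zero (x := x) (x' := x') (z := z) rfl rfl rfl rfl
      (by simp only [hx, hz]; omega) rfl rfl (by simp only [hx', hz]; omega) hy
  let τ : Expo r l := ⟨s.1.erase x, s.2.1.erase x,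
    fun y hy => s.2.2 y (Multiset.mem_of_mem_erase hy)⟩
  have hτs : x ::ₘ τ.1 = s.1 := Multiset.cons_erase hxs
  have hτk : kdegS τ.1 = wt (lev r l) z + k - 2 := by
    have : kdegS s.1 = wt (lev r l) x + kdegS τ.1 := by
      rw [← hτs, kdegS, Multiset.map_cons, Multiset.sum_cons]
    omega
  have hτc : s.1.card = τ.1.card + 1 := by rw [← hτs, Multiset.card_cons]
  -- the contribution of `s`
  have hs_ne : coeff τ (gen z • qmon s) ≠ 0 := by
    obtain ⟨e, he, hm⟩ := proj_mon_perm (L := nfWord s.1) (L' := frontWord x s.1)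
      (by rw [coe_nfWord, coe_frontWord])
    rw [coe_nfWord, hsk] at hm
    have h1 := coeff_eq_zero (gen_smul_mem_of_nonpos hz0 hm) (s := τ) (by omega)
    rw [smul_sub, smul_comm (gen z) e, map_sub, (coeff τ).map_smul, sub_eq_zero, ← proj_mul,
      ← proj_mul] at h1
    change coeff τ (gen z • proj r l (mon gen (nfWord s.1))) ≠ 0
    rw [← proj_mul, h1]
    refine smul_ne_zero (by rcases he with rfl | rfl <;> simp) ?_
    have h2 := gen_smul_mon_sub_der_mem hz0 (frontWord x s.1)
    have hlen : (frontWord x s.1).length = s.1.card := by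
      rw [← Multiset.coe_card, coe_frontWord]
    rw [coe_frontWord, hsk, hlen] at h2
    have h3 := coeff_eq_zero_of_mem_longPart h2 hτk (by omega)
    rw [map_sub, sub_eq_zero] at h3
    rw [h3]
    have hd := der_replicate_append gen (fun y => superSign z.1 y.1) (pairing z) x
      (s.1.filter (· ≠ x)).toList (by simp) (s.1.count x) (by
        rcases zmod_two_cases c with h | h
        · left; simp [hz, h, superSign_zero_left]
        · right; exact s.2.1.count_le h)
    have h4 := map_mem_of_span (N := LinearMap.ker (coeff τ)) (proj r l) (by
      rintro _ ⟨y, M, hyx, hy, hM, rfl⟩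
      change coeff τ _ = 0
      have hk := kdegS_of_eq_cons hM
      have hwt := wt_of_pairing_ne_zero hy
      have hfw : ((List.replicate (s.1.count x) x ++ (s.1.filter (· ≠ x)).toList : List _) :
        Multiset (Lt r l)) = s.1 := coe_frontWord x s.1
      rw [hfw] at hM hk
      refine coeff_mon_of_ne (fun h => hyx ?_) (by omega)
      rw [h, ← hτs] at hM
      exact ((Multiset.cons_inj_left _).1 hM).symm) hd
    rw [LinearMap.mem_ker, map_sub, map_sub, map_smul, map_smul, sub_eq_zero] at h4
    rw [frontWord, h4]
    refine smul_ne_zero (mul_ne_zero ?_ ?_) (coeff_mon_of_eq (coe_frontWord_erase hxs))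
    · exact_mod_cast (Multiset.count_pos.2 hxs).ne'
    · exact pairing_ne_zero rfl rfl rfl (by simp only [hx, hz]; omega)
  -- the other monomials do not contribute
  have ht_zero : ∀ t : Expo r l, coeff t w ≠ 0 → t ≠ s → coeff τ (gen z • qmon t) = 0 := by
    intro t ht hts
    have htk : kdegS t.1 ≤ k := by
      by_contra hlt
      exact ht (coeff_eq_zero hw (not_le.1 hlt))
    have hqt : qmon t ∈ kazhdanQ (kdegS t.1) := proj_mon_mem _ (by rw [coe_nfWord])
    rcases lt_or_eq_of_le htk with hlt | heq
    · exact coeff_eq_zero (gen_smul_mem_of_nonpos hz0 hqt) (by omega)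
    · have hcard := hmin' t ⟨heq, ht⟩
      have h2 := gen_smul_mon_sub_der_mem hz0 (nfWord t.1)
      have hlen : (nfWord t.1).length = t.1.card := by
        rw [← Multiset.coe_card, coe_nfWord]
      rw [coe_nfWord, heq, hlen] at h2
      have h3 := coeff_eq_zero_of_mem_longPart h2 hτk (by omega)
      rw [map_sub, sub_eq_zero] at h3
      change coeff τ (gen z • proj r l (mon gen (nfWord t.1))) = 0
      rw [← proj_mul, h3]
      refine map_mem_of_span (N := LinearMap.ker (coeff τ)) (proj r l) ?_ (der_mem gen _ _ _)
      rintro _ ⟨y, M, hy, hM, rfl⟩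
      have hk := kdegS_of_eq_cons hM
      have hwt := wt_of_pairing_ne_zero hy
      rw [coe_nfWord] at hM hk
      refine coeff_mon_of_ne (fun h => ?_) (by omega)
      rw [h] at hM
      rcases hor y hy with rfl | rfl
      · exact hts (Subtype.ext (hM.trans hτs))
      · have e1 : rowSum t = (i - 1 : ℕ) + (τ.1.map fun x => (x.2.1.2 : ℕ)).sum := by
          change (t.1.map _).sum = _
          rw [hM, Multiset.map_cons, Multiset.sum_cons]
        have e2 : rowSum s = (i : ℕ) + (τ.1.map fun x => (x.2.1.2 : ℕ)).sum := by
          change (s.1.map _).sum = _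
          rw [← hτs, Multiset.map_cons, Multiset.sum_cons]
        have e3 : t.1.card = τ.1.card + 1 := by rw [hM, Multiset.card_cons]
        omega
  have hfin : coeff τ (gen z • w) = coeff s w * coeff τ (gen z • qmon s) := by
    conv_lhs => rw [← (qbasis r l).linearCombination_repr w]
    rw [Finsupp.linearCombination_apply, Finsupp.sum, Finset.smul_sum, map_sum]
    have hb : ∀ t, qbasis r l t = qmon t := fun t => by simp [qbasis]
    rw [Finset.sum_eq_single s]
    · rw [smul_comm, map_smul, hb]; rfl
    · intro t ht hts
      rw [smul_comm, map_smul, hb, ht_zero t (Finsupp.mem_support_iff.1 ht) hts, smul_zero]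
    · intro hs
      exact absurd (Finsupp.notMem_support_iff.1 hs) hsw
  rw [hinv z hz0, map_zero] at hfin
  exact mul_ne_zero hsw hs_ne hfin.symm

end UpperBound

/-! ### Sergeev's elements -/

section Sergeev

variable {ι : Type} [DecidableEq ι] [Fintype ι]

/-- Sergeev's elements of the enveloping superalgebra, of parity `c`: the entries of the signed
powers of the matrix of the generators. -/
def serg : ℕ → ZMod 2 → ι → ι → Env ι
  | 0, c, a, b => if c = 0 ∧ a = b then 1 else 0
  | m + 1, c, a, b => ∑ k, (Env.of ι (letter (0, a, k)) * serg m c k b +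
      (-1 : ℂ) ^ m • (Env.of ι (letter (1, a, k)) * serg m (c + 1) k b))

theorem of_letter_mul (x y : Letter ι) : Env.of ι (letter x) * Env.of ι (letter y) =
    superSign x.1 y.1 • (Env.of ι (letter y) * Env.of ι (letter x)) +
      (if x.2.2 = y.2.1 then Env.of ι (letter (x.1 + y.1, x.2.1, y.2.2)) else 0) -
      superSign x.1 y.1 •
        (if y.2.2 = x.2.1 then Env.of ι (letter (x.1 + y.1, y.2.1, x.2.2)) else 0) := by
  have h := Env.of_bracket ι (letter_mem_parity x) (letter_mem_parity y)
  rw [sub_eq_iff_eq_add, letter_bracket, map_sub, map_smul, apply_ite (Env.of ι),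
    apply_ite (Env.of ι), map_zero] at h
  rw [h]
  abel

theorem zmod_two_add_one_add_one (c : ZMod 2) : c + 1 + 1 = c := by
  rw [add_assoc, show (1 + 1 : ZMod 2) = 0 from rfl, add_zero]

/-- Even generators commute with Sergeev's elements like matrix units. -/
theorem even_mul_serg (a b : ι) (m : ℕ) : ∀ (c : ZMod 2) (i j : ι),
    Env.of ι (letter (0, a, b)) * serg m c i j = serg m c i j * Env.of ι (letter (0, a, b)) +
      (if b = i then serg m c a j else 0) - (if j = a then serg m c i b else 0) := by
  induction m with
  | zero =>
    intro c i j
    by_cases hc : c = 0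
    · by_cases h1 : i = j <;> by_cases h2 : b = i <;> by_cases h3 : j = a <;>
        simp [serg, hc, h1, h2, h3] <;> grind
    · simp [serg, hc]
  | succ m ih =>
    intro c i j
    have key : ∀ k, Env.of ι (letter (0, a, b)) * (Env.of ι (letter (0, i, k)) * serg m c k j +
        (-1 : ℂ) ^ m • (Env.of ι (letter (1, i, k)) * serg m (c + 1) k j)) =
        (Env.of ι (letter (0, i, k)) * serg m c k j +
        (-1 : ℂ) ^ m • (Env.of ι (letter (1, i, k)) * serg m (c + 1) k j)) *
          Env.of ι (letter (0, a, b)) +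
        (if b = i then (Env.of ι (letter (0, a, k)) * serg m c k j +
          (-1 : ℂ) ^ m • (Env.of ι (letter (1, a, k)) * serg m (c + 1) k j)) else 0) -
        (if j = a then (Env.of ι (letter (0, i, k)) * serg m c k b +
          (-1 : ℂ) ^ m • (Env.of ι (letter (1, i, k)) * serg m (c + 1) k b)) else 0) +
        ((if b = k then Env.of ι (letter (0, i, k)) * serg m c a j +
            (-1 : ℂ) ^ m • (Env.of ι (letter (1, i, k)) * serg m (c + 1) a j) else 0) -
          (if k = a then Env.of ι (letter (0, i, b)) * serg m c k j +
            (-1 : ℂ) ^ m • (Env.of ι (letter (1, i, b)) * serg m (c + 1) k j) else 0)) := by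
      intro k
      have h0 := of_letter_mul (0, a, b) (0, i, k)
      have h1 := of_letter_mul (0, a, b) (1, i, k)
      simp only [superSign_zero_left, one_smul, zero_add] at h0 h1
      rw [mul_add, mul_smul_comm, ← mul_assoc, ← mul_assoc, h0, h1]
      simp only [add_mul, sub_mul, mul_assoc, ih, mul_add, mul_sub, ite_mul, mul_ite, zero_mul,
        mul_zero, smul_add, smul_sub, smul_mul_assoc]
      split_ifs <;> module
    have hsum : ∀ c i j, serg (m + 1) c i j = ∑ k, (Env.of ι (letter (0, i, k)) * serg m c k j +
      (-1 : ℂ) ^ m • (Env.of ι (letter (1, i, k)) * serg m (c + 1) k j)) := fun _ _ _ => rfl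
    rw [hsum, Finset.mul_sum, Finset.sum_congr rfl fun k _ => key k, Finset.sum_add_distrib,
      Finset.sum_sub_distrib, Finset.sum_add_distrib, Finset.sum_sub_distrib, Finset.sum_ite_eq,
      Finset.sum_ite_eq', if_pos (Finset.mem_univ _), if_pos (Finset.mem_univ _), sub_self,
      add_zero, ← Finset.sum_mul]
    congr 1
    · congr 1
      split_ifs
      · rfl
      · simp
    · split_ifs
      · rfl
      · simp

/-- Odd generators supercommute with Sergeev's elements like matrix units, with a sign that depends
on the power. -/
theorem odd_mul_serg (a b : ι) (m : ℕ) : ∀ (c : ZMod 2) (i j : ι),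
    Env.of ι (letter (1, a, b)) * serg m c i j =
      superSign 1 c • (serg m c i j * Env.of ι (letter (1, a, b))) +
      (-1 : ℂ) ^ (m + 1) • (if b = i then serg m (c + 1) a j else 0) -
      superSign 1 c • (if j = a then serg m (c + 1) i b else 0) := by
  induction m with
  | zero =>
    intro c i j
    rcases zmod_two_cases c with rfl | rfl
    · by_cases h1 : i = j <;> simp [serg, h1, superSign]
    · by_cases h1 : i = b <;> by_cases h3 : j = a <;>
        simp [serg, h1, h3, superSign, show (1 + 1 : ZMod 2) = 0 from rfl] <;> grind
  | succ m ih =>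
    intro c i j
    have hs : superSign 1 (c + 1) = -superSign 1 c := by
      rw [superSign_add_right]; simp [superSign]
    have hε : ((-1 : ℂ) ^ m) * (-1) ^ m = 1 := by
      rw [← mul_pow]; simp
    have key : ∀ k, Env.of ι (letter (1, a, b)) * (Env.of ι (letter (0, i, k)) * serg m c k j +
        (-1 : ℂ) ^ m • (Env.of ι (letter (1, i, k)) * serg m (c + 1) k j)) =
        superSign 1 c • ((Env.of ι (letter (0, i, k)) * serg m c k j +
        (-1 : ℂ) ^ m • (Env.of ι (letter (1, i, k)) * serg m (c + 1) k j)) *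
          Env.of ι (letter (1, a, b))) +
        (-1 : ℂ) ^ m • (if b = i then (Env.of ι (letter (0, a, k)) * serg m (c + 1) k j +
          (-1 : ℂ) ^ m • (Env.of ι (letter (1, a, k)) * serg m c k j)) else 0) -
        superSign 1 c • (if j = a then (Env.of ι (letter (0, i, k)) * serg m (c + 1) k b +
          (-1 : ℂ) ^ m • (Env.of ι (letter (1, i, k)) * serg m c k b)) else 0) +
        ((if b = k then - (-1 : ℂ) ^ m • (Env.of ι (letter (0, i, k)) * serg m (c + 1) a j) +
            Env.of ι (letter (1, i, k)) * serg m c a j else 0) -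
          (if k = a then - (-1 : ℂ) ^ m • (Env.of ι (letter (0, i, b)) * serg m (c + 1) k j) +
            Env.of ι (letter (1, i, b)) * serg m c k j else 0)) := by
      intro k
      have h0 := of_letter_mul (1, a, b) (0, i, k)
      have h1 := of_letter_mul (1, a, b) (1, i, k)
      simp only [superSign_zero_right, one_smul, add_zero, show (1 + 1 : ZMod 2) = 0 from rfl,
        show superSign 1 1 = -1 from by simp [superSign]] at h0 h1
      rw [mul_add, mul_smul_comm, ← mul_assoc, ← mul_assoc, h0, h1]
      simp only [add_mul, sub_mul, mul_assoc, ih, mul_add, mul_sub, ite_mul, mul_ite, zero_mul,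
        mul_zero, smul_add, smul_sub, smul_mul_assoc, mul_smul_comm, zmod_two_add_one_add_one, hs,
        smul_smul, pow_succ, mul_neg, mul_one, neg_mul, hε, one_smul, neg_smul,
        smul_neg]
      split_ifs <;> simp only [smul_zero, smul_add, smul_smul, hε, one_smul, neg_zero,
        mul_comm (superSign 1 c)] <;> module
    have hsum : ∀ c i j, serg (m + 1) c i j = ∑ k, (Env.of ι (letter (0, i, k)) * serg m c k j +
      (-1 : ℂ) ^ m • (Env.of ι (letter (1, i, k)) * serg m (c + 1) k j)) := fun _ _ _ => rfl
    rw [hsum, Finset.mul_sum, Finset.sum_congr rfl fun k _ => key k, Finset.sum_add_distrib,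
      Finset.sum_sub_distrib, Finset.sum_add_distrib, Finset.sum_sub_distrib, Finset.sum_ite_eq,
      Finset.sum_ite_eq', if_pos (Finset.mem_univ _), if_pos (Finset.mem_univ _), sub_self,
      add_zero, ← Finset.smul_sum, ← Finset.smul_sum, ← Finset.smul_sum, ← Finset.sum_mul]
    simp only [hsum, zmod_two_add_one_add_one]
    congr 1
    · congr 1
      rw [show (-1 : ℂ) ^ (m + 1 + 1) = (-1) ^ m by ring]
      split_ifs
      · rfl
      · simp
    · split_ifs
      · rfl
      · simp

end Sergeev

/-! ### The leading terms of the generators of the `W`-algebra -/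

section Generators

variable {r l : ℕ}

theorem kazhdanParity_mul {k k' : ℤ} {a a' : ZMod 2} {x y : UQ r l} (hx : x ∈ kazhdanParity k a)
    (hy : y ∈ kazhdanParity k' a') : x * y ∈ kazhdanParity (k + k') (a + a') := by
  have h3 := Submodule.mul_mem_mul hx hy
  rw [kazhdanParity, kazhdanParity, Submodule.span_mul_span] at h3
  refine Submodule.span_mono ?_ h3
  rintro _ ⟨_, ⟨L, ⟨hL, hL'⟩, rfl⟩, _, ⟨M, ⟨hM, hM'⟩, rfl⟩, rfl⟩
  refine ⟨L ++ M, ?_, by simp⟩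
  simp only [Set.mem_ofPred_eq, List.map_append, List.sum_append]
  exact ⟨add_le_add hL hM, by rw [hL', hM']⟩

theorem of_letter_mem_kazhdanParity (x : Lt r l) :
    Env.of _ (letter x) ∈ kazhdanParity (wt (lev r l) x) x.1 := by
  refine Submodule.span_mono (Set.image_mono ?_) (of_letter_mem isKazhdanEven_chi x)
  rintro M ⟨-, h1, h2⟩
  exact ⟨h1.le, h2⟩

theorem kazhdanParity_le (k : ℤ) (a : ZMod 2) :
    kazhdanParity (r := r) (l := l) k a ≤ kazhdanU r l k := by
  rw [kazhdanU_eq_span]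
  exact Submodule.span_mono (Set.image_mono fun M hM => hM.1)

/-- Sergeev's elements are homogeneous with respect to the Kazhdan filtration and the parity. -/
theorem serg_mem (m : ℕ) : ∀ (c : ZMod 2) (a b : Fin r × Fin l),
    serg m c a b ∈ kazhdanParity (2 * (m + ((b.2 : ℤ) - a.2))) c := by
  induction m with
  | zero =>
    intro c a b
    rw [serg]
    split_ifs with h
    · exact Submodule.subset_span ⟨[], by simp [h.1, h.2], rfl⟩
    · exact zero_mem _
  | succ m ih =>
    intro c a b
    have hdeg : ∀ (c' : ZMod 2) (k : Fin r × Fin l), wt (lev r l) (c', a, k) +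
        2 * ((m : ℤ) + ((b.2 : ℤ) - k.2)) = 2 * (((m + 1 : ℕ) : ℤ) + ((b.2 : ℤ) - a.2)) := by
      intro c' k
      change 2 * ((k.2 : ℤ) - a.2) + 2 + _ = _
      push_cast; ring
    rw [serg]
    refine sum_mem fun k _ => add_mem ?_ (Submodule.smul_mem _ _ ?_)
    · have := kazhdanParity_mul (of_letter_mem_kazhdanParity (0, a, k)) (ih c k b)
      rw [zero_add, hdeg] at this
      exact this
    · have := kazhdanParity_mul (of_letter_mem_kazhdanParity (1, a, k)) (ih (c + 1) k b)
      rw [add_comm c 1, ← add_assoc, show (1 + 1 : ZMod 2) = 0 from rfl, zero_add, hdeg] at this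
      rw [add_comm c 1]
      exact this

theorem proj_serg_mem (m : ℕ) (c : ZMod 2) (a b : Fin r × Fin l) :
    proj r l (serg m c a b) ∈ kazhdanQ (2 * (m + ((b.2 : ℤ) - a.2))) :=
  ⟨_, kazhdanParity_le _ _ (serg_mem m c a b), rfl⟩

/-- On the left, a letter of nonpositive degree acts by its value under `χ`, up to lower degrees. -/
theorem of_letter_smul_sub_mem {z : Lt r l} (hz : wt (lev r l) z ≤ 0) {k : ℤ}
    {v : WhittakerModule r l} (hv : v ∈ kazhdanQ k) :
    Env.of _ (letter z) • v - chi r l (letter z) • v ∈ kazhdanQ (wt (lev r l) z + k - 2) := by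
  have := gen_smul_mem_of_nonpos hz hv
  rw [gen, shifted, sub_smul, algebraMap_smul] at this
  exact this

theorem of_letter_of_pos {z : Lt r l} (hz : 0 < wt (lev r l) z) : Env.of _ (letter z) = gen z := by
  rw [of_letter_eq (chi r l)]
  by_cases h : chi r l (letter z) = 0
  · rw [h, map_zero, add_zero]
  · have := (isKazhdanEven_chi z h).1
    omega

theorem proj_serg_succ (m : ℕ) (c : ZMod 2) (a b : Fin r × Fin l) :
    proj r l (serg (m + 1) c a b) = ∑ k, (Env.of _ (letter (0, a, k)) • proj r l (serg m c k b) +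
      (-1 : ℂ) ^ m • (Env.of _ (letter (1, a, k)) • proj r l (serg m (c + 1) k b))) := by
  rw [serg, map_sum]
  refine Finset.sum_congr rfl fun k _ => ?_
  rw [map_add, map_smul, proj_mul, proj_mul]

theorem wt_letter (c : ZMod 2) (a b : Fin r × Fin l) :
    wt (lev r l) (c, a, b) = 2 * ((b.2 : ℤ) - a.2) + 2 := rfl

theorem chi_letter_eq_ite {p : Fin r} {i : ℕ} (hi : i + 1 < l) (c : ZMod 2) (k : Fin r × Fin l) :
    chi r l (letter (c, (p, ⟨i + 1, hi⟩), k)) =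
      if c = 0 ∧ k = (p, ⟨i, by omega⟩) then 1 else 0 := by
  rw [chi_letter]
  refine if_congr (and_congr Iff.rfl ?_) rfl rfl
  obtain ⟨q, j⟩ := k
  simp only [Prod.mk.injEq, Fin.ext_iff]
  refine and_congr Iff.rfl ⟨fun h => ?_, fun h => ?_⟩ <;> omega

/-- In Kazhdan degree zero only the path along the lower diagonal contributes. -/
theorem proj_serg_zero (hl : 0 < l) (p q : Fin r) (i : ℕ) : ∀ (hi : i < l) (c : ZMod 2),
    proj r l (serg i c (p, ⟨i, hi⟩) (q, ⟨0, hl⟩)) =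
      (if c = 0 ∧ p = q then (1 : ℂ) else 0) • proj r l 1 := by
  induction i with
  | zero =>
    intro hi c
    rw [serg]
    simp only [Prod.mk.injEq, and_true]
    split_ifs <;> simp
  | succ i ih =>
    intro hi c
    have hterm : ∀ (c' c'' : ZMod 2) (k : Fin r × Fin l),
        Env.of _ (letter (c', (p, ⟨i + 1, hi⟩), k)) • proj r l (serg i c'' k (q, ⟨0, hl⟩)) =
        chi r l (letter (c', (p, ⟨i + 1, hi⟩), k)) • proj r l (serg i c'' k (q, ⟨0, hl⟩)) := by
      intro c' c'' k
      have hmem := proj_serg_mem i c'' k (q, ⟨0, hl⟩)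
      by_cases hk : (k.2 : ℕ) ≤ i
      · have := of_letter_smul_sub_mem (z := (c', (p, ⟨i + 1, hi⟩), k)) (by
          rw [wt_letter]; simp only; push_cast; omega) hmem
        refine sub_eq_zero.1 (eq_zero_of_mem_kazhdanQ ?_ this)
        rw [wt_letter]; simp only; push_cast; omega
      · rw [eq_zero_of_mem_kazhdanQ (by simp only; push_cast; omega) hmem, smul_zero, smul_zero]
    rw [proj_serg_succ]
    simp only [hterm, chi_letter_eq_ite, one_ne_zero, false_and, if_false, zero_smul, smul_zero,
      add_zero, true_and, ite_smul, one_smul]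
    rw [Finset.sum_ite_eq', if_pos (Finset.mem_univ _), ih (by omega) c]
    simp only [ite_smul, one_smul, zero_smul]

/-- The words in letters of positive degree that have degree `k` and either contain a letter outside
the first rows of the blocks or have at least `d` letters, and the words of lower degree. -/
def decomposableU (k : ℤ) (d : ℕ) : Submodule ℂ (UQ r l) :=
  Submodule.span ℂ (mon gen '' {L | (∀ x ∈ L, 0 < wt (lev r l) x) ∧
    (kdegS (L : Multiset (Lt r l)) < k ∨ (kdegS (L : Multiset (Lt r l)) = k ∧
      ((∃ x ∈ L, (x.2.1.2 : ℕ) ≠ 0) ∨ d ≤ L.length)))})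

/-- The image of `decomposableU` in the generalized Whittaker module. -/
abbrev decomposable (k : ℤ) (d : ℕ) : Submodule ℂ (WhittakerModule r l) :=
  (decomposableU k d).map (proj r l)

theorem kazhdanQ_le_decomposable {k k' : ℤ} (h : k' < k) (d : ℕ) :
    kazhdanQ (r := r) (l := l) k' ≤ decomposable k d := by
  rw [kazhdanQ_eq_span]
  refine Submodule.span_le.2 ?_
  rintro _ ⟨s, hs, rfl⟩
  refine ⟨_, Submodule.subset_span ⟨nfWord s.1, ⟨fun x hx => s.2.2 x ?_, Or.inl ?_⟩, rfl⟩, rfl⟩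
  · rwa [← Multiset.mem_coe, coe_nfWord] at hx
  · rw [coe_nfWord]; exact lt_of_le_of_lt hs h

/-- A letter times a vector is decomposable if the letter lies outside the first rows or if the
vector has positive degree, so that its words in top degree are not empty. -/
theorem gen_smul_mem_decomposable {x : Lt r l} (hx : 0 < wt (lev r l) x) {k k' : ℤ}
    {v : WhittakerModule r l} (hv : v ∈ kazhdanQ k) (hk : wt (lev r l) x + k ≤ k')
    (h : (x.2.1.2 : ℕ) ≠ 0 ∨ 0 < k) : gen x • v ∈ decomposable k' 2 := by
  rw [kazhdanQ_eq_span] at hv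
  refine map_mem_of_span (Algebra.lsmul ℂ ℂ (WhittakerModule r l) (gen x)) ?_ hv
  rintro _ ⟨s, hs, rfl⟩
  change kdegS s.1 ≤ k at hs
  refine ⟨mon gen (x :: nfWord s.1), Submodule.subset_span ⟨_, ⟨?_, ?_⟩, rfl⟩, by
    rw [mon_cons, proj_mul]; rfl⟩
  · intro y hy
    rcases List.mem_cons.1 hy with rfl | hy
    · exact hx
    · rw [← Multiset.mem_coe, coe_nfWord] at hy
      exact s.2.2 y hy
  · have hd : kdegS ((x :: nfWord s.1 : List (Lt r l)) : Multiset (Lt r l)) =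
        wt (lev r l) x + kdegS s.1 := by
      rw [← Multiset.cons_coe, coe_nfWord, kdegS, Multiset.map_cons, Multiset.sum_cons]
    rw [hd]
    by_cases hlt : wt (lev r l) x + kdegS s.1 < k'
    · exact Or.inl hlt
    · refine Or.inr ⟨by omega, ?_⟩
      rcases h with h | h
      · exact Or.inl ⟨x, by simp, h⟩
      · right
        have hne : nfWord s.1 ≠ [] := by
          intro h0
          have := coe_nfWord s.1
          rw [h0] at this
          rw [← this] at hs hlt
          simp [kdegS] at hs hlt
          omega
        have := List.length_pos_of_ne_nil hne
        simp only [List.length_cons]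
        omega

/-- The sign in the leading terms of the generators. -/
def leadSign (c : ZMod 2) (n : ℕ) : ℂ := if c = 0 then 1 else (-1) ^ n

/-- The leading terms of Sergeev's elements in the first column. Modulo decomposable terms, the
first factor of the power contributes only through `χ`, which moves from row `i + 1` to row `i`. In
row zero the first letter is the leading one, and the other factors form an element of degree zero.
-/
theorem proj_serg_lead (hl : 0 < l) (p q : Fin r) (n : ℕ) (hn : n < l) (i : ℕ) :
    ∀ (hi : i < l) (c : ZMod 2),
    proj r l (serg (i + n + 1) c (p, ⟨i, hi⟩) (q, ⟨0, hl⟩)) -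
      leadSign c n • proj r l (gen (c, (p, ⟨0, hl⟩), (q, ⟨n, hn⟩))) ∈
      decomposable (2 * ((n : ℤ) + 1)) 2 := by
  induction i with
  | zero =>
    intro hi c
    have hterm : ∀ (c' c'' : ZMod 2) (k : Fin r × Fin l),
        Env.of _ (letter (c', (p, ⟨0, hi⟩), k)) • proj r l (serg n c'' k (q, ⟨0, hl⟩)) -
        (if c'' = 0 ∧ k = (q, ⟨n, hn⟩) then
          proj r l (gen (c', (p, ⟨0, hl⟩), (q, ⟨n, hn⟩))) else 0) ∈
        decomposable (2 * ((n : ℤ) + 1)) 2 := by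
      intro c' c'' k
      have hpos : 0 < wt (lev r l) ((c', (p, ⟨0, hi⟩), k) : Lt r l) := by
        rw [wt_letter]; simp only; push_cast; omega
      rw [of_letter_of_pos hpos]
      have hmem := proj_serg_mem n c'' k (q, ⟨0, hl⟩)
      rcases lt_trichotomy (k.2 : ℕ) n with hlt | heq | hgt
      · rw [if_neg, sub_zero]
        · refine gen_smul_mem_decomposable hpos hmem ?_ (Or.inr ?_)
          · rw [wt_letter]; simp only; push_cast; omega
          · simp only; push_cast; omega
        · rintro ⟨-, rfl⟩
          simp at hlt
      · obtain ⟨k₁, k₂⟩ := k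
        obtain rfl : k₂ = ⟨n, hn⟩ := Fin.ext heq
        rw [proj_serg_zero hl]
        simp only [Prod.mk.injEq, and_true]
        split_ifs with h
        · rw [one_smul, ← proj_mul, mul_one, h.2, sub_self]
          exact zero_mem _
        · simp
      · rw [eq_zero_of_mem_kazhdanQ (by simp only; push_cast; omega) hmem, smul_zero, if_neg,
          sub_zero]
        · exact zero_mem _
        · rintro ⟨-, rfl⟩
          simp at hgt
    have hsum := sum_mem (t := Finset.univ) (fun (k : Fin r × Fin l) _ => add_mem (hterm 0 c k)
      (Submodule.smul_mem _ ((-1 : ℂ) ^ n) (hterm 1 (c + 1) k)))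
    rw [zero_add, proj_serg_succ]
    convert hsum using 1
    simp only [smul_sub]
    rw [Finset.sum_congr rfl fun k _ => sub_add_sub_comm _ _ _ _, Finset.sum_sub_distrib]
    congr 1
    rcases zmod_two_cases c with rfl | rfl
    · simp only [leadSign, true_and, zero_add, one_ne_zero, false_and, if_false, if_true, smul_zero,
        add_zero, one_smul]
      rw [Finset.sum_ite_eq', if_pos (Finset.mem_univ _)]
    · simp only [leadSign, true_and, zero_add, one_ne_zero, false_and, if_false,
        show (1 + 1 : ZMod 2) = 0 from rfl]
      rw [← Finset.smul_sum, Finset.sum_ite_eq', if_pos (Finset.mem_univ _)]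
  | succ i ih =>
    intro hi c
    have hterm : ∀ (c' c'' : ZMod 2) (k : Fin r × Fin l),
        Env.of _ (letter (c', (p, ⟨i + 1, hi⟩), k)) •
          proj r l (serg (i + n + 1) c'' k (q, ⟨0, hl⟩)) -
        (if c' = 0 ∧ k = (p, ⟨i, by omega⟩) then
          proj r l (serg (i + n + 1) c'' k (q, ⟨0, hl⟩)) else 0) ∈
        decomposable (2 * ((n : ℤ) + 1)) 2 := by
      intro c' c'' k
      have hmem := proj_serg_mem (i + n + 1) c'' k (q, ⟨0, hl⟩)
      by_cases hk : (k.2 : ℕ) ≤ i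
      · have := of_letter_smul_sub_mem (z := (c', (p, ⟨i + 1, hi⟩), k)) (by
          rw [wt_letter]; simp only; push_cast; omega) hmem
        rw [chi_letter_eq_ite, ite_smul, one_smul, zero_smul] at this
        refine kazhdanQ_le_decomposable ?_ _ this
        rw [wt_letter]; simp only; push_cast; omega
      · have hpos : 0 < wt (lev r l) ((c', (p, ⟨i + 1, hi⟩), k) : Lt r l) := by
          rw [wt_letter]; simp only; push_cast; omega
        rw [of_letter_of_pos hpos, if_neg, sub_zero]
        · refine gen_smul_mem_decomposable hpos hmem ?_ (Or.inl ?_)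
          · rw [wt_letter]; simp only; push_cast; omega
          · simp
        · rintro ⟨-, rfl⟩
          simp at hk
    have hsum := sum_mem (t := Finset.univ) (fun (k : Fin r × Fin l) _ => add_mem (hterm 0 c k)
      (Submodule.smul_mem _ ((-1 : ℂ) ^ (i + n + 1)) (hterm 1 (c + 1) k)))
    have hrec : proj r l (serg (i + 1 + n + 1) c (p, ⟨i + 1, hi⟩) (q, ⟨0, hl⟩)) -
        proj r l (serg (i + n + 1) c (p, ⟨i, by omega⟩) (q, ⟨0, hl⟩)) ∈
        decomposable (2 * ((n : ℤ) + 1)) 2 := by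
      rw [show i + 1 + n + 1 = (i + n + 1) + 1 by omega, proj_serg_succ]
      convert hsum using 1
      simp only [smul_sub]
      rw [Finset.sum_congr rfl fun k _ => sub_add_sub_comm _ _ _ _, Finset.sum_sub_distrib]
      congr 1
      simp only [true_and, one_ne_zero, false_and, if_false, smul_zero, add_zero]
      rw [Finset.sum_ite_eq', if_pos (Finset.mem_univ _)]
    have := add_mem hrec (ih (by omega) c)
    rwa [sub_add_sub_cancel] at this

/-! ### The generators of the `W`-algebra -/

variable (r l) in
/-- The indices of the generators of the `W`-algebra: the parity, two block numbers, and the power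
of the nilpotent element. -/
abbrev GenIndex : Type := ZMod 2 × Fin r × Fin r × Fin l

/-- The letter in the first row of a block that leads the generator. -/
def leadLetter (y : GenIndex r l) : Lt r l :=
  (y.1, (y.2.1, ⟨0, y.2.2.2.pos⟩), (y.2.2.1, y.2.2.2))

/-- The Kazhdan degree of a generator. -/
def gdeg (y : GenIndex r l) : ℤ := 2 * ((y.2.2.2 : ℤ) + 1)

theorem wt_leadLetter (y : GenIndex r l) : wt (lev r l) (leadLetter y) = gdeg y := by
  simp only [leadLetter, wt_letter, gdeg]; push_cast; ring

theorem leadLetter_injective : Function.Injective (leadLetter (r := r) (l := l)) := by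
  rintro ⟨c, p, q, n⟩ ⟨c', p', q', n'⟩ h
  simp only [leadLetter, Prod.mk.injEq] at h
  simp [h]

/-- Sergeev's elements in the last row and the first column of the blocks. -/
def wgenU (y : GenIndex r l) : UQ r l :=
  serg (l + y.2.2.2) y.1 (y.2.1, ⟨l - 1, by have := y.2.2.2.pos; omega⟩)
    (y.2.2.1, ⟨0, y.2.2.2.pos⟩)

theorem wgenU_mem (y : GenIndex r l) : wgenU y ∈ kazhdanParity (gdeg y) y.1 := by
  have h := serg_mem (l + y.2.2.2) y.1 (y.2.1, ⟨l - 1, by have := y.2.2.2.pos; omega⟩)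
    (y.2.2.1, ⟨0, y.2.2.2.pos⟩)
  have hdeg : 2 * (((l + y.2.2.2 : ℕ) : ℤ) + ((0 : ℕ) - ((l - 1 : ℕ) : ℤ))) = gdeg y := by
    have := y.2.2.2.pos
    simp only [gdeg]
    push_cast [Nat.cast_sub (show 1 ≤ l from this)]
    ring
  rw [← hdeg]
  exact h

theorem proj_wgenU_lead (y : GenIndex r l) :
    proj r l (wgenU y) - leadSign y.1 y.2.2.2 • proj r l (gen (leadLetter y)) ∈
      decomposable (gdeg y) 2 := by
  obtain ⟨c, p, q, n⟩ := y
  have hl := n.pos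
  have h := proj_serg_lead hl p q n n.2 (l - 1) (by omega) c
  rw [show l - 1 + (n : ℕ) + 1 = l + n by omega] at h
  exact h

/-- The generators are Whittaker vectors: a letter of nonpositive degree has neither its column
equal to the last row of a block nor its row equal to the first column. -/
theorem gen_smul_proj_wgenU (y : GenIndex r l) {z : Lt r l} (hz : wt (lev r l) z ≤ 0) :
    gen z • proj r l (wgenU y) = 0 := by
  obtain ⟨c, p, q, n⟩ := y
  obtain ⟨d, a, b⟩ := z
  have hl := n.pos
  have hab : (b.2 : ℕ) < a.2 := by
    rw [wt_letter] at hz; omega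
  have h1 : b ≠ (p, ⟨l - 1, by omega⟩) := by
    intro h
    have h' := congrArg (fun k : Fin r × Fin l => (k.2 : ℕ)) h
    have := a.2.2
    simp only at h'
    omega
  have h2 : (q, (⟨0, hl⟩ : Fin l)) ≠ a := by
    intro h
    have h' := congrArg (fun k : Fin r × Fin l => (k.2 : ℕ)) h
    simp only at h'
    omega
  rw [← proj_mul]
  rcases zmod_two_cases d with rfl | rfl
  · have h := even_mul_serg a b (l + n) c (p, ⟨l - 1, by omega⟩) (q, ⟨0, hl⟩)
    rw [if_neg h1, if_neg h2, add_zero, sub_zero] at h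
    have h3 : gen (0, a, b) * wgenU (c, p, q, n) = wgenU (c, p, q, n) * gen (0, a, b) := by
      rw [gen, shifted, sub_mul, mul_sub, Algebra.commutes]
      congr 1
    rw [h3]
    exact proj_mul_gen _ hz
  · have h := odd_mul_serg a b (l + n) c (p, ⟨l - 1, by omega⟩) (q, ⟨0, hl⟩)
    rw [if_neg h1, if_neg h2, smul_zero, smul_zero, add_zero, sub_zero] at h
    have h0 : gen (1, a, b) = Env.of _ (letter (1, a, b)) := by
      rw [gen, shifted, chi_letter]; simp
    have h3 : gen (1, a, b) * wgenU (c, p, q, n) =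
        superSign 1 c • (wgenU (c, p, q, n) * gen (1, a, b)) := by
      rw [h0]; exact h
    rw [h3, map_smul, proj_mul_gen _ hz, smul_zero]

end Generators

/-! ### Monomials in the generators of the `W`-algebra -/

section WMonomials

variable {r l : ℕ}

/-- The element of the `W`-algebra with a given Whittaker vector as the image of the canonical
generator. -/
def whittakerEnd (v : WhittakerModule r l) (hv : ∀ z : Lt r l, wt (lev r l) z ≤ 0 → gen z • v = 0) :
    WAlg r l :=
  MulOpposite.op ((whittakerIdeal r l).liftQ (LinearMap.toSpanSingleton (UQ r l) _ v) (by
    refine Ideal.span_le.2 ?_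
    rintro _ ⟨a, ha, rfl⟩
    have := map_mem_of_span (N := ⊥) ((LinearMap.toSpanSingleton (UQ r l) _ v).restrictScalars ℂ ∘ₗ
      (Env.of _ - (Algebra.linearMap ℂ (UQ r l)) ∘ₗ chi r l)) ?_ (nilM_le_span ha)
    · exact this
    · rintro _ ⟨z, hz, rfl⟩
      exact hv z hz))

theorem evalOne_whittakerEnd (v : WhittakerModule r l) (hv) :
    evalOne r l (whittakerEnd v hv) = v := by
  have : evalOne r l (whittakerEnd v hv) = (1 : UQ r l) • v := rfl
  rw [this, one_smul]

/-- The embedding of the `W`-algebra takes values in the Whittaker vectors. -/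
theorem gen_smul_evalOne (w : WAlg r l) {z : Lt r l} (hz : wt (lev r l) z ≤ 0) :
    gen z • evalOne r l w = 0 := by
  change gen z • w.unop (proj r l 1) = 0
  rw [← map_smul, ← proj_mul, mul_one, ← one_mul (gen z), proj_mul_gen _ hz, map_zero]

theorem evalOne_mul {w w' : WAlg r l} {a : UQ r l} (h : evalOne r l w = proj r l a) :
    evalOne r l (w * w') = a • evalOne r l w' := by
  change w'.unop (evalOne r l w) = a • w'.unop (proj r l 1)
  rw [h, ← map_smul, ← proj_mul, mul_one]

/-- The generators of the `W`-algebra. -/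
def wgen (y : GenIndex r l) : WAlg r l :=
  whittakerEnd (proj r l (wgenU y)) fun _ hz => gen_smul_proj_wgenU y hz

/-- The generator is represented by Sergeev's element. -/
theorem evalOne_wgen (y : GenIndex r l) : evalOne r l (wgen y) = proj r l (wgenU y) :=
  evalOne_whittakerEnd _ _

theorem evalOne_mon_wgen (L : List (GenIndex r l)) :
    evalOne r l (mon wgen L) = proj r l (mon wgenU L) := by
  induction L with
  | nil => rfl
  | cons y L ih => rw [mon_cons, evalOne_mul (evalOne_wgen y), ih, mon_cons, proj_mul]

/-- The Kazhdan degree of a multiset of generators. -/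
abbrev gdegS (S : Multiset (GenIndex r l)) : ℤ := (S.map gdeg).sum

theorem gdegS_coe (L : List (GenIndex r l)) :
    gdegS (L : Multiset (GenIndex r l)) = (L.map gdeg).sum := by
  simp [gdegS]

theorem mon_wgenU_mem (L : List (GenIndex r l)) :
    mon wgenU L ∈ kazhdanParity (L.map gdeg).sum (L.map Prod.fst).sum := by
  induction L with
  | nil => exact Submodule.subset_span ⟨[], by simp, rfl⟩
  | cons y L ih => simpa using kazhdanParity_mul (wgenU_mem y) ih

theorem mon_wgen_mem (L : List (GenIndex r l)) : mon wgen L ∈ (kazhdanW r l).F (L.map gdeg).sum :=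
  ⟨_, kazhdanParity_le _ _ (mon_wgenU_mem L), (evalOne_mon_wgen L).symm⟩

theorem wgen_mem (y : GenIndex r l) : wgen y ∈ (kazhdanW r l).F (gdeg y) := by
  simpa using mon_wgen_mem [y]

theorem mem_decomposableU {L : List (Lt r l)} (h : ∀ x ∈ L, 0 < wt (lev r l) x) :
    mon gen L ∈ decomposableU (kdegS (L : Multiset (Lt r l))) L.length :=
  Submodule.subset_span ⟨L, ⟨h, Or.inr ⟨rfl, Or.inr le_rfl⟩⟩, rfl⟩

theorem decomposableU_mono {k : ℤ} {d d' : ℕ} (h : d ≤ d') :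
    decomposableU (r := r) (l := l) k d' ≤ decomposableU k d := by
  refine Submodule.span_mono (Set.image_mono ?_)
  rintro L ⟨hL, h' | ⟨h1, h2 | h2⟩⟩
  · exact ⟨hL, Or.inl h'⟩
  · exact ⟨hL, Or.inr ⟨h1, Or.inl h2⟩⟩
  · exact ⟨hL, Or.inr ⟨h1, Or.inr (h.trans h2)⟩⟩

theorem decomposableU_mul {k k' : ℤ} {d d' : ℕ} {x y : UQ r l} (hx : x ∈ decomposableU k d)
    (hy : y ∈ decomposableU k' d') : x * y ∈ decomposableU (k + k') (d + d') := by
  have h3 := Submodule.mul_mem_mul hx hy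
  rw [decomposableU, decomposableU, Submodule.span_mul_span] at h3
  refine Submodule.span_mono ?_ h3
  rintro _ ⟨_, ⟨L, ⟨hL, hL'⟩, rfl⟩, _, ⟨M, ⟨hM, hM'⟩, rfl⟩, rfl⟩
  refine ⟨L ++ M, ⟨?_, ?_⟩, by simp⟩
  · intro x hx
    rcases List.mem_append.1 hx with h | h
    · exact hL x h
    · exact hM x h
  · have hd : kdegS ((L ++ M : List (Lt r l)) : Multiset (Lt r l)) =
        kdegS (L : Multiset (Lt r l)) + kdegS (M : Multiset (Lt r l)) := by
      simp only [kdegS_coe, List.map_append, List.sum_append]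
    rw [hd]
    rcases hL' with h1 | ⟨h1, h2⟩
    · left; rcases hM' with h | h <;> omega
    · rcases hM' with h | ⟨h, h'⟩
      · left; omega
      · right
        refine ⟨by omega, ?_⟩
        rcases h2 with ⟨x, hx, hx'⟩ | h2
        · exact Or.inl ⟨x, List.mem_append_left _ hx, hx'⟩
        · rcases h' with ⟨x, hx, hx'⟩ | h'
          · exact Or.inl ⟨x, List.mem_append_right _ hx, hx'⟩
          · right
            rw [List.length_append]; omega

theorem leadSign_ne_zero (c : ZMod 2) (n : ℕ) : leadSign c n ≠ 0 := by
  unfold leadSign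
  split_ifs <;> simp

theorem gdeg_pos (y : GenIndex r l) : 0 < gdeg y := by
  unfold gdeg; omega

theorem kdegS_map_leadLetter (S : Multiset (GenIndex r l)) :
    kdegS (S.map leadLetter) = gdegS S := by
  simp only [kdegS, gdegS, Multiset.map_map, Function.comp_def, wt_leadLetter]

/-- The leading term of a monomial in the generators is the word of their leading letters, up to
decomposable terms with more letters. -/
theorem exists_lead_mon_wgen (L : List (GenIndex r l)) : ∃ (c : ℂ) (u : UQ r l), c ≠ 0 ∧
    evalOne r l (mon wgen L) = proj r l u ∧
    u - c • mon gen (L.map leadLetter) ∈ decomposableU (L.map gdeg).sum (L.length + 1) := by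
  induction L with
  | nil => exact ⟨1, 1, one_ne_zero, rfl, by simp⟩
  | cons y L ih =>
    obtain ⟨c, u, hc, hu, hm⟩ := ih
    obtain ⟨e, he, hpe⟩ := proj_wgenU_lead y
    have hpe' : proj r l (wgenU y) =
        proj r l (leadSign y.1 y.2.2.2 • gen (leadLetter y) + e) := by
      rw [map_add, hpe, map_smul]; abel
    refine ⟨leadSign y.1 y.2.2.2 * c, (leadSign y.1 y.2.2.2 • gen (leadLetter y) + e) * u,
      mul_ne_zero (leadSign_ne_zero _ _) hc, ?_, ?_⟩
    · rw [mon_cons, evalOne_mul ((evalOne_wgen y).trans hpe'), hu, proj_mul]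
    · have hW := mem_decomposableU (L := L.map (leadLetter (r := r) (l := l))) (by
        intro x hx
        obtain ⟨z, -, rfl⟩ := List.mem_map.1 hx
        rw [wt_leadLetter]; exact gdeg_pos z)
      rw [← Multiset.map_coe, kdegS_map_leadLetter, gdegS_coe, List.length_map] at hW
      have hg := mem_decomposableU (L := [leadLetter y]) (by
        intro x hx
        obtain rfl := List.mem_singleton.1 hx
        rw [wt_leadLetter]; exact gdeg_pos y)
      have hg1 : kdegS (([leadLetter y] : List (Lt r l)) : Multiset (Lt r l)) = gdeg y := by
        rw [kdegS_coe]; simp [wt_leadLetter]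
      rw [hg1] at hg
      simp only [mon_cons, mon_nil, mul_one, List.length_singleton] at hg
      have h1 := decomposableU_mul (add_mem (Submodule.smul_mem _ (leadSign y.1 y.2.2.2) hg)
        (decomposableU_mono (by omega) he)) hm
      have h2 := decomposableU_mul he (Submodule.smul_mem _ c hW)
      rw [List.map_cons, List.map_cons, List.sum_cons, List.length_cons, mon_cons]
      have h3 := add_mem (decomposableU_mono (d := L.length + 1 + 1) (by omega) h1)
        (decomposableU_mono (d := L.length + 1 + 1) (by omega) h2)
      convert h3 using 1
      simp only [mul_sub, add_mul, Algebra.mul_smul_comm, Algebra.smul_mul_assoc, mul_smul,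
        smul_add]
      rw [smul_comm c (leadSign y.1 y.2.2.2)]
      abel

/-- Decomposable terms do not contribute to the coefficients at short monomials in first-row
letters. -/
theorem coeff_decomposableU {k : ℤ} {d : ℕ} {u : UQ r l} (hu : u ∈ decomposableU k d)
    {s : Expo r l} (hs : kdegS s.1 = k) (h0 : ∀ x ∈ s.1, (x.2.1.2 : ℕ) = 0) (hd : s.1.card < d) :
    coeff s (proj r l u) = 0 := by
  have := map_mem_of_span (N := ⊥) (coeff s ∘ₗ proj r l) ?_ hu
  · exact this
  · rintro _ ⟨L, ⟨-, hL⟩, rfl⟩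
    refine coeff_mon_of_ne ?_ ?_
    · rintro he
      rcases hL with hL | ⟨-, ⟨x, hx, hx'⟩ | hL⟩
      · rw [he] at hL; omega
      · rw [← Multiset.mem_coe, he] at hx
        exact hx' (h0 x hx)
      · rw [← he, Multiset.coe_card] at hd
        omega
    · rcases hL with hL | ⟨hL, -⟩ <;> omega

/-- The exponents of the leading monomials of the monomials in the generators. -/
def leadExpo (S : Multiset (GenIndex r l)) (hS : Good Prod.fst S) : Expo r l :=
  ⟨S.map leadLetter, by
    classical
    rw [good_iff_count] at hS ⊢
    intro x hx
    by_cases hm : x ∈ S.map leadLetter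
    · obtain ⟨y, -, rfl⟩ := Multiset.mem_map.1 hm
      rw [Multiset.count_map_eq_count' _ _ leadLetter_injective]
      exact hS y hx
    · rw [Multiset.count_eq_zero.2 hm]; omega, by
    intro x hx
    obtain ⟨y, -, rfl⟩ := Multiset.mem_map.1 hx
    rw [wt_leadLetter]; exact gdeg_pos y⟩

theorem leadExpo_row (S : Multiset (GenIndex r l)) (hS : Good Prod.fst S) :
    ∀ x ∈ (leadExpo S hS).1, (x.2.1.2 : ℕ) = 0 := by
  intro x hx
  obtain ⟨y, -, rfl⟩ := Multiset.mem_map.1 hx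
  rfl

/-- The monomials in first-row letters are the leading monomials of the monomials in the generators.
-/
theorem exists_leadExpo (s : Expo r l) (h0 : ∀ x ∈ s.1, (x.2.1.2 : ℕ) = 0) :
    ∃ (S : Multiset (GenIndex r l)) (hS : Good Prod.fst S), s = leadExpo S hS := by
  classical
  let f : Lt r l → GenIndex r l := fun x => (x.1, x.2.1.1, x.2.2.1, x.2.2.2)
  have hf : ∀ x ∈ s.1, leadLetter (f x) = x := by
    rintro ⟨c, ⟨p, i⟩, q, n⟩ hx
    have := h0 _ hx
    simp only [f, leadLetter, Prod.mk.injEq, true_and, and_true, Fin.ext_iff]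
    exact this.symm
  have hm : (s.1.map f).map leadLetter = s.1 := by
    rw [Multiset.map_map]
    exact (Multiset.map_congr rfl hf).trans (Multiset.map_id' _)
  refine ⟨s.1.map f, ?_, Subtype.ext hm.symm⟩
  rw [good_iff_count]
  intro y hy
  have h1 := s.2.1
  rw [good_iff_count] at h1
  rw [← Multiset.count_map_eq_count' _ _ leadLetter_injective, hm]
  exact h1 _ hy

theorem coeff_mon_wgen_of_ne {L : List (GenIndex r l)} {S : Multiset (GenIndex r l)}
    {hS : Good Prod.fst S} (hk : gdegS S = (L.map gdeg).sum) (hc : S.card ≤ L.length)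
    (hne : (L : Multiset (GenIndex r l)) ≠ S) :
    coeff (leadExpo S hS) (evalOne r l (mon wgen L)) = 0 := by
  obtain ⟨c, u, -, hu, hm⟩ := exists_lead_mon_wgen L
  have hks : kdegS (leadExpo S hS).1 = (L.map gdeg).sum := (kdegS_map_leadLetter S).trans hk
  have h1 := coeff_decomposableU hm hks (leadExpo_row S hS) (by
    rw [leadExpo, Multiset.card_map]; omega)
  rw [map_sub, map_sub, map_smul, map_smul, coeff_mon_of_ne, smul_zero, sub_zero] at h1
  · rw [hu, h1]
  · rw [← Multiset.map_coe]
    exact fun h => hne (Multiset.map_injective leadLetter_injective h)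
  · rw [hks, ← Multiset.map_coe, kdegS_map_leadLetter, gdegS_coe]

theorem coeff_mon_wgen_of_eq {L : List (GenIndex r l)} {S : Multiset (GenIndex r l)}
    {hS : Good Prod.fst S} (he : (L : Multiset (GenIndex r l)) = S) :
    coeff (leadExpo S hS) (evalOne r l (mon wgen L)) ≠ 0 := by
  obtain ⟨c, u, hc, hu, hm⟩ := exists_lead_mon_wgen L
  have hks : kdegS (leadExpo S hS).1 = (L.map gdeg).sum := by
    rw [← gdegS_coe, he]; exact kdegS_map_leadLetter S
  have h1 := coeff_decomposableU hm hks (leadExpo_row S hS) (by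
    rw [leadExpo, Multiset.card_map, ← he, Multiset.coe_card]; omega)
  rw [map_sub, map_sub, map_smul, map_smul, sub_eq_zero] at h1
  rw [hu, h1]
  refine mul_ne_zero hc (coeff_mon_of_eq ?_)
  rw [← Multiset.map_coe, he]; rfl

/-- Monomials of degree `k` in the generators are linearly independent modulo lower degree. -/
theorem linearIndependent_lead {k : ℤ} (c : Multiset (GenIndex r l) →₀ ℂ)
    (hc : ∀ S ∈ c.support, Good Prod.fst S ∧ gdegS S = k)
    (h : c.sum (fun S a => a • mon wgen S.toList) ∈ (kazhdanW r l).F (k - 1)) : c = 0 := by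
  by_contra hne
  -- the leading coefficient of a monomial with the least number of letters is not affected by the
  -- decomposable terms of the others
  obtain ⟨S, hS, hmin⟩ := c.support.exists_min_image Multiset.card
    (Finset.nonempty_iff_ne_empty.2 (by simpa using hne))
  obtain ⟨hg, hk⟩ := hc S hS
  have hz := coeff_eq_zero h (s := leadExpo S hg) (by
    have : kdegS (leadExpo S hg).1 = gdegS S := kdegS_map_leadLetter S
    omega)
  rw [Finsupp.sum, map_sum, map_sum, Finset.sum_eq_single S] at hz
  · rw [map_smul, map_smul] at hz
    exact mul_ne_zero (Finsupp.mem_support_iff.1 hS)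
      (coeff_mon_wgen_of_eq (Multiset.coe_toList S)) hz
  · intro T hT hTS
    rw [map_smul, map_smul, coeff_mon_wgen_of_ne, smul_zero]
    · rw [← gdegS_coe, Multiset.coe_toList, hk, (hc T hT).2]
    · rw [Multiset.length_toList]; exact hmin T hT
    · rwa [Multiset.coe_toList]
  · exact fun h => absurd hS h

theorem card_le_kdegS (s : Expo r l) : (s.1.card : ℤ) ≤ kdegS s.1 := by
  have := Multiset.card_nsmul_le_sum (s := s.1.map (wt (lev r l))) (a := 1) (by
    intro x hx
    obtain ⟨y, hy, rfl⟩ := Multiset.mem_map.1 hx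
    exact s.2.2 y hy)
  simpa using this

/-- Monomials in the generators span the `W`-algebra modulo lower degree; for a subspace `P` such
that the first-row coefficients of its elements are nonzero only at exponents satisfying `q`, the
monomials with such exponents suffice for the elements of `P`. -/
theorem exists_sub_mem_pred {k : ℤ} {P : Submodule ℂ (WAlg r l)}
    {q : Multiset (GenIndex r l) → Prop}
    (hP : ∀ S, q S → mon wgen S.toList ∈ P)
    (hq : ∀ w ∈ P, ∀ S hS, coeff (leadExpo S hS) (evalOne r l w) ≠ 0 → q S)
    {w : WAlg r l} (hwP : w ∈ P) (hw : w ∈ (kazhdanW r l).F k) :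
    ∃ w' ∈ Submodule.span ℂ ((fun S : Multiset (GenIndex r l) => mon wgen S.toList) ''
      {S | Good Prod.fst S ∧ gdegS S = k ∧ q S}), w - w' ∈ (kazhdanW r l).F (k - 1) := by
  classical
  set N := Submodule.span ℂ ((fun S : Multiset (GenIndex r l) => mon wgen S.toList) ''
      {S | Good Prod.fst S ∧ gdegS S = k ∧ q S}) with hN
  have hNP : N ≤ P := by
    refine Submodule.span_le.2 ?_
    rintro _ ⟨S, ⟨-, -, hS⟩, rfl⟩
    exact hP S hS
  have hNF : N ≤ (kazhdanW r l).F k := by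
    refine Submodule.span_le.2 ?_
    rintro _ ⟨S, ⟨-, hS, -⟩, rfl⟩
    have := mon_wgen_mem S.toList
    rwa [← gdegS_coe, Multiset.coe_toList, hS] at this
  -- the coefficients are removed in the order of the number of letters
  have main : ∀ d : ℕ, ∃ w' ∈ N, ∀ S hS, gdegS S = k → S.card < d →
      coeff (leadExpo S hS) (evalOne r l (w - w')) = 0 := by
    intro d
    induction d with
    | zero => exact ⟨0, zero_mem _, by simp⟩
    | succ d ih =>
      obtain ⟨w', hw', hd⟩ := ih
      set v := w - w' with hv
      -- the exponents with `d` letters that occur in `v`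
      have hfin : {S : Multiset (GenIndex r l) | ∃ hS, gdegS S = k ∧ S.card = d ∧
          coeff (leadExpo S hS) (evalOne r l v) ≠ 0}.Finite := by
        have h1 : (((qbasis r l).repr (evalOne r l v)).support.image
            fun s : Expo r l => s.1 : Set (Multiset (Lt r l))).Finite := Finset.finite_toSet _
        refine Set.Finite.of_finite_image (f := Multiset.map leadLetter) (h1.subset ?_)
          ((Multiset.map_injective leadLetter_injective).injOn)
        rintro _ ⟨S, ⟨hS, -, -, hne⟩, rfl⟩
        exact Finset.mem_coe.2 (Finset.mem_image.2
          ⟨leadExpo S hS, Finsupp.mem_support_iff.2 hne, rfl⟩)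
      set T := hfin.toFinset with hT
      have hTm : ∀ S, S ∈ T ↔ ∃ hS, gdegS S = k ∧ S.card = d ∧
          coeff (leadExpo S hS) (evalOne r l v) ≠ 0 := fun S => by
        rw [hT, Set.Finite.mem_toFinset]; rfl
      let a : Multiset (GenIndex r l) → ℂ := fun S => if hS : Good Prod.fst S then
        coeff (leadExpo S hS) (evalOne r l v) /
          coeff (leadExpo S hS) (evalOne r l (mon wgen S.toList)) else 0
      have hvP : v ∈ P := sub_mem hwP (hNP hw')
      refine ⟨w' + ∑ S ∈ T, a S • mon wgen S.toList, add_mem hw' (sum_mem fun S hS => ?_), ?_⟩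
      · obtain ⟨hg, hk, -, hne⟩ := (hTm S).1 hS
        exact Submodule.smul_mem _ _ (Submodule.subset_span ⟨S, ⟨hg, hk, hq v hvP S hg hne⟩, rfl⟩)
      · intro S hg hk hc
        rw [← sub_sub, ← hv, map_sub, map_sub, map_sum, map_sum]
        have hterm : ∀ U ∈ T, U ≠ S →
            coeff (leadExpo S hg) (evalOne r l (a U • mon wgen U.toList)) = 0 := by
          intro U hU hUS
          obtain ⟨-, hk', hc', -⟩ := (hTm U).1 hU
          rw [map_smul, map_smul, coeff_mon_wgen_of_ne, smul_zero]
          · rw [← gdegS_coe, Multiset.coe_toList, hk, hk']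
          · rw [Multiset.length_toList]; omega
          · rwa [Multiset.coe_toList]
        by_cases hST : S ∈ T
        · rw [Finset.sum_eq_single S hterm (fun h => absurd hST h), map_smul, map_smul, smul_eq_mul]
          simp only [a, dif_pos hg]
          rw [div_mul_cancel₀ _ (coeff_mon_wgen_of_eq (Multiset.coe_toList S)), sub_self]
        · rw [Finset.sum_eq_zero fun U hU => hterm U hU fun h => hST (h ▸ hU), sub_zero]
          by_cases hc' : S.card = d
          · by_contra hne
            exact hST ((hTm S).2 ⟨hg, hk, hc', hne⟩)
          · exact hd S hg hk (by omega)
  -- each letter has positive degree, so monomials of degree `k` have at most `k` letters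
  obtain ⟨w', hw', h⟩ := main (k.toNat + 1)
  refine ⟨w', hw', mem_kazhdanQ_pred_of_whittaker (sub_mem hw (hNF hw'))
    (fun z hz => gen_smul_evalOne _ hz) ?_⟩
  intro s hs h0
  obtain ⟨S, hS, rfl⟩ := exists_leadExpo s h0
  have h1 := card_le_kdegS (leadExpo S hS)
  have h2 : (leadExpo S hS).1.card = S.card := Multiset.card_map _ _
  have h3 : kdegS (leadExpo S hS).1 = gdegS S := kdegS_map_leadLetter S
  exact h S hS (by omega) (by omega)

/-- Supercommutators of homogeneous elements have lower Kazhdan degree. -/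
theorem superCommutator_mem {k k' : ℤ} {a a' : ZMod 2} {x y : UQ r l} (hx : x ∈ kazhdanParity k a)
    (hy : y ∈ kazhdanParity k' a') :
    x * y - superSign a a' • (y * x) ∈ kazhdanU r l (k + k' - 1) := by
  refine map_mem_of_span (LinearMap.mulLeft ℂ x - superSign a a' • LinearMap.mulRight ℂ x) ?_ hy
  rintro _ ⟨M, ⟨hM, rfl⟩, rfl⟩
  refine map_mem_of_span (LinearMap.mulRight ℂ (mon gen M) -
    superSign a (M.map Prod.fst).sum • LinearMap.mulLeft ℂ (mon gen M)) ?_ hx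
  rintro _ ⟨L, ⟨hL, rfl⟩, rfl⟩
  have h := gen_superComm.block_swap_mem (J := fun s => kdegS s ≤ k + k')
    (J' := fun s => kdegS s ≤ k + k' - 1) (by
      intro x y s M hM hs
      rw [kdegS_comm hM]
      omega) L M [] (by
        simp only [List.append_nil, kdegS_coe, List.map_append, List.sum_append]
        omega)
  simp only [List.append_nil, mon_append] at h
  refine map_mem_of_span LinearMap.id ?_ h
  rintro _ ⟨M, -, hM, rfl⟩
  rw [kdegS_coe] at hM
  exact kazhdanU_mono r l hM (mon_mem_kazhdanU M)

theorem wgen_superCommutator_mem (x y : GenIndex r l) :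
    wgen x * wgen y - superSign x.1 y.1 • (wgen y * wgen x) ∈
      (kazhdanW r l).F (gdeg x + gdeg y - 1) := by
  refine ⟨_, superCommutator_mem (wgenU_mem x) (wgenU_mem y), ?_⟩
  have h1 := evalOne_mon_wgen [x, y]
  have h2 := evalOne_mon_wgen [y, x]
  simp only [mon_cons, mon_nil, mul_one] at h1 h2
  rw [map_sub, map_smul, map_sub, map_smul, h1, h2]

/-! ### Parity of leading terms -/

theorem kazhdanParity_le_parityU (k : ℤ) (a : ZMod 2) :
    kazhdanParity (r := r) (l := l) k a ≤ parityU r l a := by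
  have hgen : ∀ x : Lt r l, gen x ∈ parityU r l x.1 := by
    intro x
    refine sub_mem ?_ ?_
    · have := mon_mem_degreePart (f := Env.of _) (D := Queer.parity)
        (b := letter (ι := Fin r × Fin l)) (w := Prod.fst) letter_mem_parity [x]
      rw [parityU]
      simpa using this
    · by_cases h : chi r l (letter x) = 0
      · simp [h]
      · rw [Algebra.algebraMap_eq_smul_one, (isKazhdanEven_chi x h).2]
        exact Submodule.smul_mem _ _ (one_mem_degreePart _ _)
  refine Submodule.span_le.2 ?_
  rintro _ ⟨L, ⟨-, rfl⟩, rfl⟩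
  induction L with
  | nil => exact one_mem_degreePart _ _
  | cons x L ih =>
    rw [mon_cons, List.map_cons, List.sum_cons]
    exact degreePart_mul_le _ _ _ _ (Submodule.mul_mem_mul (hgen x) ih)

theorem mon_wgen_mem_parityW (L : List (GenIndex r l)) :
    mon wgen L ∈ parityW r l (L.map Prod.fst).sum :=
  ⟨_, kazhdanParity_le_parityU _ _ (mon_wgenU_mem L), (evalOne_mon_wgen L).symm⟩

theorem parity_le_span {ι : Type} [Fintype ι] [DecidableEq ι] (a : ZMod 2) :
    Queer.parity (ι := ι) a ≤ Submodule.span ℂ (letter '' {x : Letter ι | x.1 = a}) := by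
  intro v hv
  rw [eq_sum_letter v]
  refine sum_mem fun i _ => sum_mem fun j _ => ?_
  rcases zmod_two_cases a with rfl | rfl
  · rw [Queer.mem_parity_zero] at hv
    rw [hv, Matrix.zero_apply, zero_smul, add_zero]
    exact Submodule.smul_mem _ _ (Submodule.subset_span ⟨_, rfl, rfl⟩)
  · rw [Queer.mem_parity_one] at hv
    rw [hv, Matrix.zero_apply, zero_smul, zero_add]
    exact Submodule.smul_mem _ _ (Submodule.subset_span ⟨_, rfl, rfl⟩)

/-- Rewriting in normal form preserves the parity of words. -/
theorem coeff_eq_zero_of_parity {a : ZMod 2} {u : UQ r l} (hu : u ∈ parityU r l a) {s : Expo r l}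
    (hs : (s.1.map Prod.fst).sum ≠ a) : coeff s (proj r l u) = 0 := by
  have h1 := degreePart_le_span (f := Env.of (Fin r × Fin l)) parity_le_span a hu
  refine map_mem_of_span (N := ⊥) (coeff s ∘ₗ proj r l) ?_ h1
  rintro _ ⟨L, hL, rfl⟩
  refine map_mem_of_span (N := ⊥) (coeff s ∘ₗ proj r l) ?_ (mon_of_letter_mem L)
  rintro _ ⟨M, ⟨-, hM⟩, rfl⟩
  have h2 := gen_superComm.mem_span_normal (J := fun t => (t.map Prod.fst).sum = a) (by
    intro x y t M hM ht
    have := hM.2.2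
    simp only [Multiset.map_add, Multiset.sum_add, Multiset.map_cons, Multiset.sum_cons,
      Multiset.map_coe, Multiset.sum_coe, this] at ht ⊢
    rw [← ht, add_assoc]) nfWord coe_nfWord M (by
      rw [Multiset.map_coe, Multiset.sum_coe, hM]; exact hL)
  refine map_mem_of_span (N := ⊥) (coeff s ∘ₗ proj r l) ?_ h2
  rintro _ ⟨t, ht, hta, rfl⟩
  by_cases hpos : ∀ x ∈ t, 0 < wt (lev r l) x
  · change coeff s (qmon ⟨t, ht, hpos⟩) = 0
    rw [coeff_qmon, if_neg]
    rintro rfl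
    exact hs hta
  · push Not at hpos
    obtain ⟨z, hz, hz'⟩ := hpos
    change coeff s (proj r l _) = 0
    rw [proj_mon_nfWord_eq_zero hz hz', map_zero]

theorem parity_eq_of_coeff_ne_zero {a : ZMod 2} {w : WAlg r l} (hw : w ∈ parityW r l a)
    (S : Multiset (GenIndex r l)) (hS : Good Prod.fst S)
    (h : coeff (leadExpo S hS) (evalOne r l w) ≠ 0) : (S.map Prod.fst).sum = a := by
  obtain ⟨u, hu, hw⟩ := hw
  by_contra hne
  refine h ?_
  rw [← hw]
  refine coeff_eq_zero_of_parity hu ?_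
  rwa [leadExpo, Multiset.map_map]

end WMonomials

/-! ### The annihilator of the functional -/

section Annihilator

/-- The matrix of the component of parity `c`. -/
def part {ι : Type} (c : ZMod 2) : Queer ι →ₗ[ℂ] Matrix ι ι ℂ where
  toFun x := if c = 0 then x.even else x.odd
  map_add' x y := by split_ifs <;> rfl
  map_smul' a x := by split_ifs <;> rfl

theorem part_zero {ι : Type} (x : Queer ι) : part 0 x = x.even := rfl

theorem part_one {ι : Type} (x : Queer ι) : part 1 x = x.odd := rfl

theorem queer_ext_part {ι : Type} {x y : Queer ι} (h : ∀ c, part c x = part c y) : x = y :=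
  Queer.ext (h 0) (h 1)

theorem part_eq_zero_of_mem_parity {ι : Type} {a c : ZMod 2} {x : Queer ι} (hx : x ∈ Queer.parity a)
    (h : c ≠ a) : part c x = 0 := by
  rcases zmod_two_cases a with rfl | rfl <;> rcases zmod_two_cases c with rfl | rfl
  · exact absurd rfl h
  · exact hx
  · exact hx
  · exact absurd rfl h

variable {r l : ℕ}

theorem jordan_mul_apply (A : Matrix (Fin r × Fin l) (Fin r × Fin l) ℂ) (p : Fin r) (i : Fin l)
    (b : Fin r × Fin l) :
    (jordan r l * A) (p, i) b = if h : (i : ℕ) + 1 < l then A (p, ⟨i + 1, h⟩) b else 0 := by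
  rw [Matrix.mul_apply]
  split_ifs with h
  · rw [Finset.sum_eq_single (p, ⟨i + 1, h⟩)]
    · simp [jordan]
    · rintro ⟨q, j⟩ - hne
      rw [jordan, Matrix.of_apply, if_neg, zero_mul]
      rintro ⟨h1, h2⟩
      exact hne (Prod.ext h1.symm (Fin.ext h2))
    · exact fun h => absurd (Finset.mem_univ _) h
  · refine Finset.sum_eq_zero fun k _ => ?_
    rw [jordan, Matrix.of_apply, if_neg, zero_mul]
    rintro ⟨-, h2⟩
    have := k.2.2
    simp only at h2
    omega

theorem mul_jordan_apply (A : Matrix (Fin r × Fin l) (Fin r × Fin l) ℂ) (a : Fin r × Fin l)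
    (q : Fin r) (j : Fin l) :
    (A * jordan r l) a (q, j) = if 0 < (j : ℕ) then A a (q, ⟨j - 1, by omega⟩) else 0 := by
  rw [Matrix.mul_apply]
  split_ifs with h
  · rw [Finset.sum_eq_single (q, ⟨j - 1, by omega⟩)]
    · rw [jordan, Matrix.of_apply, if_pos, mul_one]
      exact ⟨rfl, by simp only; omega⟩
    · rintro ⟨q', j'⟩ - hne
      rw [jordan, Matrix.of_apply, if_neg, mul_zero]
      rintro ⟨h1, h2⟩
      refine hne (Prod.ext h1 (Fin.ext ?_))
      simp only at h2 ⊢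
      omega
    · exact fun h => absurd (Finset.mem_univ _) h
  · refine Finset.sum_eq_zero fun k _ => ?_
    rw [jordan, Matrix.of_apply, if_neg, mul_zero]
    rintro ⟨-, h2⟩
    simp only at h2
    omega

/-- The functional on brackets, by the cyclicity of the trace. -/
theorem chi_bracket (x z : Queer (Fin r × Fin l)) : chi r l ⁅x, z⁆ =
    (z.even * (jordan r l * x.even - x.even * jordan r l)).trace +
      (z.odd * (jordan r l * x.odd + x.odd * jordan r l)).trace := by
  change Matrix.trace (Queer.mul ⁅x, z⁆ (oddE r l)).odd = _
  have h : (Queer.mul ⁅x, z⁆ (oddE r l)).odd = (x.even * z.even * jordan r l -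
      z.even * x.even * jordan r l) +
      (x.odd * z.odd * jordan r l + z.odd * x.odd * jordan r l) := by
    simp [Queer.mul, oddE, sub_mul, add_mul]
  have e : ∀ A Z : Matrix (Fin r × Fin l) (Fin r × Fin l) ℂ,
      (A * Z * jordan r l).trace = (Z * (jordan r l * A)).trace := by
    intro A Z
    rw [Matrix.mul_assoc, Matrix.trace_mul_comm, Matrix.mul_assoc]
  rw [h, Matrix.trace_add, Matrix.trace_sub, Matrix.trace_add, Matrix.mul_sub, Matrix.mul_add,
    Matrix.trace_sub, Matrix.trace_add, e x.even, e x.odd, Matrix.mul_assoc z.even,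
    Matrix.mul_assoc z.odd]

/-- An element lies in the annihilator if and only if it supercommutes with the odd nilpotent
element. -/
theorem mem_gChi_iff {x : Queer (Fin r × Fin l)} : x ∈ gChi r l ↔
    ∀ c, jordan r l * part c x = superSign c 1 • (part c x * jordan r l) := by
  have h0 : (jordan r l * part 0 x = superSign 0 1 • (part 0 x * jordan r l)) ↔
      jordan r l * x.even - x.even * jordan r l = 0 := by
    rw [superSign_zero_left, one_smul, sub_eq_zero]; rfl
  have h1 : (jordan r l * part 1 x = superSign 1 1 • (part 1 x * jordan r l)) ↔
      jordan r l * x.odd + x.odd * jordan r l = 0 := by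
    rw [superSign, if_pos ⟨rfl, rfl⟩, neg_smul, one_smul, ← add_eq_zero_iff_eq_neg]; rfl
  constructor
  · intro hx c
    have hx' : ∀ z, chi r l ⁅x, z⁆ = 0 := hx
    simp only [chi_bracket] at hx'
    rcases zmod_two_cases c with rfl | rfl
    · rw [h0]
      ext a b
      simpa [Matrix.trace_single_mul] using hx' ⟨Matrix.single b a 1, 0⟩
    · rw [h1]
      ext a b
      simpa [Matrix.trace_single_mul] using hx' ⟨0, Matrix.single b a 1⟩
  · intro h z
    rw [chi_bracket, h0.1 (h 0), h1.1 (h 1), mul_zero, mul_zero, Matrix.trace_zero, add_zero]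

/-- A matrix commuting with the Jordan matrix up to the factor `ε` is determined by its entries in
the first rows of the blocks. -/
theorem apply_eq_of_jordan_mul {A : Matrix (Fin r × Fin l) (Fin r × Fin l) ℂ} {ε : ℂ}
    (h : jordan r l * A = ε • (A * jordan r l)) (p q : Fin r) (i : ℕ) : ∀ (hi : i < l) (j : Fin l),
    A (p, ⟨i, hi⟩) (q, j) =
      if i ≤ j then ε ^ i * A (p, ⟨0, j.pos⟩) (q, ⟨j - i, by omega⟩) else 0 := by
  induction i with
  | zero => intro hi j; simp
  | succ i ih =>
    intro hi j
    have := congrFun₂ h (p, ⟨i, by omega⟩) (q, j)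
    rw [jordan_mul_apply, dif_pos hi, Matrix.smul_apply, mul_jordan_apply] at this
    rw [this]
    by_cases hj : 0 < (j : ℕ)
    · rw [if_pos hj, ih]
      by_cases hij : i + 1 ≤ (j : ℕ)
      · rw [if_pos hij, if_pos (by simp only; omega), smul_eq_mul, pow_succ', mul_assoc]
        simp only [Nat.sub_sub, add_comm 1 i]
      · rw [if_neg hij, if_neg (by simp only; omega), smul_zero]
    · rw [if_neg hj, smul_zero, if_neg (by omega)]

/-- The matrix with entries `ε ^ i` in rows `i`, on the diagonal with number `n` of the block in
position `(p, q)`, where `y = (c, p, q, n)` and `ε` is `1` for `c = 0` and `-1` for `c = 1`. -/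
def stringMatrix (y : GenIndex r l) : Matrix (Fin r × Fin l) (Fin r × Fin l) ℂ :=
  Matrix.of fun a b => if a.1 = y.2.1 ∧ b.1 = y.2.2.1 ∧ (b.2 : ℕ) = a.2 + y.2.2.2 then
    superSign y.1 1 ^ (a.2 : ℕ) else 0

theorem jordan_mul_stringMatrix (y : GenIndex r l) :
    jordan r l * stringMatrix y = superSign y.1 1 • (stringMatrix y * jordan r l) := by
  ext ⟨p, i⟩ ⟨q, j⟩
  rw [jordan_mul_apply, Matrix.smul_apply, mul_jordan_apply]
  simp only [stringMatrix, Matrix.of_apply]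
  by_cases h : p = y.2.1 ∧ q = y.2.2.1 ∧ (j : ℕ) = i + 1 + y.2.2.2
  · rw [dif_pos (by omega), if_pos h, if_pos (by omega), if_pos ⟨h.1, h.2.1, by omega⟩, pow_succ',
      smul_eq_mul]
  · split_ifs with h1 h2 h3 h4 <;> 
      first | (exfalso; exact h ⟨by tauto, by tauto, by omega⟩) | simp

/-- The basis vectors of the annihilator. -/
def annVector (y : GenIndex r l) : Queer (Fin r × Fin l) :=
  if y.1 = 0 then ⟨stringMatrix y, 0⟩ else ⟨0, stringMatrix y⟩

theorem part_annVector (c : ZMod 2) (y : GenIndex r l) :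
    part c (annVector y) = if c = y.1 then stringMatrix y else 0 := by
  obtain ⟨d, y⟩ := y
  rcases zmod_two_cases c with rfl | rfl <;> rcases zmod_two_cases d with rfl | rfl <;>
    simp [part_zero, part_one, annVector]

theorem annVector_mem_gChi (y : GenIndex r l) : annVector y ∈ gChi r l := by
  rw [mem_gChi_iff]
  intro c
  rw [part_annVector]
  split_ifs with h
  · rw [h]; exact jordan_mul_stringMatrix y
  · simp

theorem annVector_mem_parity (y : GenIndex r l) : annVector y ∈ Queer.parity y.1 := by
  obtain ⟨c, y⟩ := y
  rcases zmod_two_cases c with rfl | rfl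
  · rfl
  · rfl

/-- The coordinates on the annihilator: the entries in the first rows of the blocks. -/
def annCoord (y : GenIndex r l) : Queer (Fin r × Fin l) →ₗ[ℂ] ℂ where
  toFun x := part y.1 x (leadLetter y).2.1 (leadLetter y).2.2
  map_add' x x' := by rw [map_add]; rfl
  map_smul' c x := by rw [map_smul]; rfl

theorem annCoord_annVector (y z : GenIndex r l) :
    annCoord y (annVector z) = if y = z then 1 else 0 := by
  change part y.1 (annVector z) _ _ = _
  obtain ⟨c, p, q, n⟩ := y
  obtain ⟨c', p', q', n'⟩ := z
  rw [part_annVector]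
  simp only [leadLetter, stringMatrix, Prod.mk.injEq]
  by_cases hc : c = c'
  · simp only [hc, if_true, Matrix.of_apply, true_and, pow_zero, zero_add, Fin.ext_iff]
  · simp [hc]

theorem eq_sum_annVector {x : Queer (Fin r × Fin l)} (hx : x ∈ gChi r l) :
    x = ∑ y, annCoord y x • annVector y := by
  rw [mem_gChi_iff] at hx
  refine queer_ext_part fun c => ?_
  ext ⟨p, i⟩ ⟨q, j⟩
  rw [map_sum, Matrix.sum_apply, show i = ⟨i, i.2⟩ from rfl, apply_eq_of_jordan_mul (hx c) p q i]
  simp only [map_smul, Matrix.smul_apply, part_annVector]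
  split_ifs with hij
  · rw [Finset.sum_eq_single (c, p, q, ⟨j - i, by omega⟩)]
    · rw [if_pos rfl, stringMatrix, Matrix.of_apply, if_pos ⟨rfl, rfl, by simp only; omega⟩,
        smul_eq_mul, mul_comm]
      rfl
    · rintro ⟨c', p', q', n⟩ - hne
      by_cases hc : c = c'
      · rw [if_pos hc, stringMatrix, Matrix.of_apply, if_neg, smul_zero]
        rintro ⟨h1, h2, h3⟩
        simp only at h1 h2 h3
        refine hne ?_
        rw [hc, h1, h2]
        simp only [Prod.mk.injEq, true_and]
        ext
        simp only
        omega
      · rw [if_neg hc]; simp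
    · exact fun h => absurd (Finset.mem_univ _) h
  · refine (Finset.sum_eq_zero fun y _ => ?_).symm
    split_ifs
    · rw [stringMatrix, Matrix.of_apply, if_neg, smul_zero]
      rintro ⟨-, -, h3⟩
      simp only at h3
      omega
    · simp

theorem annVector_mem_dynkin (y : GenIndex r l) : annVector y ∈ dynkin r l (gdeg y - 2) := by
  rw [eq_sum_letter (annVector y)]
  refine sum_mem fun a _ => sum_mem fun b _ => ?_
  by_cases h : (b.2 : ℕ) = a.2 + y.2.2.2
  · have hw : ∀ c, gdeg y = wt (lev r l) (c, a, b) := by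
      intro c
      rw [wt_letter, gdeg, h]; push_cast; ring
    exact add_mem (Submodule.smul_mem _ _ (by rw [hw 0]; exact letter_mem_dynkin _))
      (Submodule.smul_mem _ _ (by rw [hw 1]; exact letter_mem_dynkin _))
  · have h0 : ∀ c, part c (annVector y) a b = 0 := by
      intro c
      rw [part_annVector]
      split_ifs
      · rw [stringMatrix, Matrix.of_apply, if_neg]
        exact fun h' => h h'.2.2
      · rfl
    have h1 := h0 0
    have h2 := h0 1
    rw [part_zero] at h1
    rw [part_one] at h2
    rw [h1, h2, zero_smul, zero_smul, add_zero]
    exact zero_mem _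

/-! ### The Dynkin grading is good -/

theorem mem_dynkin {j : ℤ} {x : Queer (Fin r × Fin l)} :
    x ∈ dynkin r l j ↔ ⁅cartanH r l, x⁆ = (j : ℂ) • x := Iff.rfl

theorem cartanH_bracket (x y : Queer (Fin r × Fin l)) :
    ⁅cartanH r l, ⁅x, y⁆⁆ = ⁅⁅cartanH r l, x⁆, y⁆ + ⁅x, ⁅cartanH r l, y⁆⁆ := by
  ext1 <;>
  · simp only [cartanH, Queer.bracket_even, Queer.bracket_odd, Queer.add_even, Queer.add_odd,
      Matrix.zero_mul, Matrix.mul_zero, sub_zero, add_zero]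
    noncomm_ring

/-- The operator `ad h`. -/
def adH (r l : ℕ) : Module.End ℂ (Queer (Fin r × Fin l)) where
  toFun x := ⁅cartanH r l, x⁆
  map_add' := Queer.bracket_add _
  map_smul' c x := Queer.bracket_smul c _ x

theorem isInternal_dynkin : DirectSum.IsInternal (dynkin r l) := by
  rw [DirectSum.isInternal_submodule_iff_iSupIndep_and_iSup_eq_top]
  constructor
  · have h := (Module.End.eigenspaces_iSupIndep (adH r l)).comp
      (Int.cast_injective (α := ℂ))
    convert h using 1
    funext j
    ext x
    rw [Function.comp_apply, Module.End.mem_eigenspace_iff]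
    rfl
  · rw [eq_top_iff]
    intro x _
    rw [eq_sum_letter x]
    have hl : ∀ z : Lt r l, letter z ∈ ⨆ j, dynkin r l j := fun z =>
      Submodule.mem_iSup_of_mem _ (letter_mem_dynkin z)
    exact sum_mem fun a _ => sum_mem fun b _ =>
      add_mem (Submodule.smul_mem _ _ (hl _)) (Submodule.smul_mem _ _ (hl _))

theorem isGoodGrading_dynkin : IsGoodGrading (dynkin r l) (chi r l) where
  internal := isInternal_dynkin
  bracket_mem i j x y hx hy := by
    rw [mem_dynkin] at *
    rw [cartanH_bracket, hx, hy, Queer.smul_bracket, Queer.bracket_smul, Int.cast_add, add_smul]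
  parity j := by
    refine le_antisymm ?_ (iSup_le fun a => inf_le_left)
    refine (dynkin_le_span j).trans (Submodule.span_le.2 ?_)
    rintro _ ⟨x, rfl, rfl⟩
    exact Submodule.mem_iSup_of_mem x.1 ⟨letter_mem_dynkin x, letter_mem_parity x⟩
  chi_eq_zero j hj x hx := by
    refine map_mem_of_span (N := ⊥) (chi r l) ?_ (dynkin_le_span j hx)
    rintro _ ⟨z, rfl, rfl⟩
    by_contra h
    exact hj (by rw [(isKazhdanEven_chi z h).1]; rfl)
  annihilator_le := by
    intro x hx
    rw [eq_sum_annVector hx]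
    refine sum_mem fun y _ => Submodule.smul_mem _ _ ?_
    exact (le_iSup₂_of_le (f := fun (j : ℤ) (_ : 0 ≤ j) => dynkin r l j) (gdeg y - 2)
      (by unfold gdeg; omega) le_rfl) (annVector_mem_dynkin y)

theorem dynkin_neg_one : dynkin r l (-1) = ⊥ := by
  rw [eq_bot_iff]
  refine (dynkin_le_span (-1)).trans ?_
  rw [show {x : Lt r l | wt (lev r l) x - 2 = -1} = ∅ from ?_, Set.image_empty,
    Submodule.span_empty]
  ext x
  simp only [Set.mem_ofPred_eq, Set.mem_empty_iff_false, iff_false, wt]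
  omega

end Annihilator

/-! ### The associated graded algebra -/

section Graded

namespace AlgFiltration

variable {A : Type} [Ring A] [Algebra ℂ A] (Φ : AlgFiltration A)

/-- The symbol in degree `k` of an element of filtration degree `k`, in the associated graded
algebra. -/
def symbol (k : ℤ) : Φ.F k →ₗ[ℂ] Φ.Gr := DirectSum.lof ℂ ℤ Φ.Piece k ∘ₗ Φ.symb k

theorem symbol_congr {i j : ℤ} (h : i = j) {x y : A} (hx : x ∈ Φ.F i) (hy : y ∈ Φ.F j)
    (hxy : x = y) : Φ.symbol i ⟨x, hx⟩ = Φ.symbol j ⟨y, hy⟩ := by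
  subst h hxy; rfl

theorem symbol_mul {i j : ℤ} {x y : A} (hx : x ∈ Φ.F i) (hy : y ∈ Φ.F j) :
    Φ.symbol i ⟨x, hx⟩ * Φ.symbol j ⟨y, hy⟩ = Φ.symbol (i + j) ⟨x * y, Φ.mul_mem hx hy⟩ :=
  DirectSum.of_mul_of (A := Φ.Piece) _ _

theorem symbol_eq_zero {k : ℤ} {x : A} (hx : x ∈ Φ.F k) :
    Φ.symbol k ⟨x, hx⟩ = 0 ↔ x ∈ Φ.F (k - 1) := by
  have h1 : Φ.symbol k ⟨x, hx⟩ = 0 ↔ Φ.symb k ⟨x, hx⟩ = 0 := by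
    rw [← map_zero (DirectSum.lof ℂ ℤ Φ.Piece k)]
    exact (DirectSum.of_injective (β := Φ.Piece) k).eq_iff
  rw [h1]
  exact Submodule.Quotient.mk_eq_zero (Φ.lower k)

theorem symbol_mem_grDegree {k : ℤ} (x : Φ.F k) : Φ.symbol k x ∈ Φ.grDegree k := ⟨_, rfl⟩

theorem exists_symbol {k : ℤ} {v : Φ.Gr} (hv : v ∈ Φ.grDegree k) : ∃ x, v = Φ.symbol k x := by
  obtain ⟨x, rfl⟩ := hv
  obtain ⟨x, rfl⟩ := Φ.symb_surjective k x
  exact ⟨x, rfl⟩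

theorem iSup_grDegree : ⨆ k, Φ.grDegree k = ⊤ := by
  classical
  rw [eq_top_iff]
  intro v _
  induction v using DirectSum.induction_on with
  | zero => exact zero_mem _
  | of i x => exact Submodule.mem_iSup_of_mem i ⟨x, rfl⟩
  | add x y hx hy => exact add_mem (hx trivial) (hy trivial)

end AlgFiltration

variable {r l : ℕ}

/-- The symbols of the generators of the `W`-algebra. -/
def grGen (y : GenIndex r l) : (kazhdanW r l).Gr :=
  (kazhdanW r l).symbol (gdeg y) ⟨wgen y, wgen_mem y⟩

theorem mon_grGen (L : List (GenIndex r l)) :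
    mon grGen L = (kazhdanW r l).symbol (L.map gdeg).sum ⟨mon wgen L, mon_wgen_mem L⟩ := by
  induction L with
  | nil => rfl
  | cons y L ih =>
    rw [mon_cons, ih, grGen, AlgFiltration.symbol_mul]
    exact AlgFiltration.symbol_congr _ (by simp) _ _ (by simp)

theorem grGen_superComm (x y : GenIndex r l) :
    grGen x * grGen y = superSign x.1 y.1 • (grGen y * grGen x) := by
  have h1 : wgen y * wgen x ∈ (kazhdanW r l).F (gdeg x + gdeg y) := by
    rw [add_comm]; exact (kazhdanW r l).mul_mem (wgen_mem y) (wgen_mem x)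
  have h2 : grGen y * grGen x = (kazhdanW r l).symbol (gdeg x + gdeg y) ⟨_, h1⟩ := by
    rw [grGen, grGen, AlgFiltration.symbol_mul]
    exact AlgFiltration.symbol_congr _ (add_comm _ _) _ _ rfl
  rw [← sub_eq_zero, h2, grGen, grGen, AlgFiltration.symbol_mul, ← map_smul, ← map_sub]
  exact (AlgFiltration.symbol_eq_zero _ _).2 (wgen_superCommutator_mem x y)

/-- The normal monomials in the symbols of the generators are linearly independent: a relation may
be projected to each degree, where `linearIndependent_lead` applies. -/
theorem linearIndependent_mon_grGen : LinearIndependent ℂ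
    (fun S : {S : Multiset (GenIndex r l) // Good Prod.fst S} => mon grGen S.1.toList) := by
  classical
  rw [linearIndependent_iff]
  intro c hc
  ext S
  -- the component of degree `k` of the relation, for the degree `k` of `S`
  set k := gdegS S.1 with hk
  have hdeg : ∀ T : Multiset (GenIndex r l), (T.toList.map gdeg).sum = gdegS T := fun T => by
    rw [← gdegS_coe, Multiset.coe_toList]
  have hmem : ∀ T : Multiset (GenIndex r l), gdegS T = k → mon wgen T.toList ∈ (kazhdanW r l).F k :=
    fun T hT => by have := mon_wgen_mem T.toList; rwa [hdeg, hT] at this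
  let c' : Multiset (GenIndex r l) →₀ ℂ := (c.mapDomain Subtype.val).filter fun T => gdegS T = k
  have hc'S : c' S.1 = c S := by
    rw [show c' S.1 = (c.mapDomain Subtype.val) S.1 from
      Finsupp.filter_apply_pos (fun T => gdegS T = k) _ hk.symm]
    exact Finsupp.mapDomain_apply Subtype.val_injective _ _
  have hgood : ∀ T ∈ c'.support, Good Prod.fst T ∧ gdegS T = k := by
    intro T hT
    rw [Finsupp.support_filter, Finset.mem_filter] at hT
    obtain ⟨U, -, rfl⟩ := Finset.mem_image.1 (Finsupp.mapDomain_support hT.1)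
    exact ⟨U.2, hT.2⟩
  rw [Finsupp.zero_apply, ← hc'S]
  suffices h : c' = 0 by rw [h, Finsupp.zero_apply]
  have hsum : c'.sum (fun T a => a • mon wgen T.toList) ∈ (kazhdanW r l).F k :=
    sum_mem fun T hT => Submodule.smul_mem _ _ (hmem T (hgood T hT).2)
  refine linearIndependent_lead c' hgood ((AlgFiltration.symbol_eq_zero _ hsum).1 ?_)
  have h1 : (kazhdanW r l).symbol k ⟨_, hsum⟩ = c'.sum fun T a => a • mon grGen T.toList := by
    have h2 : (⟨_, hsum⟩ : (kazhdanW r l).F k) = ∑ T ∈ c'.support.attach,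
        c' T.1 • ⟨mon wgen T.1.toList, hmem T.1 (hgood T.1 T.2).2⟩ := by
      ext1
      simp only [AddSubmonoidClass.coe_finsetSum, Submodule.coe_smul]
      exact (Finset.sum_attach c'.support fun T => c' T • mon wgen T.toList).symm
    rw [h2, map_sum, Finsupp.sum, ← Finset.sum_attach c'.support]
    refine Finset.sum_congr rfl fun T _ => ?_
    rw [map_smul, mon_grGen]
    refine congrArg _ (AlgFiltration.symbol_congr _ ?_ _ _ rfl)
    rw [hdeg, (hgood T.1 T.2).2]
  rw [h1]
  -- projecting to the component of degree `k`
  let π : (kazhdanW r l).Gr →ₗ[ℂ] (kazhdanW r l).Gr :=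
    DirectSum.lof ℂ ℤ (kazhdanW r l).Piece k ∘ₗ DirectSum.component ℂ ℤ (kazhdanW r l).Piece k
  have hπ : ∀ T : Multiset (GenIndex r l),
      π (mon grGen T.toList) = if gdegS T = k then mon grGen T.toList else 0 := by
    intro T
    rw [mon_grGen]
    change DirectSum.lof ℂ ℤ (kazhdanW r l).Piece k (DirectSum.component ℂ ℤ _ k
      (DirectSum.lof ℂ ℤ (kazhdanW r l).Piece _ _)) = _
    split_ifs with h
    · have h' : (T.toList.map gdeg).sum = k := (hdeg T).trans h
      clear_value k
      subst h'
      rw [DirectSum.component.lof_self]; rfl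
    · rw [DirectSum.component.of, dif_neg (by rwa [hdeg]), map_zero]
  have h3 := congrArg π hc
  rw [map_zero, Finsupp.linearCombination_apply, Finsupp.sum, map_sum] at h3
  simp only [map_smul, hπ] at h3
  rw [← h3]
  have h4 : (c.mapDomain Subtype.val).sum
      (fun T a => a • (if gdegS T = k then mon grGen T.toList else 0)) =
      ∑ x ∈ c.support, c x • (if gdegS x.1 = k then mon grGen x.1.toList else 0) :=
    Finsupp.sum_mapDomain_index (by simp) (by intros; rw [add_smul])
  rw [← h4, Finsupp.sum, Finsupp.sum, Finsupp.support_filter, Finset.sum_filter]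
  refine Finset.sum_congr rfl fun T _ => ?_
  split_ifs with h
  · rw [Finsupp.filter_apply_pos (fun T => gdegS T = k) _ h]
  · rw [smul_zero]

/-- Symbols are combinations of monomials in the symbols of the generators; `P` and `q` are as in
`exists_sub_mem_pred`. -/
theorem symbol_mem_span {k : ℤ} {P : Submodule ℂ (WAlg r l)} {q : Multiset (GenIndex r l) → Prop}
    (hP : ∀ S, q S → mon wgen S.toList ∈ P)
    (hq : ∀ w ∈ P, ∀ S hS, coeff (leadExpo S hS) (evalOne r l w) ≠ 0 → q S)
    {w : WAlg r l} (hwP : w ∈ P) (hw : w ∈ (kazhdanW r l).F k) :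
    (kazhdanW r l).symbol k ⟨w, hw⟩ ∈
      Submodule.span ℂ ((fun S : Multiset (GenIndex r l) => mon grGen S.toList) ''
        {S | Good Prod.fst S ∧ gdegS S = k ∧ q S}) := by
  obtain ⟨w', hw', hm⟩ := exists_sub_mem_pred hP hq hwP hw
  have hF : Submodule.span ℂ ((fun S : Multiset (GenIndex r l) => mon wgen S.toList) ''
      {S | Good Prod.fst S ∧ gdegS S = k ∧ q S}) ≤
      ((Submodule.span ℂ ((fun S : Multiset (GenIndex r l) => mon grGen S.toList) ''
        {S | Good Prod.fst S ∧ gdegS S = k ∧ q S})).comap ((kazhdanW r l).symbol k)).map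
          ((kazhdanW r l).F k).subtype := by
    refine Submodule.span_le.2 ?_
    rintro _ ⟨S, hS, rfl⟩
    have hdeg : (S.toList.map gdeg).sum = k := by
      rw [← gdegS_coe, Multiset.coe_toList]; exact hS.2.1
    refine ⟨⟨_, hdeg ▸ mon_wgen_mem S.toList⟩, ?_, rfl⟩
    refine Submodule.subset_span ⟨S, hS, ?_⟩
    change mon grGen S.toList = _
    rw [mon_grGen]
    exact AlgFiltration.symbol_congr _ hdeg _ _ rfl
  obtain ⟨⟨w', hw'F⟩, hs, rfl⟩ := hF hw'
  have h1 : (kazhdanW r l).symbol k ⟨w, hw⟩ = (kazhdanW r l).symbol k ⟨w', hw'F⟩ := by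
    rw [← sub_eq_zero, ← map_sub]
    exact (AlgFiltration.symbol_eq_zero _ _).2 hm
  rw [h1]
  exact hs

theorem grDegree_eq_span (k : ℤ) : (kazhdanW r l).grDegree k =
    Submodule.span ℂ (mon grGen '' {L : List (GenIndex r l) | (L.map gdeg).sum = k}) := by
  apply le_antisymm
  · intro v hv
    obtain ⟨⟨w, hw⟩, rfl⟩ := AlgFiltration.exists_symbol _ hv
    refine Submodule.span_mono ?_ (symbol_mem_span (P := ⊤) (q := fun _ => True)
      (fun _ _ => trivial) (fun _ _ _ _ _ => trivial) trivial hw)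
    rintro _ ⟨S, ⟨-, hS, -⟩, rfl⟩
    refine ⟨S.toList, ?_, rfl⟩
    rwa [Set.mem_ofPred_eq, ← gdegS_coe, Multiset.coe_toList]
  · refine Submodule.span_le.2 ?_
    rintro _ ⟨L, rfl, rfl⟩
    rw [mon_grGen]
    exact AlgFiltration.symbol_mem_grDegree _ _

theorem grSub_parityW_eq_span (a : ZMod 2) : (kazhdanW r l).grSub (parityW r l a) =
    Submodule.span ℂ (mon grGen '' {L : List (GenIndex r l) | (L.map Prod.fst).sum = a}) := by
  apply le_antisymm
  · refine iSup_le fun k => ?_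
    rintro _ ⟨⟨w, hw⟩, hwa, rfl⟩
    refine Submodule.span_mono ?_ (symbol_mem_span (P := parityW r l a)
      (q := fun S => (S.map Prod.fst).sum = a) ?_
      (fun w hw S hS h => parity_eq_of_coeff_ne_zero hw S hS h) hwa hw)
    · rintro _ ⟨S, ⟨-, -, hS⟩, rfl⟩
      refine ⟨S.toList, ?_, rfl⟩
      rw [← Multiset.coe_toList S] at hS
      exact hS
    · rintro S rfl
      have := mon_wgen_mem_parityW S.toList
      rwa [← Multiset.sum_coe, ← Multiset.map_coe, Multiset.coe_toList] at this
  · refine Submodule.span_le.2 ?_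
    rintro _ ⟨L, rfl, rfl⟩
    rw [mon_grGen]
    exact Submodule.mem_iSup_of_mem (L.map gdeg).sum
      ⟨⟨_, mon_wgen_mem L⟩, mon_wgen_mem_parityW L, rfl⟩

/-! ### The isomorphism -/

/-- The linear map that sends the basis vectors of the annihilator to the symbols of the
generators. -/
def annToGr : gChi r l →ₗ[ℂ] (kazhdanW r l).Gr :=
  (∑ y, (LinearMap.toSpanSingleton ℂ _ (grGen y)) ∘ₗ annCoord y) ∘ₗ (gChi r l).subtype

/-- The basis vectors of the annihilator, as elements of the annihilator. -/
def annBasis (y : GenIndex r l) : gChi r l := ⟨annVector y, annVector_mem_gChi y⟩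

theorem annToGr_annBasis (y : GenIndex r l) : annToGr (annBasis y) = grGen y := by
  have : annToGr (annBasis y) = ∑ z, annCoord z (annVector y) • grGen z := by
    simp [annToGr, annBasis]
  rw [this]
  simp [annCoord_annVector]

theorem eq_sum_annBasis (x : gChi r l) :
    x = ∑ y, annCoord y (x : Queer (Fin r × Fin l)) • annBasis y := by
  ext1
  rw [AddSubmonoidClass.coe_finsetSum]
  exact eq_sum_annVector x.2

theorem gChiParity_le_span (a : ZMod 2) : gChiParity r l a ≤
    Submodule.span ℂ (annBasis '' {y : GenIndex r l | y.1 = a}) := by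
  intro x hx
  rw [eq_sum_annBasis x]
  refine sum_mem fun y _ => ?_
  by_cases hy : y.1 = a
  · exact Submodule.smul_mem _ _ (Submodule.subset_span ⟨y, hy, rfl⟩)
  · have : annCoord y (x : Queer (Fin r × Fin l)) = 0 := by
      change part y.1 _ _ _ = 0
      exact congrFun₂ (part_eq_zero_of_mem_parity hx hy) _ _
    rw [this, zero_smul]
    exact zero_mem _

theorem gChiDegree_le_span (d : ℤ) : gChiDegree r l d ≤
    Submodule.span ℂ (annBasis '' {y : GenIndex r l | gdeg y = d}) := by
  intro x hx
  rw [eq_sum_annBasis x]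
  refine sum_mem fun y _ => ?_
  by_cases hy : gdeg y = d
  · exact Submodule.smul_mem _ _ (Submodule.subset_span ⟨y, hy, rfl⟩)
  · have h := entry_eq_zero_of_mem_dynkin hx (leadLetter y).2.1 (leadLetter y).2.2 (by
      simp only [leadLetter, gdeg] at hy ⊢
      push_cast
      omega)
    have : annCoord y (x : Queer (Fin r × Fin l)) = 0 := by
      change part y.1 _ _ _ = 0
      rcases zmod_two_cases y.1 with h' | h' <;> rw [h']
      · exact h.1
      · exact h.2
    rw [this, zero_smul]
    exact zero_mem _

theorem annToGr_superComm {a b : ZMod 2} {x y : gChi r l} (hx : x ∈ gChiParity r l a)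
    (hy : y ∈ gChiParity r l b) :
    annToGr x * annToGr y = superSign a b • (annToGr y * annToGr x) := by
  rw [← sub_eq_zero, ← Submodule.mem_bot ℂ]
  refine map_mem_of_span ((LinearMap.mulLeft ℂ (annToGr x) -
    superSign a b • LinearMap.mulRight ℂ (annToGr x)) ∘ₗ annToGr) ?_ (gChiParity_le_span b hy)
  rintro _ ⟨z, rfl, rfl⟩
  refine map_mem_of_span ((LinearMap.mulRight ℂ (annToGr (annBasis z)) -
    superSign a z.1 • LinearMap.mulLeft ℂ (annToGr (annBasis z))) ∘ₗ annToGr) ?_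
    (gChiParity_le_span a hx)
  rintro _ ⟨y, rfl, rfl⟩
  simp only [LinearMap.comp_apply, LinearMap.sub_apply, LinearMap.mulRight_apply,
    LinearMap.smul_apply, LinearMap.mulLeft_apply, annToGr_annBasis, Submodule.mem_bot, sub_eq_zero]
  exact grGen_superComm y z

/-- The homomorphism from the symmetric superalgebra of the annihilator to the associated graded
algebra. -/
def symToGr : SGChi r l →ₐ[ℂ] (kazhdanW r l).Gr :=
  RingQuot.liftAlgHom ℂ ⟨TensorAlgebra.lift ℂ annToGr, by
    rintro _ _ ⟨a, b, x, y, hx, hy⟩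
    simpa using annToGr_superComm hx hy⟩

theorem symToGr_of (x : gChi r l) : symToGr (SuperSym.of _ x) = annToGr x := by
  change RingQuot.liftAlgHom ℂ _ (RingQuot.mkAlgHom ℂ _ (TensorAlgebra.ι ℂ x)) = _
  rw [RingQuot.liftAlgHom_mkAlgHom_apply, TensorAlgebra.lift_ι_apply]

/-- The generators of the symmetric superalgebra of the annihilator. -/
def symGen (y : GenIndex r l) : SGChi r l := SuperSym.of _ (annBasis y)

theorem symToGr_mon (L : List (GenIndex r l)) : symToGr (mon symGen L) = mon grGen L := by
  induction L with
  | nil => exact map_one _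
  | cons y L ih => rw [mon_cons, map_mul, ih, symGen, symToGr_of, annToGr_annBasis, mon_cons]

theorem symGen_superComm :
    SuperComm (symGen (r := r) (l := l)) Prod.fst (fun _ _ => ∅) where
  length_le _ _ _ h := absurd h (Set.notMem_empty _)
  comm_mem x y := by
    have h := RingQuot.mkAlgHom_rel ℂ (SymRel.comm (P := gChiParity r l) x.1 y.1 (annBasis x)
      (annBasis y) (annVector_mem_parity x) (annVector_mem_parity y))
    rw [map_smul, map_mul, map_mul] at h
    rw [Set.image_empty, Submodule.span_empty, Submodule.mem_bot, sub_eq_zero]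
    exact h

theorem mem_span_mon_symGen (v : SGChi r l) :
    v ∈ Submodule.span ℂ (Set.range (mon (symGen (r := r) (l := l)))) := by
  obtain ⟨t, rfl⟩ := RingQuot.mkAlgHom_surjective ℂ (SymRel (gChiParity r l)) v
  induction t using TensorAlgebra.induction with
  | algebraMap c =>
    rw [AlgHom.commutes, Algebra.algebraMap_eq_smul_one]
    exact Submodule.smul_mem _ _ (Submodule.subset_span ⟨[], rfl⟩)
  | ι x =>
    change SuperSym.of _ x ∈ _
    rw [eq_sum_annBasis x, map_sum]
    refine sum_mem fun y _ => ?_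
    rw [map_smul]
    exact Submodule.smul_mem _ _ (Submodule.subset_span ⟨[y], by simp [symGen]⟩)
  | mul s t hs ht =>
    rw [map_mul]
    have h3 := Submodule.mul_mem_mul hs ht
    rw [Submodule.span_mul_span] at h3
    refine Submodule.span_mono ?_ h3
    rintro _ ⟨_, ⟨x, rfl⟩, _, ⟨M, rfl⟩, rfl⟩
    exact ⟨x ++ M, by simp⟩
  | add s t hs ht =>
    rw [map_add]
    exact add_mem hs ht

/-- The normal monomials in the basis vectors span the symmetric superalgebra. -/
theorem mem_span_normal_symGen (v : SGChi r l) : v ∈ Submodule.span ℂ (Set.range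
    fun S : {S : Multiset (GenIndex r l) // Good Prod.fst S} => mon symGen S.1.toList) := by
  refine map_mem_of_span LinearMap.id ?_ (mem_span_mon_symGen v)
  rintro _ ⟨L, rfl⟩
  refine Submodule.span_mono ?_ (symGen_superComm.mem_span_normal (J := fun _ => True)
    (fun _ _ _ _ _ _ => trivial) Multiset.toList Multiset.coe_toList L trivial)
  rintro _ ⟨S, hS, -, rfl⟩
  exact ⟨⟨S, hS⟩, rfl⟩

theorem symToGr_injective : Function.Injective (symToGr (r := r) (l := l)) := by
  rw [injective_iff_map_eq_zero]
  intro v hv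
  obtain ⟨c, rfl⟩ := (Finsupp.mem_span_range_iff_exists_finsupp).1 (mem_span_normal_symGen v)
  rw [Finsupp.sum, map_sum] at hv
  simp only [map_smul, symToGr_mon] at hv
  have := (linearIndependent_iff.1 linearIndependent_mon_grGen) c hv
  rw [this, Finsupp.sum_zero_index]

theorem symToGr_surjective : Function.Surjective (symToGr (r := r) (l := l)) := by
  have : LinearMap.range (symToGr (r := r) (l := l)).toLinearMap = ⊤ := by
    rw [eq_top_iff, ← AlgFiltration.iSup_grDegree]
    refine iSup_le fun k => ?_
    rw [grDegree_eq_span]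
    refine Submodule.span_le.2 ?_
    rintro _ ⟨L, -, rfl⟩
    exact ⟨_, symToGr_mon L⟩
  exact LinearMap.range_eq_top.1 this

/-- The isomorphism matches the monomials of degree `k`, for any grading that is defined on the
basis vectors; this covers both the Kazhdan degree and the parity. -/
theorem degreePart_symGen {κ : Type} [AddMonoid κ] {D : κ → Submodule ℂ (gChi r l)}
    {w : GenIndex r l → κ} (hD : ∀ d, D d ≤ Submodule.span ℂ (annBasis '' {y | w y = d}))
    (hb : ∀ y, annBasis y ∈ D (w y)) (k : κ) :
    (degreePart (SuperSym.of (gChiParity r l)) D k).map symToGr.toLinearMap =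
      Submodule.span ℂ (mon grGen '' {L : List (GenIndex r l) | (L.map w).sum = k}) := by
  have h : degreePart (SuperSym.of (gChiParity r l)) D k =
      Submodule.span ℂ (mon symGen '' {L : List (GenIndex r l) | (L.map w).sum = k}) := by
    refine le_antisymm (degreePart_le_span hD k) (Submodule.span_le.2 ?_)
    rintro _ ⟨L, rfl, rfl⟩
    exact mon_mem_degreePart hb L
  rw [h, Submodule.map_span, Set.image_image]
  congr 1
  exact Set.image_congr fun L _ => symToGr_mon L

theorem map_symm_map_ofBijective {A B : Type} [Ring A] [Ring B] [Algebra ℂ A] [Algebra ℂ B]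
    (f : A →ₐ[ℂ] B) (hf : Function.Bijective f) (N : Submodule ℂ A) :
    (N.map f.toLinearMap).map (AlgEquiv.ofBijective f hf).symm.toLinearMap = N := by
  have h : (AlgEquiv.ofBijective f hf).symm.toLinearMap ∘ₗ f.toLinearMap = LinearMap.id :=
    LinearMap.ext (AlgEquiv.ofBijective f hf).symm_apply_apply
  rw [← Submodule.map_comp, h, Submodule.map_id]

end Graded

end QueerW

end

open QueerW in
theorem mainTheorem4 (r l : ℕ) (hl : 0 < l) :
    IsGoodGrading (dynkin r l) (chi r l) ∧ dynkin r l (-1) = ⊥ ∧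
    ∃ Ψ : (kazhdanW r l).Gr ≃ₐ[ℂ] SGChi r l,
      (∀ k : ℤ, ((kazhdanW r l).grDegree k).map Ψ.toLinearMap = symDegree r l k) ∧
      (∀ a : ZMod 2, ((kazhdanW r l).grSub (parityW r l a)).map Ψ.toLinearMap = symParity r l a) := by
  refine ⟨isGoodGrading_dynkin, dynkin_neg_one,
    (AlgEquiv.ofBijective symToGr ⟨symToGr_injective, symToGr_surjective⟩).symm,
    fun k => ?_, fun a => ?_⟩
  · rw [grDegree_eq_span, ← degreePart_symGen gChiDegree_le_span annVector_mem_dynkin k]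
    exact map_symm_map_ofBijective _ _ _
  · rw [grSub_parityW_eq_span, ← degreePart_symGen gChiParity_le_span annVector_mem_parity a]
    exact map_symm_map_ofBijective _ _ _
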